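/- Let $dA$ be area measure on $\mathbb C$, $\mathbb D$ the open unit disc, $\mathbb T$ the unit circle with measure $d\theta/2\pi$, and $d\lambda(z)=\frac{dA(z)}{\pi(1-|z|^2)^2}$ on $\mathbb D$. For $\beta>0$ let $F^2_\beta$ be the Hilbert space of entire functions in $L^2(\mathbb C,d\mu_\beta)$, $d\mu_\beta(z)=\frac\beta\pi e^{-\beta|z|^2}dA(z)$; for $\alpha>-1$ let $A^2_\alpha$ be the Hilbert space of analytic functions on $\mathbb D$ in $L^2(\mathbb D,dA_\alpha)$, $dA_\alpha(z)=\frac{\alpha+1}\pi(1-|z|^2)^\alpha dA(z)$. Put $$W^\beta_z\phi(\zeta)=\phi(\zeta-z)\,e^{\beta\bar z\zeta-\beta|z|^2/2}\quad(z,\zeta\in\mathbb C),\qquad U^\alpha_z\phi(\zeta)=\phi\Big(\frac{\zeta-z}{1-\bar z\zeta}\Big)\Big[\frac{1-|z|^2}{(1-\bar z\zeta)^2}\Big]^{(2+\alpha)/2}\quad(z,\zeta\in\mathbb D),$$ with the principal branch of the power, and $\phi_\theta(\zeta)=\phi(e^{i\theta}\zeta)$. For windows $\phi,\psi$ in $F^2_\beta$,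 respectively in $A^2_\alpha$, and a symbol $f$ in $L^\infty(\mathbb T\times\mathbb C)$, respectively in $L^\infty(\mathbb T\times\mathbb D)$, the localization operators $\mathbb L_f^{\phi,\psi,\beta}$ on $F^2_\beta$ and $\mathbf L_f^{\phi,\psi,\alpha}$ on $A^2_\alpha$ are the bounded linear operators determined by $$\langle\mathbb L_f^{\phi,\psi,\beta}g,h\rangle_{F^2_\beta}=\frac\beta\pi\int_0^{2\pi}\frac{d\theta}{2\pi}\int_{\mathbb C}f(e^{i\theta},z)\,\langle g,W^\beta_z\phi_\theta\rangle\langle W^\beta_z\psi_\theta,h\rangle\,dA(z),\qquad g,h\in F^2_\beta,$$ $$\langle\mathbf L_f^{\phi,\psi,\alpha}g,h\rangle_{A^2_\alpha}=(\alpha+1)\int_0^{2\pi}\frac{d\theta}{2\pi}\int_{\mathbb D}f(e^{i\theta},z)\,\langle g,U^\alpha_z\phi_\theta\rangle\langle U^\alpha_z\psi_\theta,h\rangle\,d\lambda(z),\qquad g,h\in A^2_\alpha.$$ **Theorem.** Let $\beta>0$, $\phi,\psi\in F^2_\beta$, $f\in L^\infty(\mathbb T\times\mathbb C)$ and $\sigma\ge0$.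 For $r>0$ write $u_r(z)=u(rz)$ for entire functions $u$, and $f_{r,\sigma}(e^{i\theta},z)=(1-|z|^2)^\sigma f(e^{i\theta},rz)$ for $z\in\mathbb D$. Then the operators $\mathbb L_f^{\phi,\psi,\beta}$ on $F^2_\beta$ and, for every $r>0$, $\mathbf L_{f_{r,\sigma}}^{\phi_r,\psi_r,\beta r^2}$ on $A^2_{\beta r^2}$ are well defined (the integrals above converge absolutely and define bounded operators), and $$\lim_{r\to\infty}\big\langle\mathbf L_{f_{r,\sigma}}^{\phi_r,\psi_r,\beta r^2}g_r,\,h_r\big\rangle_{A^2_{\beta r^2}}=\big\langle\mathbb L_f^{\phi,\psi,\beta}g,\,h\big\rangle_{F^2_\beta}\qquad\text{for all }g,h\in F^2_\beta.$$ -/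

import Mathlib

open MeasureTheory Filter Topology Complex
open scoped ENNReal ComplexConjugate

noncomputable section

/-! ### Measures -/

instance instMeasurableSpaceCircle : MeasurableSpace Circle := borel Circle

instance instBorelSpaceCircle : BorelSpace Circle := ⟨rfl⟩

/-- The normalised arc length `dθ / 2π` on the unit circle `𝕋`. -/
def circleMeasure : Measure Circle :=
  Measure.map Circle.exp
    (ENNReal.ofReal (1 / (2 * Real.pi)) • volume.restrict (Set.Ioc 0 (2 * Real.pi)))

/-- The open unit disc `𝔻`, as a subset of `ℂ`. -/
def disc : Set ℂ := Metric.ball 0 1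

/-- The Gaussian measure `dμ_β = (β/π) exp(-β|z|²) dA` on `ℂ`. -/
def fockMeasure (β : ℝ) : Measure ℂ :=
  volume.withDensity fun z => ENNReal.ofReal (β / Real.pi * Real.exp (-β * ‖z‖ ^ 2))

/-- The measure `dA_α = ((α+1)/π) (1-|z|²)^α dA` on the unit disc. -/
def bergmanMeasure (α : ℝ) : Measure ℂ :=
  (volume.restrict disc).withDensity fun z =>
    ENNReal.ofReal ((α + 1) / Real.pi * (1 - ‖z‖ ^ 2) ^ α)

/-- The Möbius invariant area measure `dλ = dA / (π (1-|z|²)²)` on the unit disc. -/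
def moebiusMeasure : Measure ℂ :=
  (volume.restrict disc).withDensity fun z =>
    ENNReal.ofReal (1 / (Real.pi * (1 - ‖z‖ ^ 2) ^ 2))

/-! ### The Fock space and the weighted Bergman spaces -/

/-- `φ ∈ F²_β`: the function `φ` is entire and square integrable for `μ_β`. -/
def MemFock (β : ℝ) (φ : ℂ → ℂ) : Prop :=
  Differentiable ℂ φ ∧ MemLp φ 2 (fockMeasure β)

/-- `φ ∈ A²_α`: the function `φ` is analytic on the unit disc and square integrable for `A_α`
(its values outside the disc are irrelevant). -/
def MemBergman (α : ℝ) (φ : ℂ → ℂ) : Prop :=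
  DifferentiableOn ℂ φ disc ∧ MemLp φ 2 (bergmanMeasure α)

/-- The Fock space `F²_β` as an inner product space: the subspace of `L²(ℂ, μ_β)` of the classes
of functions in `F²_β`. -/
def FockSpace (β : ℝ) : Submodule ℂ (Lp ℂ 2 (fockMeasure β)) where
  carrier := {u | ∃ φ : ℂ → ℂ, Differentiable ℂ φ ∧ u =ᵐ[fockMeasure β] φ}
  zero_mem' := ⟨0, differentiable_const 0, Lp.coeFn_zero _ _ _⟩
  add_mem' := by
    rintro u v ⟨φ, hφ, hu⟩ ⟨ψ, hψ, hv⟩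
    exact ⟨φ + ψ, hφ.add hψ, (Lp.coeFn_add u v).trans (hu.add hv)⟩
  smul_mem' := by
    rintro c u ⟨φ, hφ, hu⟩
    exact ⟨c • φ, hφ.const_smul c, (Lp.coeFn_smul c u).trans (hu.const_smul c)⟩

/-- The weighted Bergman space `A²_α` as an inner product space: the subspace of `L²(𝔻, A_α)` of
the classes of functions in `A²_α`. -/
def BergmanSpace (α : ℝ) : Submodule ℂ (Lp ℂ 2 (bergmanMeasure α)) where
  carrier := {u | ∃ φ : ℂ → ℂ, DifferentiableOn ℂ φ disc ∧ u =ᵐ[bergmanMeasure α] φ}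
  zero_mem' := ⟨0, differentiableOn_const 0, Lp.coeFn_zero _ _ _⟩
  add_mem' := by
    rintro u v ⟨φ, hφ, hu⟩ ⟨ψ, hψ, hv⟩
    exact ⟨φ + ψ, hφ.add hψ, (Lp.coeFn_add u v).trans (hu.add hv)⟩
  smul_mem' := by
    rintro c u ⟨φ, hφ, hu⟩
    exact ⟨c • φ, hφ.const_smul c, (Lp.coeFn_smul c u).trans (hu.const_smul c)⟩

/-- A function in `F²_β` as a vector of the inner product space. -/
def MemFock.toSpace {β : ℝ} {φ : ℂ → ℂ} (h : MemFock β φ) : FockSpace β :=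
  ⟨h.2.toLp φ, φ, h.1, h.2.coeFn_toLp⟩

/-- A function in `A²_α` as a vector of the inner product space. -/
def MemBergman.toSpace {α : ℝ} {φ : ℂ → ℂ} (h : MemBergman α φ) : BergmanSpace α :=
  ⟨h.2.toLp φ, φ, h.1, h.2.coeFn_toLp⟩

/-- The inner product `⟨u, v⟩ = ∫ u conj(v) dμ_β` of `F²_β`, for functions; linear in `u`. -/
def fockInner (β : ℝ) (u v : ℂ → ℂ) : ℂ := ∫ ζ, u ζ * conj (v ζ) ∂fockMeasure β

/-- The inner product `⟨u, v⟩ = ∫ u conj(v) dA_α` of `A²_α`, for functions; linear in `u`. -/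
def bergmanInner (α : ℝ) (u v : ℂ → ℂ) : ℂ := ∫ ζ, u ζ * conj (v ζ) ∂bergmanMeasure α

/-! ### Rotations, dilations, and the unitary operators -/

/-- `φ_θ(ζ) = φ(e^{iθ} ζ)`, where `c = e^{iθ}`. -/
def rotate (c : Circle) (φ : ℂ → ℂ) : ℂ → ℂ := fun ζ => φ (c * ζ)

/-- `φ_r(ζ) = φ(r ζ)`. -/
def dilate (r : ℝ) (φ : ℂ → ℂ) : ℂ → ℂ := fun ζ => φ (r * ζ)

/-- The Weyl operator `W^β_z φ(ζ) = φ(ζ - z) exp(β conj(z) ζ - β|z|²/2)`. -/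
def weyl (β : ℝ) (z : ℂ) (φ : ℂ → ℂ) : ℂ → ℂ := fun ζ =>
  φ (ζ - z) * Complex.exp (β * conj z * ζ - ((β * ‖z‖ ^ 2 / 2 : ℝ) : ℂ))

/-- The Möbius map `φ_z(ζ) = (ζ - z) / (1 - conj(z) ζ)` of the unit disc. -/
def moebius (z ζ : ℂ) : ℂ := (ζ - z) / (1 - conj z * ζ)

/-- `U^α_z φ(ζ) = φ(φ_z(ζ)) [(1-|z|²) / (1 - conj(z) ζ)²]^{(2+α)/2}` (principal branch: for
`z, ζ` in the disc the base lies in the slit plane). -/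
def bergmanU (α : ℝ) (z : ℂ) (φ : ℂ → ℂ) : ℂ → ℂ := fun ζ =>
  φ (moebius z ζ) *
    (((1 - ‖z‖ ^ 2 : ℝ) : ℂ) / (1 - conj z * ζ) ^ 2) ^ (((2 + α) / 2 : ℝ) : ℂ)

/-! ### Localization operators -/

/-- The integrand `f(e^{iθ}, z) ⟨g, W_z φ_θ⟩ ⟨W_z ψ_θ, h⟩`. -/
def fockIntegrand (β : ℝ) (φ ψ : ℂ → ℂ) (f : Circle × ℂ → ℂ) (g h : ℂ → ℂ) (p : Circle × ℂ) : ℂ :=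
  f p * fockInner β g (weyl β p.2 (rotate p.1 φ)) * fockInner β (weyl β p.2 (rotate p.1 ψ)) h

/-- The integrand `f(e^{iθ}, z) ⟨g, U_z φ_θ⟩ ⟨U_z ψ_θ, h⟩`. -/
def bergmanIntegrand (α : ℝ) (φ ψ : ℂ → ℂ) (f : Circle × ℂ → ℂ) (g h : ℂ → ℂ)
    (p : Circle × ℂ) : ℂ :=
  f p * bergmanInner α g (bergmanU α p.2 (rotate p.1 φ)) *
    bergmanInner α (bergmanU α p.2 (rotate p.1 ψ)) h

/-- `T` is the localization operator on `F²_β` with symbol `f` and windows `φ`, `ψ`: the defining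
integral converges absolutely and
`⟨T g, h⟩ = (β/π) ∫ dθ/2π ∫_ℂ f(e^{iθ}, z) ⟨g, W_z φ_θ⟩ ⟨W_z ψ_θ, h⟩ dA(z)` for all `g, h`.
Mathlib's `inner ℂ x y` is linear in `y`, so it is `⟨y, x⟩` in the notation above. -/
def IsFockLocalization (β : ℝ) (φ ψ : ℂ → ℂ) (f : Circle × ℂ → ℂ)
    (T : FockSpace β →L[ℂ] FockSpace β) : Prop :=
  ∀ g h : FockSpace β,
    Integrable (fockIntegrand β φ ψ f g.1 h.1) (circleMeasure.prod volume) ∧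
    inner ℂ h (T g) =
      (β / Real.pi : ℂ) * ∫ c, ∫ z, fockIntegrand β φ ψ f g.1 h.1 (c, z) ∂volume ∂circleMeasure

/-- `T` is the localization operator on `A²_α` with symbol `f` and windows `φ`, `ψ`: the defining
integral converges absolutely and
`⟨T g, h⟩ = (α+1) ∫ dθ/2π ∫_𝔻 f(e^{iθ}, z) ⟨g, U_z φ_θ⟩ ⟨U_z ψ_θ, h⟩ dλ(z)` for all `g, h`. -/
def IsBergmanLocalization (α : ℝ) (φ ψ : ℂ → ℂ) (f : Circle × ℂ → ℂ)
    (T : BergmanSpace α →L[ℂ] BergmanSpace α) : Prop :=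
  ∀ g h : BergmanSpace α,
    Integrable (bergmanIntegrand α φ ψ f g.1 h.1) (circleMeasure.prod moebiusMeasure) ∧
    inner ℂ h (T g) =
      (α + 1 : ℂ) *
        ∫ c, ∫ z, bergmanIntegrand α φ ψ f g.1 h.1 (c, z) ∂moebiusMeasure ∂circleMeasure

theorem IsFockLocalization.unique {β : ℝ} {φ ψ : ℂ → ℂ} {f : Circle × ℂ → ℂ}
    {S T : FockSpace β →L[ℂ] FockSpace β} (hS : IsFockLocalization β φ ψ f S)
    (hT : IsFockLocalization β φ ψ f T) : S = T :=
  ContinuousLinearMap.ext fun g =>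
    ext_inner_left ℂ fun h => (hS g h).2.trans (hT g h).2.symm

theorem IsBergmanLocalization.unique {α : ℝ} {φ ψ : ℂ → ℂ} {f : Circle × ℂ → ℂ}
    {S T : BergmanSpace α →L[ℂ] BergmanSpace α} (hS : IsBergmanLocalization α φ ψ f S)
    (hT : IsBergmanLocalization α φ ψ f T) : S = T :=
  ContinuousLinearMap.ext fun g =>
    ext_inner_left ℂ fun h => (hS g h).2.trans (hT g h).2.symm

open Classical in
/-- The localization operator on `F²_β` with symbol `f` and windows `φ`, `ψ` (the zero operator
if there is no bounded operator with the defining property). -/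
def fockLocalization (β : ℝ) (φ ψ : ℂ → ℂ) (f : Circle × ℂ → ℂ) :
    FockSpace β →L[ℂ] FockSpace β :=
  if h : ∃ T, IsFockLocalization β φ ψ f T then h.choose else 0

open Classical in
/-- The localization operator on `A²_α` with symbol `f` and windows `φ`, `ψ` (the zero operator
if there is no bounded operator with the defining property). -/
def bergmanLocalization (α : ℝ) (φ ψ : ℂ → ℂ) (f : Circle × ℂ → ℂ) :
    BergmanSpace α →L[ℂ] BergmanSpace α :=
  if h : ∃ T, IsBergmanLocalization α φ ψ f T then h.choose else 0

/-- The rescaled symbol `f_{r,σ}(e^{iθ}, z) = (1-|z|²)^σ f(e^{iθ}, r z)`. -/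
def dilateSymbol (r σ : ℝ) (f : Circle × ℂ → ℂ) : Circle × ℂ → ℂ := fun p =>
  (((1 - ‖p.2‖ ^ 2) ^ σ : ℝ) : ℂ) * f (p.1, r * p.2)

/-! ### Dilations of entire functions lie in the Bergman spaces -/

theorem isFiniteMeasure_bergmanMeasure {α : ℝ} (hα : 0 ≤ α) :
    IsFiniteMeasure (bergmanMeasure α) := by
  refine isFiniteMeasure_withDensity (ne_of_lt ?_)
  have hfin : IsFiniteMeasure ((volume : Measure ℂ).restrict disc) :=
    ⟨by rw [Measure.restrict_apply_univ]; exact measure_ball_lt_top⟩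
  refine lt_of_le_of_lt (b := ∫⁻ _ in disc, ENNReal.ofReal ((α + 1) / Real.pi)) ?_ ?_
  · refine setLIntegral_mono' Metric.isOpen_ball.measurableSet fun z hz => ?_
    have hz1 : ‖z‖ < 1 := by simpa [disc] using hz
    have h0 : 0 ≤ 1 - ‖z‖ ^ 2 := by nlinarith [norm_nonneg z]
    have h1 : 1 - ‖z‖ ^ 2 ≤ 1 := by nlinarith [norm_nonneg z]
    refine ENNReal.ofReal_le_ofReal ?_
    have hc : 0 ≤ (α + 1) / Real.pi := by positivity
    exact mul_le_of_le_one_right hc (Real.rpow_le_one h0 h1 hα)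
  · rw [lintegral_const]
    exact ENNReal.mul_lt_top ENNReal.ofReal_lt_top (measure_lt_top _ _)

theorem MemFock.dilate {β : ℝ} (hβ : 0 < β) {φ : ℂ → ℂ} (h : MemFock β φ) (r : ℝ) :
    MemBergman (β * r ^ 2) (dilate r φ) := by
  have hd : Differentiable ℂ (_root_.dilate r φ) :=
    h.1.comp ((differentiable_const (r : ℂ)).mul differentiable_id)
  refine ⟨hd.differentiableOn, ?_⟩
  have := isFiniteMeasure_bergmanMeasure (α := β * r ^ 2) (by positivity)
  obtain ⟨C, hC⟩ := (isCompact_closedBall (0 : ℂ) 1).exists_bound_of_continuousOn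
    hd.continuous.continuousOn
  refine MemLp.of_bound hd.continuous.aestronglyMeasurable C ?_
  refine (withDensity_absolutelyContinuous _ _).ae_le ?_
  filter_upwards [ae_restrict_mem (μ := volume) (Metric.isOpen_ball (x := (0 : ℂ)) (ε := 1)).measurableSet]
    with z hz
  exact hC z (Metric.ball_subset_closedBall hz)

end

/-!
# Localization operators on Bergman spaces converge weakly to those on the Fock space

The substitution `z = w / r` turns the disc, the measure of `A²_{βr²}` and the operators
`U_{w/r}` into objects on the disc of radius `r` which, as `r → ∞`, converge pointwise to `ℂ`, to
the Gaussian measure and to the Weyl operators `W_w`: the density `(1 - |w|²/r²)^{βr²}` tends to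
`exp(-β|w|²)`, and the Jacobian factor of `U_{w/r}`, raised to the power `(2 + βr²)/2`, tends to
the exponential in `W_w` (`tendsto_bergmanScaled`, `tendsto_bergmanU`). What has to be justified is
the passage to the limit under two integrals, neither of which has an evident fixed dominating
function.

Both times the tool is dominated convergence with a varying majorant
(`tendsto_integral_of_tendsto_lintegral_bound`): it is enough that the majorants converge pointwise
and that their integrals converge to the integral of the limit. For the inner products
`⟨g_r, U_{w/r} φ_{r,θ}⟩` the majorant comes from `|ab| ≤ |a|² + |b|²`, and its integral is
`‖g_r‖² + ‖φ_r‖²` because `U_z` is isometric; the norms `‖g_r‖` in `A²_{βr²}` do converge to `‖g‖`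
(`tendsto_lintegral_dilate_sq`, `tendsto_bergmanInner`). For the outer integral over the phase
space the same inequality is used, and the integrals of the majorants are known *exactly* thanks to
the Schur orthogonality relations (`lintegral_bergmanInner_sq`, `lintegral_fockInner_sq`)

`(α + 1) ∫ dθ/2π ∫ |⟨g, U_z φ_θ⟩|² dλ(z) = ‖g‖² ‖φ‖²` and
`(β/π) ∫ dθ/2π ∫ |⟨g, W_z φ_θ⟩|² dA(z) = ‖g‖² ‖φ‖²`,

so they converge as well. The same relations show that the defining integrals converge absolutely
and, the spaces being complete, that they define bounded operators (`exists_clm_inner_eq_integral`,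
`completeSpace_fockSpace`, `completeSpace_bergmanSpace`).

The Schur relations are proved for both spaces at once in `lintegral_inner_rotate_eq`, without
representation theory. In a rotation invariant `L²` space the average of `|⟨G, φ_θ⟩|²` over `θ` is
`∑ |a_n|² |b_n|² m_n²`, where `a_n`, `b_n` are the Taylor coefficients of `G`, `φ` and `m_n` is the
squared norm of `ζ ^ n`. With `G = U_{-z} g` it remains to compute the integrals over `z` of
`|a_n|²`. By the invariance of the measures, the circular means of `|U_{-z} g|²`, integrated over
`z`, are `‖g‖²` times those for the constant function `1`; comparing power series in the radius, the
same holds for the integrals of `|a_n|²`. For `g = 1` they are read off from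
`⟨U_{-z} 1, ζ ^ n⟩ = conj ((U_z ζ ^ n)(0))`.
-/

/-! ### Dominated convergence with a varying majorant -/

/-- The case of sequences: Fatou's lemma for `G i + G₀ - ‖k i - k₀‖` gives `L¹` convergence. -/
theorem tendsto_integral_of_tendsto_lintegral_bound_nat {X : Type*} [MeasurableSpace X]
    {μ : Measure X} {k : ℕ → X → ℂ} {k₀ : X → ℂ} {G : ℕ → X → ℝ≥0∞} {G₀ : X → ℝ≥0∞}
    (hk : ∀ i, AEStronglyMeasurable (k i) μ) (hG : ∀ i, AEMeasurable (G i) μ)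
    (hb : ∀ i, ∀ᵐ x ∂μ, ‖k i x‖ₑ ≤ G i x)
    (hklim : ∀ᵐ x ∂μ, Tendsto (fun i => k i x) atTop (𝓝 (k₀ x)))
    (hGlim : ∀ᵐ x ∂μ, Tendsto (fun i => G i x) atTop (𝓝 (G₀ x)))
    (hint : Tendsto (fun i => ∫⁻ x, G i x ∂μ) atTop (𝓝 (∫⁻ x, G₀ x ∂μ)))
    (hfin : ∫⁻ x, G₀ x ∂μ ≠ ∞) :
    Tendsto (fun i => ∫ x, k i x ∂μ) atTop (𝓝 (∫ x, k₀ x ∂μ)) := by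
  have hk₀ : AEStronglyMeasurable k₀ μ := aestronglyMeasurable_of_tendsto_ae atTop hk hklim
  have hG₀ : AEMeasurable G₀ μ := aemeasurable_of_tendsto_metrizable_ae atTop hG hGlim
  have hb₀ : ∀ᵐ x ∂μ, ‖k₀ x‖ₑ ≤ G₀ x := by
    filter_upwards [ae_all_iff.2 hb, hklim, hGlim] with x h1 h2 h3
    exact le_of_tendsto_of_tendsto' h2.enorm h3 h1
  have hG₀fin : ∀ᵐ x ∂μ, G₀ x ≠ ∞ :=
    (ae_lt_top' hG₀ hfin).mono fun x hx => hx.ne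
  set d : ℕ → X → ℝ≥0∞ := fun i x => ‖k i x - k₀ x‖ₑ with hd
  have hdm : ∀ i, AEMeasurable (d i) μ := fun i => ((hk i).sub hk₀).enorm
  set S : ℕ → X → ℝ≥0∞ := fun i x => G i x + G₀ x - d i x with hS
  have hSm : ∀ i, AEMeasurable (S i) μ := fun i => ((hG i).add hG₀).sub (hdm i)
  have hSlim : ∀ᵐ x ∂μ, Tendsto (fun i => S i x) atTop (𝓝 (G₀ x + G₀ x)) := by
    filter_upwards [hklim, hGlim, hG₀fin] with x h2 h3 h4
    have hd0 : Tendsto (fun i => d i x) atTop (𝓝 0) := by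
      have := (h2.sub_const (k₀ x)).enorm
      simpa using this
    simpa using ENNReal.Tendsto.sub (h3.add_const (G₀ x)) hd0 (Or.inr ENNReal.zero_ne_top)
  have hsum : ∀ i, ∫⁻ x, d i x ∂μ + ∫⁻ x, S i x ∂μ = ∫⁻ x, G i x ∂μ + ∫⁻ x, G₀ x ∂μ := by
    intro i
    rw [← lintegral_add_left' (hdm i), ← lintegral_add_left' (hG i)]
    refine lintegral_congr_ae ?_
    filter_upwards [hb i, hb₀] with x h1 h2
    exact add_tsub_cancel_of_le ((enorm_sub_le).trans (add_le_add h1 h2))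
  set I := ∫⁻ x, G₀ x ∂μ
  have hJ : Tendsto (fun i => ∫⁻ x, G i x ∂μ + I) atTop (𝓝 (I + I)) := hint.add_const I
  have hlow : I + I ≤ liminf (fun i => ∫⁻ x, S i x ∂μ) atTop := by
    rw [← lintegral_add_left' hG₀]
    refine le_trans (le_of_eq ?_) (lintegral_liminf_le' hSm)
    exact lintegral_congr_ae (hSlim.mono fun x hx => hx.liminf_eq.symm)
  have hup : limsup (fun i => ∫⁻ x, S i x ∂μ) atTop ≤ I + I := by
    rw [← hJ.limsup_eq]
    exact limsup_le_limsup (Eventually.of_forall fun i => by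
      show ∫⁻ x, S i x ∂μ ≤ ∫⁻ x, G i x ∂μ + I
      rw [← hsum i]; exact le_add_self)
  have hSI : Tendsto (fun i => ∫⁻ x, S i x ∂μ) atTop (𝓝 (I + I)) :=
    tendsto_of_le_liminf_of_limsup_le hlow hup
  have hII : I + I ≠ ∞ := ENNReal.add_ne_top.2 ⟨hfin, hfin⟩
  have hD : Tendsto (fun i => ∫⁻ x, d i x ∂μ) atTop (𝓝 0) := by
    have h0 := ENNReal.Tendsto.sub hJ hSI (Or.inl hII)
    rw [tsub_self] at h0
    refine h0.congr' ?_
    filter_upwards [hSI.eventually_lt_const hII.lt_top] with i hi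
    rw [← hsum i, ENNReal.add_sub_cancel_right hi.ne]
  refine tendsto_integral_of_L1 k₀ hk₀ ?_ hD
  filter_upwards [hint.eventually_lt_const hfin.lt_top] with i hi
  exact ⟨hk i, (lintegral_mono_ae (hb i)).trans_lt hi⟩

/-- Dominated convergence with a varying majorant: the majorants `G i` only have to converge
pointwise, together with their integrals. -/
theorem tendsto_integral_of_tendsto_lintegral_bound {X ι : Type*} [MeasurableSpace X]
    {μ : Measure X} {l : Filter ι} [l.IsCountablyGenerated]
    {k : ι → X → ℂ} {k₀ : X → ℂ} {G : ι → X → ℝ≥0∞} {G₀ : X → ℝ≥0∞}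
    (hk : ∀ᶠ i in l, AEStronglyMeasurable (k i) μ) (hG : ∀ᶠ i in l, AEMeasurable (G i) μ)
    (hb : ∀ᶠ i in l, ∀ᵐ x ∂μ, ‖k i x‖ₑ ≤ G i x)
    (hklim : ∀ᵐ x ∂μ, Tendsto (fun i => k i x) l (𝓝 (k₀ x)))
    (hGlim : ∀ᵐ x ∂μ, Tendsto (fun i => G i x) l (𝓝 (G₀ x)))
    (hint : Tendsto (fun i => ∫⁻ x, G i x ∂μ) l (𝓝 (∫⁻ x, G₀ x ∂μ)))
    (hfin : ∫⁻ x, G₀ x ∂μ ≠ ∞) :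
    Tendsto (fun i => ∫ x, k i x ∂μ) l (𝓝 (∫ x, k₀ x ∂μ)) := by
  refine tendsto_of_seq_tendsto fun u hu => ?_
  obtain ⟨N, hN⟩ := eventually_atTop.1 (hu.eventually (hk.and (hG.and hb)))
  rw [← tendsto_add_atTop_iff_nat N]
  have hu' : Tendsto (fun n => u (n + N)) atTop l := (tendsto_add_atTop_iff_nat N).2 hu
  exact tendsto_integral_of_tendsto_lintegral_bound_nat
    (fun n => (hN (n + N) le_add_self).1) (fun n => (hN (n + N) le_add_self).2.1)
    (fun n => (hN (n + N) le_add_self).2.2) (hklim.mono fun x hx => hx.comp hu')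
    (hGlim.mono fun x hx => hx.comp hu') (hint.comp hu') hfin

theorem enorm_mul_le_sq_add_sq (a b : ℂ) : ‖a‖ₑ * ‖b‖ₑ ≤ ‖a‖ₑ ^ 2 + ‖b‖ₑ ^ 2 := by
  rcases le_total ‖a‖ₑ ‖b‖ₑ with h | h
  · exact le_add_left (by rw [sq]; gcongr)
  · exact le_add_right (by rw [sq]; gcongr)

/-! ### Fourier analysis on the circle -/

instance instIsProbabilityMeasureCircle : IsProbabilityMeasure circleMeasure := by
  refine ⟨?_⟩
  rw [circleMeasure, Measure.map_apply (by fun_prop) MeasurableSet.univ]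
  simp only [Set.preimage_univ, Measure.smul_apply, Measure.restrict_apply_univ, Real.volume_Ioc,
    smul_eq_mul]
  rw [← ENNReal.ofReal_mul (by positivity), sub_zero,
    div_mul_cancel₀ _ (by positivity), ENNReal.ofReal_one]

/-- The measure `circleMeasure` is rotation invariant; this is deduced from the translation
invariance of Lebesgue measure on `ℝ / 2πℤ`. -/
theorem measurePreserving_mul_circleMeasure (u : Circle) :
    MeasurePreserving (fun c : Circle => u * c) circleMeasure circleMeasure := by
  have hT : Fact (0 < 2 * Real.pi) := ⟨by positivity⟩
  have h1 := AddCircle.measurePreserving_mk (2 * Real.pi) 0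
  have hmeas : Measurable (AddCircle.toCircle : AddCircle (2 * Real.pi) → Circle) :=
    AddCircle.continuous_toCircle.measurable
  have hcirc : circleMeasure = ENNReal.ofReal (1 / (2 * Real.pi)) •
      Measure.map (AddCircle.toCircle : AddCircle (2 * Real.pi) → Circle) volume := by
    rw [circleMeasure, Measure.map_smul, ← h1.map_eq, zero_add,
      Measure.map_map hmeas h1.measurable]
    congr 2
    funext x
    simp [AddCircle.toCircle_apply_mk]
  refine ⟨by fun_prop, ?_⟩
  obtain ⟨t, rfl⟩ : ∃ t : AddCircle (2 * Real.pi), AddCircle.toCircle t = u := by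
    refine ⟨((arg (u : ℂ) : ℝ) : AddCircle (2 * Real.pi)), ?_⟩
    rw [AddCircle.toCircle_apply_mk, div_self (by positivity), one_mul, Circle.exp_arg]
  rw [hcirc, Measure.map_smul, Measure.map_map (by fun_prop) hmeas]
  have : (fun c : Circle => AddCircle.toCircle t * c) ∘
      (AddCircle.toCircle : AddCircle (2 * Real.pi) → Circle) =
      AddCircle.toCircle ∘ (fun x => t + x) := by
    funext x
    simp [AddCircle.toCircle_add]
  rw [this, ← Measure.map_map hmeas (by fun_prop), map_add_left_eq_self]

theorem integral_circle_pow_mul_conj (n m : ℕ) :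
    ∫ c : Circle, (c : ℂ) ^ n * conj ((c : ℂ) ^ m) ∂circleMeasure = if n = m then 1 else 0 := by
  have hc : ∀ c : Circle, (c : ℂ) * conj (c : ℂ) = 1 := fun c => by
    rw [mul_conj, Circle.normSq_coe, ofReal_one]
  split_ifs with h
  · subst h
    have : ∀ c : Circle, (c : ℂ) ^ n * conj ((c : ℂ) ^ n) = 1 := fun c => by
      rw [map_pow, ← mul_pow, hc, one_pow]
    simp_rw [this]
    simp
  · set I := ∫ c : Circle, (c : ℂ) ^ n * conj ((c : ℂ) ^ m) ∂circleMeasure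
    have key : ∀ u : Circle, I = ((u : ℂ) ^ n * conj ((u : ℂ) ^ m)) * I := by
      intro u
      have h1 := (measurePreserving_mul_circleMeasure u).integral_comp
        (Homeomorph.mulLeft u).measurableEmbedding
        (fun c : Circle => (c : ℂ) ^ n * conj ((c : ℂ) ^ m))
      rw [← integral_const_mul, ← show _ = I from h1]
      refine integral_congr_ae (Eventually.of_forall fun c => ?_)
      simp only [Circle.coe_mul, mul_pow, map_mul]
      ring
    -- some rotation has `u ^ n ≠ u ^ m`
    set t : ℝ := Real.pi / ((n : ℝ) - m)
    have hnm : (n : ℝ) - m ≠ 0 := sub_ne_zero.2 (by exact_mod_cast h)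
    have h2 := key (Circle.exp t)
    have h3 : ((Circle.exp t : Circle) : ℂ) ^ n * conj (((Circle.exp t : Circle) : ℂ) ^ m) = -1 := by
      rw [Circle.coe_exp, ← Complex.exp_nat_mul, ← Complex.exp_nat_mul, ← Complex.exp_conj,
        ← Complex.exp_add, ← Complex.exp_pi_mul_I]
      congr 1
      have : (Real.pi : ℂ) = t * ((n : ℂ) - m) := by
        have : Real.pi = t * ((n : ℝ) - m) := (div_mul_cancel₀ _ hnm).symm
        exact_mod_cast this
      rw [this]
      simp
      ring
    rw [h3] at h2
    have : (2 : ℂ) * I = 0 := by linear_combination h2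
    simpa using this

/-- The polarised form of Parseval's identity. -/
theorem integral_circle_powerSeries {s t : ℕ → ℂ} (hs : Summable fun n => ‖s n‖)
    (ht : Summable fun n => ‖t n‖) :
    ∫ c : Circle, (∑' n, s n * (c : ℂ) ^ n) * conj (∑' n, t n * (c : ℂ) ^ n) ∂circleMeasure =
      ∑' n, s n * conj (t n) := by
  set F : ℕ × ℕ → Circle → ℂ := fun p c => (s p.1 * (c : ℂ) ^ p.1) * conj (t p.2 * (c : ℂ) ^ p.2)
  have hF : ∀ p c, ‖F p c‖ = ‖s p.1‖ * ‖t p.2‖ := by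
    intro p c
    simp [F, Circle.norm_coe]
  have hst : Summable fun p : ℕ × ℕ => ‖s p.1‖ * ‖t p.2‖ :=
    Summable.mul_of_nonneg hs ht (fun _ => norm_nonneg _) (fun _ => norm_nonneg _)
  have hFc : ∀ p, Continuous (F p) := fun p => by fun_prop
  have hFi : ∀ p, Integrable (F p) circleMeasure := fun p =>
    Integrable.of_bound (hFc p).aestronglyMeasurable (‖s p.1‖ * ‖t p.2‖)
      (Eventually.of_forall fun c => (hF p c).le)
  have hsum : ∀ c : Circle, (∑' n, s n * (c : ℂ) ^ n) * conj (∑' n, t n * (c : ℂ) ^ n) =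
      ∑' p, F p c := by
    intro c
    have h1 : Summable fun n => ‖s n * (c : ℂ) ^ n‖ := by simpa [Circle.norm_coe] using hs
    have h2 : Summable fun n => ‖conj (t n * (c : ℂ) ^ n)‖ := by simpa [Circle.norm_coe] using ht
    rw [conj_tsum, tsum_mul_tsum_of_summable_norm h1 h2]
  simp_rw [hsum]
  rw [← integral_tsum_of_summable_integral_norm hFi (by simpa [hF] using hst)]
  have hval : ∀ p, ∫ c, F p c ∂circleMeasure = if p.1 = p.2 then s p.1 * conj (t p.2) else 0 := by
    intro p
    have : ∀ c, F p c = (s p.1 * conj (t p.2)) * ((c : ℂ) ^ p.1 * conj ((c : ℂ) ^ p.2)) := by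
      intro c; simp only [F, map_mul]; ring
    simp_rw [this]
    rw [integral_const_mul, integral_circle_pow_mul_conj]
    split_ifs <;> simp
  simp_rw [hval]
  rw [Summable.tsum_prod']
  · refine tsum_congr fun n => ?_
    rw [tsum_eq_single n (fun m hm => by simp [hm.symm])]
    simp
  · refine Summable.of_norm_bounded hst fun p => ?_
    split_ifs <;> simp [mul_nonneg]
  · intro n
    refine summable_of_ne_finset_zero (s := {n}) fun m hm => ?_
    simp only [Finset.mem_singleton] at hm
    simp [Ne.symm hm]

theorem continuous_circle_powerSeries {s : ℕ → ℂ} (hs : Summable fun n => ‖s n‖) :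
    Continuous fun c : Circle => ∑' n, s n * (c : ℂ) ^ n :=
  continuous_tsum (fun n => by fun_prop) hs (fun n c => by simp [Circle.norm_coe])

/-- Parseval's identity for an absolutely convergent power series on the unit circle. -/
theorem lintegral_circle_powerSeries {s : ℕ → ℂ} (hs : Summable fun n => ‖s n‖) :
    ∫⁻ c : Circle, ‖∑' n, s n * (c : ℂ) ^ n‖ₑ ^ 2 ∂circleMeasure = ∑' n, ‖s n‖ₑ ^ 2 := by
  have hcont := continuous_circle_powerSeries hs
  have h := integral_circle_powerSeries hs hs
  have hsq : Summable fun n => ‖s n‖ ^ 2 := by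
    have := (Summable.mul_of_nonneg hs hs (fun _ => norm_nonneg _)
      (fun _ => norm_nonneg _)).comp_injective (i := fun n : ℕ => (n, n))
      (fun a b hab => by simpa using hab)
    simpa [sq, Function.comp_def] using this
  have e1 : ∀ z : ℂ, z * conj z = ((‖z‖ ^ 2 : ℝ) : ℂ) := fun z => by
    rw [mul_conj, normSq_eq_norm_sq]
  simp_rw [e1] at h
  have h' : ∫ c : Circle, ‖∑' n, s n * (c : ℂ) ^ n‖ ^ 2 ∂circleMeasure = ∑' n, ‖s n‖ ^ 2 := by
    rw [← ofReal_tsum] at h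
    exact ofReal_injective (integral_ofReal.symm.trans h)
  have e2 : ∀ z : ℂ, ‖z‖ₑ ^ 2 = ENNReal.ofReal (‖z‖ ^ 2) := fun z => by
    rw [ENNReal.ofReal_pow (norm_nonneg _), ofReal_norm]
  simp_rw [e2]
  rw [← ofReal_integral_eq_lintegral_ofReal, h', ENNReal.ofReal_tsum_of_nonneg
    (fun n => by positivity) hsq]
  · obtain ⟨C, hC⟩ := isCompact_univ.exists_bound_of_continuousOn hcont.continuousOn
    refine Integrable.of_bound (hcont.norm.pow 2).aestronglyMeasurable (C ^ 2)
      (Eventually.of_forall fun c => ?_)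
    have := hC c trivial
    rw [Real.norm_of_nonneg (by positivity)]
    gcongr
  · exact Eventually.of_forall fun c => by positivity

/-! ### Power series that agree near zero -/

theorem eq_zero_of_tsum_mul_pow_eq_zero {d : ℕ → ℝ} {ε : ℝ} (hε : 0 < ε)
    (hs : Summable fun n => |d n| * ε ^ n)
    (h0 : ∀ x, 0 < x → x < ε → ∑' n, d n * x ^ n = 0) (k : ℕ) : d k = 0 := by
  -- divide by `x ^ k` and let `x` tend to `0`
  induction k using Nat.strong_induction_on with
  | _ k ih =>
  have hbound : Summable fun n => |d (n + k)| * ε ^ n := by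
    have := ((summable_nat_add_iff k).2 hs).mul_right ((ε ^ k)⁻¹)
    refine this.congr fun n => ?_
    rw [pow_add]; field_simp
  have hlim : Tendsto (fun x : ℝ => ∑' n, d (n + k) * x ^ n) (𝓝[>] 0)
      (𝓝 (∑' n, d (n + k) * (0 : ℝ) ^ n)) := by
    refine tendsto_tsum_of_dominated_convergence hbound (fun n => ?_) ?_
    · exact ((continuous_const.mul (continuous_pow n)).tendsto (0 : ℝ)).mono_left
        nhdsWithin_le_nhds
    · filter_upwards [Ioo_mem_nhdsGT hε] with x hx n
      rw [norm_mul, norm_pow, Real.norm_eq_abs, Real.norm_eq_abs, abs_of_pos hx.1]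
      have := hx.1.le
      have := hx.2.le
      gcongr
  have hzero : ∀ᶠ x : ℝ in 𝓝[>] 0, ∑' n, d (n + k) * x ^ n = 0 := by
    filter_upwards [Ioo_mem_nhdsGT hε] with x hx
    have hsx : Summable fun n => d n * x ^ n := by
      refine Summable.of_norm_bounded hs fun n => ?_
      rw [norm_mul, norm_pow, Real.norm_eq_abs, Real.norm_eq_abs, abs_of_pos hx.1]
      have := hx.1.le
      have := hx.2.le
      gcongr
    have h1 := hsx.sum_add_tsum_nat_add k
    rw [h0 x hx.1 hx.2, Finset.sum_eq_zero (fun i hi => by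
      rw [ih i (Finset.mem_range.1 hi), zero_mul]), zero_add] at h1
    have h2 : ∑' n, d (n + k) * x ^ (n + k) = (∑' n, d (n + k) * x ^ n) * x ^ k := by
      rw [← tsum_mul_right]
      exact tsum_congr fun n => by rw [pow_add]; ring
    rw [h2] at h1
    exact (mul_eq_zero.1 h1).resolve_right (pow_pos hx.1 k).ne'
  have h3 := tendsto_nhds_unique (tendsto_const_nhds.congr' (hzero.mono fun x hx => hx.symm)) hlim
  rw [tsum_eq_single 0 (fun n hn => by simp [hn])] at h3
  simpa using h3.symm

/-- Two power series with coefficients in `[0, ∞]` that agree and are finite on `(0, ε]` have the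
same coefficients. -/
theorem eq_of_tsum_mul_pow_eq {p q : ℕ → ℝ≥0∞} {ε : ℝ} (hε : 0 < ε)
    (h : ∀ x : ℝ, 0 < x → x ≤ ε →
      ∑' n, p n * ENNReal.ofReal x ^ n = ∑' n, q n * ENNReal.ofReal x ^ n)
    (hfin : ∀ x : ℝ, 0 < x → x ≤ ε → ∑' n, q n * ENNReal.ofReal x ^ n ≠ ∞) : p = q := by
  have key : ∀ r : ℕ → ℝ≥0∞, (∀ x : ℝ, 0 < x → x ≤ ε → ∑' n, r n * ENNReal.ofReal x ^ n ≠ ∞) →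
      (∀ n, r n ≠ ∞) ∧ ∀ x : ℝ, 0 < x → x ≤ ε → (Summable fun n => (r n).toReal * x ^ n) ∧
        (∑' n, r n * ENNReal.ofReal x ^ n).toReal = ∑' n, (r n).toReal * x ^ n := by
    intro r hr
    have e : ∀ x : ℝ, 0 < x → ∀ n, (r n * ENNReal.ofReal x ^ n).toReal = (r n).toReal * x ^ n := by
      intro x hx n
      rw [ENNReal.toReal_mul, ENNReal.toReal_pow, ENNReal.toReal_ofReal hx.le]
    refine ⟨fun n hn => ?_, fun x hx hxe => ⟨?_, ?_⟩⟩
    · have h1 := ENNReal.ne_top_of_tsum_ne_top (hr ε hε le_rfl) n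
      rw [hn, ENNReal.top_mul (pow_ne_zero _ (by simpa using hε))] at h1
      exact h1 rfl
    · exact (ENNReal.summable_toReal (hr x hx hxe)).congr (e x hx)
    · rw [ENNReal.tsum_toReal_eq (ENNReal.ne_top_of_tsum_ne_top (hr x hx hxe))]
      exact tsum_congr (e x hx)
  obtain ⟨hq, hq'⟩ := key q hfin
  obtain ⟨hp, hp'⟩ := key p (fun x hx hxe => by rw [h x hx hxe]; exact hfin x hx hxe)
  funext k
  have hd := eq_zero_of_tsum_mul_pow_eq_zero (d := fun n => (p n).toReal - (q n).toReal) hε ?_ ?_ k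
  · exact (ENNReal.toReal_eq_toReal_iff' (hp k) (hq k)).1 (sub_eq_zero.1 hd)
  · refine Summable.of_nonneg_of_le (fun n => by positivity) (fun n => ?_)
      ((hp' ε hε le_rfl).1.add (hq' ε hε le_rfl).1)
    rw [← add_mul]
    gcongr
    refine (abs_sub _ _).trans (le_of_eq ?_)
    rw [abs_of_nonneg ENNReal.toReal_nonneg, abs_of_nonneg ENNReal.toReal_nonneg]
  · intro x hx hxe
    simp_rw [sub_mul]
    rw [(hp' x hx hxe.le).1.tsum_sub (hq' x hx hxe.le).1, ← (hp' x hx hxe.le).2,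
      ← (hq' x hx hxe.le).2, h x hx hxe.le, sub_self]

/-! ### Power series in rotation invariant `L²` spaces -/

/-- A rotation invariant measure `μ`, carried by a rotation invariant set `Ω`, for which all
polynomials are square integrable. -/
structure IsRadial (Ω : Set ℂ) (μ : Measure ℂ) : Prop where
  rot_mem : ∀ (c : Circle) {ζ : ℂ}, ζ ∈ Ω → (c : ℂ) * ζ ∈ Ω
  ae_mem : ∀ᵐ ζ ∂μ, ζ ∈ Ω
  map_rot : ∀ c : Circle, MeasurePreserving (fun ζ : ℂ => (c : ℂ) * ζ) μ μ
  moment_ne_top : ∀ n : ℕ, ∫⁻ ζ, ‖ζ‖ₑ ^ (2 * n) ∂μ ≠ ∞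

/-- `G` is the sum on `Ω` of the power series with coefficients `a`. -/
def HasCoeffs (Ω : Set ℂ) (G : ℂ → ℂ) (a : ℕ → ℂ) : Prop :=
  ∀ ζ ∈ Ω, HasSum (fun n => a n * ζ ^ n) (G ζ)

/-- The squared `L²(μ)` norm of the monomial `ζ ^ n`. -/
noncomputable def moment (μ : Measure ℂ) (n : ℕ) : ℝ≥0∞ := ∫⁻ ζ, ‖ζ‖ₑ ^ (2 * n) ∂μ

section Coeffs

variable {Ω : Set ℂ} {μ : Measure ℂ} {G φ : ℂ → ℂ} {a b : ℕ → ℂ}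

theorem HasCoeffs.summable_norm (h : HasCoeffs Ω G a) {ζ : ℂ} (hζ : ζ ∈ Ω) :
    Summable fun n => ‖a n * ζ ^ n‖ := (h ζ hζ).summable.norm

theorem hasCoeffs_pow (Ω : Set ℂ) (n : ℕ) :
    HasCoeffs Ω (fun ζ => ζ ^ n) (Pi.single n 1) := by
  intro ζ _
  convert hasSum_single n (f := fun m => (Pi.single n 1 : ℕ → ℂ) m * ζ ^ m) (fun m hm => ?_)
  · simp
  · simp [Pi.single_eq_of_ne hm]

theorem HasCoeffs.rotate (hΩ : IsRadial Ω μ) (h : HasCoeffs Ω G a) (c : Circle) :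
    HasCoeffs Ω (rotate c G) (fun n => a n * (c : ℂ) ^ n) := by
  intro ζ hζ
  have := h _ (hΩ.rot_mem c hζ)
  simpa only [mul_pow, mul_assoc, _root_.rotate] using this

theorem HasCoeffs.apply_zero (h : HasCoeffs Ω G a) (h0 : (0 : ℂ) ∈ Ω) : a 0 = G 0 := by
  have h1 := hasSum_single 0 (f := fun m => a m * (0 : ℂ) ^ m) (fun m hm => by simp [hm])
  simpa using h1.unique (h 0 h0)

theorem HasCoeffs.eval_rotate (hΩ : IsRadial Ω μ) (h : HasCoeffs Ω G a) {ζ : ℂ} (hζ : ζ ∈ Ω)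
    (c : Circle) : G (c * ζ) = ∑' n, (a n * ζ ^ n) * (c : ℂ) ^ n := by
  rw [← (h _ (hΩ.rot_mem c hζ)).tsum_eq]
  exact tsum_congr fun n => by rw [mul_pow]; ring

theorem lintegral_circle_eval (hΩ : IsRadial Ω μ) (h : HasCoeffs Ω G a) {ζ : ℂ} (hζ : ζ ∈ Ω) :
    ∫⁻ c : Circle, ‖G (c * ζ)‖ₑ ^ 2 ∂circleMeasure = ∑' n, ‖a n‖ₑ ^ 2 * ‖ζ‖ₑ ^ (2 * n) := by
  simp_rw [h.eval_rotate hΩ hζ]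
  rw [lintegral_circle_powerSeries (h.summable_norm hζ)]
  refine tsum_congr fun n => ?_
  rw [enorm_mul, enorm_pow, mul_pow, ← pow_mul, mul_comm n 2]

theorem IsRadial.isFiniteMeasure (hΩ : IsRadial Ω μ) : IsFiniteMeasure μ :=
  ⟨by have := hΩ.moment_ne_top 0; simpa [lt_top_iff_ne_top] using this⟩

theorem IsRadial.memLp_pow (hΩ : IsRadial Ω μ) (n : ℕ) : MemLp (fun ζ : ℂ => ζ ^ n) 2 μ := by
  refine ⟨by fun_prop, ?_⟩
  rw [eLpNorm_lt_top_iff_lintegral_rpow_enorm_lt_top (by simp) (by simp)]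
  have := hΩ.moment_ne_top n
  simpa [enorm_pow, ← pow_mul, mul_comm n 2, lt_top_iff_ne_top] using this

theorem IsRadial.lintegral_eq (hΩ : IsRadial Ω μ) {F : ℂ → ℝ≥0∞} (hF : Measurable F) :
    ∫⁻ ζ, F ζ ∂μ = ∫⁻ ζ, ∫⁻ c : Circle, F (c * ζ) ∂circleMeasure ∂μ := by
  have := hΩ.isFiniteMeasure
  rw [lintegral_lintegral_swap (by fun_prop)]
  simp_rw [fun c : Circle => (hΩ.map_rot c).lintegral_comp hF]
  simp

theorem IsRadial.integral_eq (hΩ : IsRadial Ω μ) {F : ℂ → ℂ} (hF : Measurable F)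
    (hFi : Integrable F μ) :
    ∫ ζ, F ζ ∂μ = ∫ ζ, ∫ c : Circle, F (c * ζ) ∂circleMeasure ∂μ := by
  have := hΩ.isFiniteMeasure
  have hm : Measurable (Function.uncurry fun (ζ : ℂ) (c : Circle) => F (c * ζ)) := by
    unfold Function.uncurry; fun_prop
  rw [integral_integral_swap]
  · have : ∀ c : Circle, ∫ ζ, F (c * ζ) ∂μ = ∫ ζ, F ζ ∂μ := fun c => by
      rw [← integral_map_of_stronglyMeasurable (by fun_prop) hF.stronglyMeasurable,
        (hΩ.map_rot c).map_eq]
    simp [this]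
  · refine ⟨hm.aestronglyMeasurable, ?_⟩
    rw [hasFiniteIntegral_iff_enorm, lintegral_prod _ hm.enorm.aemeasurable]
    have := hΩ.lintegral_eq hF.enorm
    simp only [Function.uncurry]
    rw [← this]
    exact hFi.2

/-- Pythagoras: monomials are orthogonal for a rotation invariant measure. -/
theorem lintegral_sq_eq_tsum (hΩ : IsRadial Ω μ) (hG : Measurable G) (h : HasCoeffs Ω G a) :
    ∫⁻ ζ, ‖G ζ‖ₑ ^ 2 ∂μ = ∑' n, ‖a n‖ₑ ^ 2 * moment μ n := by
  rw [hΩ.lintegral_eq (hG.enorm.pow_const 2)]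
  rw [lintegral_congr_ae (hΩ.ae_mem.mono fun ζ hζ => lintegral_circle_eval hΩ h hζ)]
  rw [lintegral_tsum (fun n => by fun_prop)]
  refine tsum_congr fun n => ?_
  rw [lintegral_const_mul _ (by fun_prop), moment]

theorem lintegral_sq_ne_top_of_memLp {X : Type*} [MeasurableSpace X] {μ : Measure X}
    {G : X → ℂ} (hG : MemLp G 2 μ) : ∫⁻ ζ, ‖G ζ‖ₑ ^ 2 ∂μ ≠ ∞ := by
  have := hG.2
  rw [eLpNorm_lt_top_iff_lintegral_rpow_enorm_lt_top (by simp) (by simp)] at this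
  simpa using this.ne

theorem summable_coeff_sq (hΩ : IsRadial Ω μ) (hG : Measurable G) (h : HasCoeffs Ω G a)
    (hG2 : MemLp G 2 μ) : Summable fun n => ‖a n‖ ^ 2 * (moment μ n).toReal := by
  have h1 := lintegral_sq_ne_top_of_memLp hG2
  rw [lintegral_sq_eq_tsum hΩ hG h] at h1
  refine (ENNReal.summable_toReal h1).congr fun n => ?_
  simp [ENNReal.toReal_mul]

theorem summable_coeff_mul (hΩ : IsRadial Ω μ) (hG : Measurable G) (h : HasCoeffs Ω G a)
    (hG2 : MemLp G 2 μ) (hφ : Measurable φ) (hb : HasCoeffs Ω φ b) (hφ2 : MemLp φ 2 μ) :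
    Summable fun n => ‖a n * conj (b n) * ((moment μ n).toReal : ℂ)‖ := by
  refine Summable.of_nonneg_of_le (fun n => norm_nonneg _) (fun n => ?_)
    ((summable_coeff_sq hΩ hG h hG2).add (summable_coeff_sq hΩ hφ hb hφ2))
  rw [norm_mul, norm_mul, RCLike.norm_conj, norm_real, Real.norm_of_nonneg ENNReal.toReal_nonneg,
    ← add_mul]
  gcongr
  nlinarith [sq_nonneg (‖a n‖ - ‖b n‖), sq_nonneg (‖a n‖), sq_nonneg (‖b n‖)]

theorem integrable_mul_conj {X : Type*} [MeasurableSpace X] {μ : Measure X} {G φ : X → ℂ}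
    (hG2 : MemLp G 2 μ) (hφ2 : MemLp φ 2 μ) :
    Integrable (fun ζ => G ζ * conj (φ ζ)) μ := by
  have : MemLp (fun ζ => conj (φ ζ)) 2 μ := hφ2.star
  exact hG2.integrable_mul this

theorem integral_mul_conj_eq_tsum (hΩ : IsRadial Ω μ) (hG : Measurable G) (h : HasCoeffs Ω G a)
    (hG2 : MemLp G 2 μ) (hφ : Measurable φ) (hb : HasCoeffs Ω φ b) (hφ2 : MemLp φ 2 μ) :
    ∫ ζ, G ζ * conj (φ ζ) ∂μ = ∑' n, a n * conj (b n) * ((moment μ n).toReal : ℂ) := by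
  have hconj : Measurable fun ζ => conj (φ ζ) := continuous_conj.measurable.comp hφ
  rw [hΩ.integral_eq (F := fun ζ => G ζ * conj (φ ζ)) (hG.mul hconj)
    (integrable_mul_conj hG2 hφ2)]
  have hinner : ∀ᵐ ζ ∂μ, ∫ c : Circle, G (c * ζ) * conj (φ (c * ζ)) ∂circleMeasure =
      ∑' n, a n * conj (b n) * ((‖ζ‖ ^ (2 * n) : ℝ) : ℂ) := by
    filter_upwards [hΩ.ae_mem] with ζ hζ
    simp_rw [h.eval_rotate hΩ hζ, hb.eval_rotate hΩ hζ]
    rw [integral_circle_powerSeries (h.summable_norm hζ) (hb.summable_norm hζ)]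
    refine tsum_congr fun n => ?_
    rw [map_mul, pow_mul, ← normSq_eq_norm_sq, ofReal_pow, ← mul_conj, mul_pow, map_pow]
    ring
  rw [integral_congr_ae hinner]
  have hmom : ∀ n, Integrable (fun ζ : ℂ => ‖ζ‖ ^ (2 * n)) μ := fun n => by
    refine ⟨by fun_prop, ?_⟩
    have := hΩ.moment_ne_top n
    rw [hasFiniteIntegral_iff_enorm]
    simpa [enorm_pow, lt_top_iff_ne_top] using this
  have hmom' : ∀ n, ∫ ζ : ℂ, ‖ζ‖ ^ (2 * n) ∂μ = (moment μ n).toReal := fun n => by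
    rw [integral_eq_lintegral_of_nonneg_ae (Eventually.of_forall fun ζ => by positivity)
      (by fun_prop), moment]
    congr 1
    refine lintegral_congr fun ζ => ?_
    rw [ENNReal.ofReal_pow (norm_nonneg _), ofReal_norm]
  rw [← integral_tsum_of_summable_integral_norm]
  · refine tsum_congr fun n => ?_
    rw [integral_const_mul]
    congr 1
    rw [← hmom']
    exact integral_ofReal
  · exact fun n => (hmom n).ofReal.const_mul _
  · refine (summable_coeff_mul hΩ hG h hG2 hφ hb hφ2).congr fun n => ?_
    simp_rw [norm_mul, norm_real]
    rw [integral_const_mul, ← hmom', Real.norm_of_nonneg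
      (integral_nonneg fun ζ => by positivity)]
    congr 1
    exact integral_congr_ae (Eventually.of_forall fun ζ => by
      simp)

theorem integral_mul_conj_pow (hΩ : IsRadial Ω μ) (hG : Measurable G) (h : HasCoeffs Ω G a)
    (hG2 : MemLp G 2 μ) (n : ℕ) :
    ∫ ζ, G ζ * conj (ζ ^ n) ∂μ = a n * ((moment μ n).toReal : ℂ) := by
  rw [integral_mul_conj_eq_tsum hΩ hG h hG2 (by fun_prop) (hasCoeffs_pow Ω n)
      (hΩ.memLp_pow n),
    tsum_eq_single n (fun m hm => by simp [Pi.single_eq_of_ne hm])]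
  simp

theorem memLp_rotate (hΩ : IsRadial Ω μ) (hφ2 : MemLp φ 2 μ) (c : Circle) :
    MemLp (rotate c φ) 2 μ :=
  hφ2.comp_measurePreserving (hΩ.map_rot c)

theorem measurable_rotate (hφ : Measurable φ) (c : Circle) : Measurable (rotate c φ) := by
  unfold rotate; fun_prop

/-- Averaging `|⟨G, φ_θ⟩|²` over the rotations decouples the Taylor coefficients. -/
theorem lintegral_circle_inner_rotate (hΩ : IsRadial Ω μ) (hG : Measurable G)
    (h : HasCoeffs Ω G a) (hG2 : MemLp G 2 μ) (hφ : Measurable φ) (hb : HasCoeffs Ω φ b)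
    (hφ2 : MemLp φ 2 μ) :
    ∫⁻ c : Circle, ‖∫ ζ, G ζ * conj (rotate c φ ζ) ∂μ‖ₑ ^ 2 ∂circleMeasure =
      ∑' n, ‖a n‖ₑ ^ 2 * (‖b n‖ₑ ^ 2 * moment μ n ^ 2) := by
  set s : ℕ → ℂ := fun n => conj (a n * conj (b n) * ((moment μ n).toReal : ℂ))
  have hs : Summable fun n => ‖s n‖ := by
    simpa [s] using summable_coeff_mul hΩ hG h hG2 hφ hb hφ2
  have hval : ∀ c : Circle, ‖∫ ζ, G ζ * conj (rotate c φ ζ) ∂μ‖ₑ = ‖∑' n, s n * (c : ℂ) ^ n‖ₑ := by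
    intro c
    rw [integral_mul_conj_eq_tsum hΩ hG h hG2 (measurable_rotate hφ c) (hb.rotate hΩ c)
      (memLp_rotate hΩ hφ2 c), ← RCLike.enorm_conj, conj_tsum]
    congr 2
    funext n
    simp only [s, map_mul, conj_conj]
    ring
  simp_rw [hval]
  rw [lintegral_circle_powerSeries hs]
  refine tsum_congr fun n => ?_
  have hm : ‖((moment μ n).toReal : ℂ)‖ₑ = moment μ n := by
    rw [← ofReal_norm, norm_real, Real.norm_of_nonneg ENNReal.toReal_nonneg,
      ENNReal.ofReal_toReal (a := moment μ n) (hΩ.moment_ne_top n)]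
  simp only [s]
  rw [RCLike.enorm_conj, enorm_mul, enorm_mul, RCLike.enorm_conj, hm]
  ring

/-- Boundedness of the evaluation at `0`, from the constant Taylor coefficient. -/
theorem enorm_sq_apply_zero_le (hΩ : IsRadial Ω μ) (hG : Measurable G) (h : HasCoeffs Ω G a)
    (h0 : (0 : ℂ) ∈ Ω) : ‖G 0‖ₑ ^ 2 * μ Set.univ ≤ ∫⁻ ζ, ‖G ζ‖ₑ ^ 2 ∂μ := by
  rw [lintegral_sq_eq_tsum hΩ hG h, ← h.apply_zero h0]
  refine le_trans (le_of_eq ?_) (ENNReal.le_tsum 0)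
  simp [moment]

end Coeffs

/-- An abstract Schur orthogonality relation. The families `G z` and `E z` play the roles of
`T_z g` and `T_z 1` for a family of unitary operators `T_z`. Proportionality of the circular means
of the two families (`hcirc`) forces the mean squares of their Taylor coefficients to be
proportional, and for `E` these are given by `hpow`. -/
theorem lintegral_inner_rotate_eq {Ω : Set ℂ} {μ ν : Measure ℂ} [SFinite ν] (hΩ : IsRadial Ω μ)
    {ε : ℝ} (hε : 0 < ε) (hεΩ : ∀ x : ℝ, 0 < x → x ≤ ε → (x : ℂ) ∈ Ω)
    {G E : ℂ → ℂ → ℂ} {a e : ℂ → ℕ → ℂ} {φ : ℂ → ℂ} {b : ℕ → ℂ}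
    (hGm : Measurable (Function.uncurry G)) (hEm : Measurable (Function.uncurry E))
    (hG : ∀ᵐ z ∂ν, HasCoeffs Ω (G z) (a z)) (hE : ∀ᵐ z ∂ν, HasCoeffs Ω (E z) (e z))
    (hG2 : ∀ᵐ z ∂ν, MemLp (G z) 2 μ) (hE2 : ∀ᵐ z ∂ν, MemLp (E z) 2 μ)
    (hφ : Measurable φ) (hb : HasCoeffs Ω φ b) (hφ2 : MemLp φ 2 μ) {N C : ℝ≥0∞} (hN : N ≠ ∞)
    (hcirc : ∀ x : ℝ, (x : ℂ) ∈ Ω →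
      ∫⁻ z, ∫⁻ c : Circle, ‖G z (c * x)‖ₑ ^ 2 ∂circleMeasure ∂ν =
        N * ∫⁻ z, ∫⁻ c : Circle, ‖E z (c * x)‖ₑ ^ 2 ∂circleMeasure ∂ν)
    (hfin : ∀ x : ℝ, (x : ℂ) ∈ Ω →
      ∫⁻ z, ∫⁻ c : Circle, ‖E z (c * x)‖ₑ ^ 2 ∂circleMeasure ∂ν ≠ ∞)
    (hpow : ∀ n : ℕ, ∫⁻ z, ‖∫ ζ, E z ζ * conj (ζ ^ n) ∂μ‖ₑ ^ 2 ∂ν = C * moment μ n) :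
    ∫⁻ z, ∫⁻ c : Circle, ‖∫ ζ, G z ζ * conj (rotate c φ ζ) ∂μ‖ₑ ^ 2 ∂circleMeasure ∂ν =
      N * C * ∫⁻ ζ, ‖φ ζ‖ₑ ^ 2 ∂μ := by
  -- the Taylor coefficients depend measurably on `z`
  have hmeas : ∀ {F : ℂ → ℂ → ℂ} {d : ℂ → ℕ → ℂ}, Measurable (Function.uncurry F) →
      (∀ᵐ z ∂ν, HasCoeffs Ω (F z) (d z)) → ∀ n, AEMeasurable (fun z => d z n) ν := by
    intro F d hF hd n
    have h1 : Measurable fun z => ∫ c : Circle, F z (c * ε) * conj ((c : ℂ) ^ n) ∂circleMeasure := by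
      refine (StronglyMeasurable.integral_prod_right (f := fun (z : ℂ) (c : Circle) =>
        F z (c * ε) * conj ((c : ℂ) ^ n)) (Measurable.stronglyMeasurable ?_)).measurable
      refine Measurable.mul ?_ (by fun_prop)
      exact hF.comp (f := fun p : ℂ × Circle => (p.1, (p.2 : ℂ) * ε)) (by fun_prop)
    -- Cauchy's formula on the circle of radius `ε`
    refine ⟨fun z => (∫ c : Circle, F z (c * ε) * conj ((c : ℂ) ^ n) ∂circleMeasure) / (ε : ℂ) ^ n,
      h1.div_const _, ?_⟩
    filter_upwards [hd] with z hz
    have hεm := hεΩ ε hε le_rfl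
    simp_rw [hz.eval_rotate hΩ hεm]
    have h2 := integral_circle_powerSeries (hz.summable_norm hεm)
      (t := Pi.single n 1) (summable_of_ne_finset_zero (s := {n}) fun m hm => by
        simp [Pi.single_eq_of_ne (Finset.notMem_singleton.1 hm)])
    have h3 : ∀ c : Circle, ∑' m, (Pi.single n 1 : ℕ → ℂ) m * (c : ℂ) ^ m = (c : ℂ) ^ n := by
      intro c
      rw [tsum_eq_single n (fun m hm => by simp [Pi.single_eq_of_ne hm])]
      simp
    simp_rw [h3] at h2
    rw [h2, tsum_eq_single n (fun m hm => by simp [Pi.single_eq_of_ne hm])]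
    have : (ε : ℂ) ^ n ≠ 0 := pow_ne_zero _ (by exact_mod_cast hε.ne')
    simp [this]
  have hexp : ∀ {F : ℂ → ℂ → ℂ} {d : ℂ → ℕ → ℂ}, Measurable (Function.uncurry F) →
      (∀ᵐ z ∂ν, HasCoeffs Ω (F z) (d z)) → ∀ x : ℝ, (x : ℂ) ∈ Ω →
      ∫⁻ z, ∫⁻ c : Circle, ‖F z (c * x)‖ₑ ^ 2 ∂circleMeasure ∂ν =
        ∑' n, (∫⁻ z, ‖d z n‖ₑ ^ 2 ∂ν) * ENNReal.ofReal (x ^ 2) ^ n := by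
    intro F d hF hd x hx
    rw [lintegral_congr_ae (hd.mono fun z hz => lintegral_circle_eval hΩ hz hx),
      lintegral_tsum (fun n => ((hmeas hF hd n).enorm.pow_const 2).mul_const _)]
    refine tsum_congr fun n => ?_
    rw [lintegral_mul_const'' _ ((hmeas hF hd n).enorm.pow_const 2)]
    congr 1
    rw [pow_mul, ← ofReal_norm, norm_real, ← ENNReal.ofReal_pow (norm_nonneg _),
      Real.norm_eq_abs, sq_abs]
  -- the circular means determine the mean squares of the coefficients, as power series in `x ^ 2`
  have hq : (fun n => ∫⁻ z, ‖a z n‖ₑ ^ 2 ∂ν) = fun n => N * ∫⁻ z, ‖e z n‖ₑ ^ 2 ∂ν := by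
    have hsq : ∀ x : ℝ, 0 < x → x ≤ ε ^ 2 → ((√x : ℝ) : ℂ) ∈ Ω := fun x hx hxe =>
      hεΩ _ (Real.sqrt_pos.2 hx) (Real.sqrt_le_iff.2 ⟨hε.le, hxe⟩)
    have hE' : ∀ x : ℝ, 0 < x → x ≤ ε ^ 2 →
        ∑' n, (N * ∫⁻ z, ‖e z n‖ₑ ^ 2 ∂ν) * ENNReal.ofReal x ^ n =
          N * ∫⁻ z, ∫⁻ c : Circle, ‖E z (c * (√x : ℝ))‖ₑ ^ 2 ∂circleMeasure ∂ν := by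
      intro x hx hxe
      rw [hexp hEm hE _ (hsq x hx hxe), Real.sq_sqrt hx.le, ← ENNReal.tsum_mul_left]
      exact tsum_congr fun n => mul_assoc _ _ _
    refine eq_of_tsum_mul_pow_eq (ε := ε ^ 2) (by positivity) (fun x hx hxe => ?_)
      (fun x hx hxe => ?_)
    · rw [hE' x hx hxe, ← hcirc _ (hsq x hx hxe), hexp hGm hG _ (hsq x hx hxe), Real.sq_sqrt hx.le]
    · rw [hE' x hx hxe]
      exact ENNReal.mul_ne_top hN (hfin _ (hsq x hx hxe))
  have hGz : ∀ z, Measurable (G z) := fun z => hGm.comp measurable_prodMk_left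
  have hEz : ∀ z, Measurable (E z) := fun z => hEm.comp measurable_prodMk_left
  have he : ∀ n, (∫⁻ z, ‖e z n‖ₑ ^ 2 ∂ν) * moment μ n ^ 2 = C * moment μ n := by
    intro n
    rw [← hpow n, ← lintegral_mul_const'' _ ((hmeas hEm hE n).enorm.pow_const 2)]
    refine lintegral_congr_ae ?_
    filter_upwards [hE, hE2] with z h1 h2
    rw [integral_mul_conj_pow hΩ (hEz z) h1 h2, enorm_mul, mul_pow]
    congr 2
    rw [← ofReal_norm, norm_real, Real.norm_of_nonneg ENNReal.toReal_nonneg]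
    exact (ENNReal.ofReal_toReal (hΩ.moment_ne_top n)).symm
  have hin : ∀ᵐ z ∂ν,
      ∫⁻ c : Circle, ‖∫ ζ, G z ζ * conj (rotate c φ ζ) ∂μ‖ₑ ^ 2 ∂circleMeasure =
        ∑' n, ‖a z n‖ₑ ^ 2 * (‖b n‖ₑ ^ 2 * moment μ n ^ 2) := by
    filter_upwards [hG, hG2] with z h1 h2
    exact lintegral_circle_inner_rotate hΩ (hGz z) h1 h2 hφ hb hφ2
  rw [lintegral_congr_ae hin,
    lintegral_tsum (fun n => ((hmeas hGm hG n).enorm.pow_const 2).mul_const _),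
    lintegral_sq_eq_tsum hΩ hφ hb, ← ENNReal.tsum_mul_left]
  refine tsum_congr fun n => ?_
  rw [lintegral_mul_const'' _ ((hmeas hGm hG n).enorm.pow_const 2), show
    ∫⁻ z, ‖a z n‖ₑ ^ 2 ∂ν = N * ∫⁻ z, ‖e z n‖ₑ ^ 2 ∂ν from congrFun hq n]
  calc _ = N * ((∫⁻ z, ‖e z n‖ₑ ^ 2 ∂ν) * moment μ n ^ 2) * ‖b n‖ₑ ^ 2 := by ring
    _ = _ := by rw [he]; ring

/-! ### Operators defined by weak integrals -/

/-- A linear map into functions that is bounded for the `L²` seminorm defines a bounded operator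
into `L²`. -/
theorem exists_clm_toLp {H X : Type*} [NormedAddCommGroup H] [InnerProductSpace ℂ H]
    [MeasurableSpace X] {ν : Measure X} (L : H →ₗ[ℂ] (X → ℂ)) (hL : ∀ g, MemLp (L g) 2 ν)
    {C : ℝ≥0∞} (hC : C ≠ ∞) (hLC : ∀ g, eLpNorm (L g) 2 ν ≤ C * ‖g‖ₑ) :
    ∃ A : H →L[ℂ] Lp ℂ 2 ν, ∀ g, A g =ᵐ[ν] L g := by
  let A₀ : H →ₗ[ℂ] Lp ℂ 2 ν :=
    { toFun := fun g => (hL g).toLp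
      map_add' := fun g h => by
        rw [← MemLp.toLp_add]
        exact MemLp.toLp_congr _ _ (by rw [map_add])
      map_smul' := fun c g => by
        rw [RingHom.id_apply, ← MemLp.toLp_const_smul]
        exact MemLp.toLp_congr _ _ (by rw [map_smul]) }
  refine ⟨A₀.mkContinuous C.toReal fun g => ?_, fun g => (hL g).coeFn_toLp⟩
  show ‖(hL g).toLp‖ ≤ _
  rw [Lp.norm_toLp, ← toReal_enorm g, ← ENNReal.toReal_mul]
  exact ENNReal.toReal_mono (ENNReal.mul_ne_top hC (by simp)) (hLC g)

theorem eLpNorm_two_sq {X : Type*} [MeasurableSpace X] {ν : Measure X} (F : X → ℂ) :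
    eLpNorm F 2 ν ^ 2 = ∫⁻ x, ‖F x‖ₑ ^ 2 ∂ν := by
  rw [eLpNorm_eq_lintegral_rpow_enorm_toReal (by simp) (by simp), ← ENNReal.rpow_natCast,
    ← ENNReal.rpow_mul]
  simp

theorem enorm_Lp_two_sq {X : Type*} [MeasurableSpace X] {ν : Measure X} (u : Lp ℂ 2 ν) :
    ‖u‖ₑ ^ 2 = ∫⁻ x, ‖u x‖ₑ ^ 2 ∂ν := by
  rw [← eLpNorm_two_sq, Lp.enorm_def]

theorem memLp_two_of_lintegral_sq_le {X : Type*} [MeasurableSpace X] {ν : Measure X} {F : X → ℂ}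
    (hF : AEStronglyMeasurable F ν) {K D : ℝ≥0∞} (hK : K ≠ ∞) (hD : D ≠ ∞)
    (h : ∫⁻ x, ‖F x‖ₑ ^ 2 ∂ν ≤ K * D ^ 2) :
    MemLp F 2 ν ∧ eLpNorm F 2 ν ≤ K ^ (1 / 2 : ℝ) * D := by
  have h1 : eLpNorm F 2 ν ≤ K ^ (1 / 2 : ℝ) * D := by
    have h2 : (K ^ (1 / 2 : ℝ)) ^ 2 = K := by
      rw [← ENNReal.rpow_natCast, ← ENNReal.rpow_mul]
      simp
    rw [← eLpNorm_two_sq, ← h2, ← mul_pow] at h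
    exact (ENNReal.pow_le_pow_left_iff two_ne_zero).1 h
  exact ⟨⟨hF, h1.trans_lt (ENNReal.mul_lt_top (ENNReal.rpow_lt_top_of_nonneg (by norm_num) hK)
    hD.lt_top)⟩, h1⟩

/-- If the coefficient maps `g ↦ ⟨g, w x⟩` and `h ↦ ⟨h, v x⟩` are bounded into `L²` and `m` is
bounded, then `∫ m(x) ⟨g, w x⟩ ⟨v x, h⟩` is the form of a bounded operator. -/
theorem exists_clm_inner_eq_integral {H X : Type*} [NormedAddCommGroup H] [InnerProductSpace ℂ H]
    [CompleteSpace H] [MeasurableSpace X] {ν : Measure X} {w v : X → H} {m : X → ℂ}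
    (hm : MemLp m ∞ ν) (hwm : ∀ g, AEStronglyMeasurable (fun x => inner ℂ (w x) g) ν)
    (hvm : ∀ g, AEStronglyMeasurable (fun x => inner ℂ (v x) g) ν) {C D : ℝ≥0∞} (hC : C ≠ ∞)
    (hD : D ≠ ∞) (hwC : ∀ g, ∫⁻ x, ‖(inner ℂ (w x) g : ℂ)‖ₑ ^ 2 ∂ν ≤ C * ‖g‖ₑ ^ 2)
    (hvD : ∀ g, ∫⁻ x, ‖(inner ℂ (v x) g : ℂ)‖ₑ ^ 2 ∂ν ≤ D * ‖g‖ₑ ^ 2) :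
    ∃ T : H →L[ℂ] H, ∀ g h,
      Integrable (fun x => m x * inner ℂ (w x) g * inner ℂ h (v x)) ν ∧
      inner ℂ h (T g) = ∫ x, m x * inner ℂ (w x) g * inner ℂ h (v x) ∂ν := by
  let L₁ : H →ₗ[ℂ] (X → ℂ) :=
    { toFun := fun g x => m x * inner ℂ (w x) g
      map_add' := fun g h => by funext x; simp [mul_add]
      map_smul' := fun c g => by funext x; simp; ring }
  let L₂ : H →ₗ[ℂ] (X → ℂ) :=
    { toFun := fun g x => inner ℂ (v x) g
      map_add' := fun g h => by funext x; simp
      map_smul' := fun c g => by funext x; simp }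
  have hw := fun g => memLp_two_of_lintegral_sq_le (hwm g) hC enorm_ne_top (hwC g)
  have hv := fun g => memLp_two_of_lintegral_sq_le (hvm g) hD enorm_ne_top (hvD g)
  have hC' : C ^ (1 / 2 : ℝ) ≠ ∞ := ENNReal.rpow_ne_top_of_nonneg (by norm_num) hC
  have hD' : D ^ (1 / 2 : ℝ) ≠ ∞ := ENNReal.rpow_ne_top_of_nonneg (by norm_num) hD
  have hL₁ : ∀ g, MemLp (L₁ g) 2 ν := fun g => (hw g).1.mul (p := ∞) hm
  obtain ⟨A, hA⟩ := exists_clm_toLp L₁ hL₁ (C := eLpNorm m ∞ ν * C ^ (1 / 2 : ℝ))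
    (ENNReal.mul_ne_top hm.2.ne hC') (fun g => by
      rw [mul_assoc]
      refine le_trans ?_ (mul_le_mul_right (hw g).2 _)
      exact eLpNorm_smul_le_eLpNorm_top_mul_eLpNorm 2 (hwm g) m)
  obtain ⟨B, hB⟩ := exists_clm_toLp L₂ (fun g => (hv g).1) hD' (fun g => (hv g).2)
  refine ⟨(ContinuousLinearMap.adjoint B).comp A, fun g h => ⟨?_, ?_⟩⟩
  · have := integrable_mul_conj (hL₁ g) (hv h).1
    refine this.congr (Eventually.of_forall fun x => ?_)
    show m x * inner ℂ (w x) g * conj (inner ℂ (v x) h) = _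
    rw [inner_conj_symm]
  · rw [ContinuousLinearMap.comp_apply, ContinuousLinearMap.adjoint_inner_right, L2.inner_def]
    refine integral_congr_ae ?_
    filter_upwards [hA g, hB h] with x h1 h2
    rw [h1, h2, RCLike.inner_apply]
    show m x * inner ℂ (w x) g * conj (inner ℂ (v x) h) = _
    rw [inner_conj_symm]

/-! ### Closedness of spaces of holomorphic functions -/

/-- When point evaluations are locally uniformly bounded, the square integrable holomorphic
functions form a closed subspace of `L²`. -/
theorem isClosed_setOf_holomorphic {Ω : Set ℂ} (hΩ : IsOpen Ω) {μ : Measure ℂ}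
    (hμ : ∀ᵐ ζ ∂μ, ζ ∈ Ω) {k : ℂ → ℝ} (hk : ContinuousOn k Ω)
    (hb : ∀ φ : ℂ → ℂ, DifferentiableOn ℂ φ Ω → MemLp φ 2 μ →
      ∀ z ∈ Ω, ‖φ z‖ ≤ k z * (eLpNorm φ 2 μ).toReal) :
    IsClosed {u : Lp ℂ 2 μ | ∃ φ : ℂ → ℂ, DifferentiableOn ℂ φ Ω ∧ u =ᵐ[μ] φ} := by
  refine IsSeqClosed.isClosed fun u u₀ hu hlim => ?_
  choose G hG hGu using hu
  have hG2 : ∀ n, MemLp (G n) 2 μ := fun n => (memLp_congr_ae (hGu n)).1 (Lp.memLp (u n))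
  have hdist : ∀ n m, ∀ z ∈ Ω, ‖G n z - G m z‖ ≤ k z * ‖u n - u m‖ := by
    intro n m z hz
    have h1 := hb (G n - G m) ((hG n).sub (hG m)) ((hG2 n).sub (hG2 m)) z hz
    rwa [← eLpNorm_congr_ae ((hGu n).sub (hGu m)), ← eLpNorm_congr_ae (Lp.coeFn_sub (u n) (u m)),
      ← Lp.norm_def] at h1
  have hcau : CauchySeq u := hlim.cauchySeq
  have hunif : ∀ K ⊆ Ω, IsCompact K → UniformCauchySeqOn G atTop K := by
    intro K hK hKc
    obtain ⟨M, hM⟩ := hKc.exists_bound_of_continuousOn (hk.mono hK)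
    rw [Metric.uniformCauchySeqOn_iff]
    intro ε hε
    have hM1 : 0 < |M| + 1 := by positivity
    obtain ⟨N, hN⟩ := Metric.cauchySeq_iff.1 hcau (ε / (|M| + 1)) (by positivity)
    refine ⟨N, fun m hm n hn x hx => ?_⟩
    rw [dist_eq_norm]
    have h1 := hN m hm n hn
    rw [dist_eq_norm] at h1
    calc ‖G m x - G n x‖ ≤ k x * ‖u m - u n‖ := hdist m n x (hK hx)
      _ ≤ (|M| + 1) * ‖u m - u n‖ := by
          gcongr
          have := hM x hx
          rw [Real.norm_eq_abs] at this
          linarith [le_abs_self (k x), le_abs_self M]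
      _ < ε := by rwa [lt_div_iff₀' hM1] at h1
  have hpt : ∀ z ∈ Ω, ∃ y, Tendsto (fun n => G n z) atTop (𝓝 y) := fun z hz =>
    cauchySeq_tendsto_of_complete
      ((hunif {z} (by simpa using hz) isCompact_singleton).cauchySeq (by simp))
  choose! F hF using hpt
  have hloc : TendstoLocallyUniformlyOn G F atTop Ω := by
    rw [tendstoLocallyUniformlyOn_iff_forall_isCompact hΩ]
    exact fun K hK hKc => (hunif K hK hKc).tendstoUniformlyOn_of_tendsto fun z hz => hF z (hK hz)
  refine ⟨F, hloc.differentiableOn (Eventually.of_forall hG) hΩ, ?_⟩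
  obtain ⟨ns, hns, hae⟩ := (tendstoInMeasure_of_tendsto_Lp hlim).exists_seq_tendsto_ae
  filter_upwards [hae, hμ, ae_all_iff.2 hGu] with z h1 h2 h3
  refine tendsto_nhds_unique h1 ?_
  simp_rw [h3]
  exact (hF z h2).comp hns.tendsto_atTop

/-! ### Taylor coefficients and densities -/

/-- The Taylor coefficients at the origin. -/
noncomputable def taylorCoeff (G : ℂ → ℂ) (n : ℕ) : ℂ := (n.factorial : ℂ)⁻¹ * iteratedDeriv n G 0

theorem hasCoeffs_univ {G : ℂ → ℂ} (hG : Differentiable ℂ G) :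
    HasCoeffs Set.univ G (taylorCoeff G) := by
  intro ζ _
  have := Complex.hasSum_taylorSeries_of_entire hG 0 ζ
  simp only [sub_zero, smul_eq_mul] at this
  refine this.congr_fun fun n => ?_
  simp only [taylorCoeff]; ring

theorem hasCoeffs_disc {G : ℂ → ℂ} (hG : DifferentiableOn ℂ G disc) :
    HasCoeffs disc G (taylorCoeff G) := by
  intro ζ hζ
  have := Complex.hasSum_taylorSeries_on_ball (c := 0) (r := 1) (z := ζ) (f := G)
    (by simpa [disc] using hG) (by simpa [disc] using hζ)
  simp only [sub_zero, smul_eq_mul] at this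
  refine this.congr_fun fun n => ?_
  simp only [taylorCoeff]; ring

theorem MeasureTheory.MeasurePreserving.withDensity_self {X : Type*} [MeasurableSpace X]
    {μ : Measure X} {T : X → X} (hT : MeasurePreserving T μ μ) {k : X → ℝ≥0∞} (hk : Measurable k)
    (hkT : ∀ x, k (T x) = k x) : MeasurePreserving T (μ.withDensity k) (μ.withDensity k) := by
  refine ⟨hT.measurable, ?_⟩
  ext s hs
  rw [Measure.map_apply hT.measurable hs, withDensity_apply _ (hT.measurable hs),
    withDensity_apply _ hs, ← hT.setLIntegral_comp_preimage hs hk]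
  simp_rw [hkT]

theorem measurePreserving_rotation (c : Circle) :
    MeasurePreserving (fun ζ : ℂ => (c : ℂ) * ζ) volume volume :=
  (rotation c).measurePreserving

/-! ### The Fock space -/

section Fock

variable {β : ℝ}

/-- The density of `fockMeasure β`. -/
noncomputable def fockDensity (β : ℝ) (ζ : ℂ) : ℝ := β / Real.pi * Real.exp (-β * ‖ζ‖ ^ 2)

theorem continuous_fockDensity (β : ℝ) : Continuous (fockDensity β) := by
  unfold fockDensity; fun_prop

theorem fockDensity_nonneg (hβ : 0 < β) (ζ : ℂ) : 0 ≤ fockDensity β ζ := by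
  unfold fockDensity; positivity

theorem fockMeasure_eq (β : ℝ) :
    fockMeasure β = volume.withDensity fun ζ => ENNReal.ofReal (fockDensity β ζ) := rfl

theorem lintegral_fock (β : ℝ) (F : ℂ → ℝ≥0∞) :
    ∫⁻ ζ, F ζ ∂fockMeasure β = ∫⁻ ζ, ENNReal.ofReal (fockDensity β ζ) * F ζ := by
  rw [fockMeasure_eq, lintegral_withDensity_eq_lintegral_mul_non_measurable _
    (continuous_fockDensity β).measurable.ennreal_ofReal (by simp)]
  rfl

theorem integral_fock (hβ : 0 < β) (F : ℂ → ℂ) :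
    ∫ ζ, F ζ ∂fockMeasure β = ∫ ζ, (fockDensity β ζ : ℂ) * F ζ := by
  rw [fockMeasure_eq, integral_withDensity_eq_integral_toReal_smul
    (continuous_fockDensity β).measurable.ennreal_ofReal (by simp)]
  refine integral_congr_ae (Eventually.of_forall fun ζ => ?_)
  show (ENNReal.ofReal (fockDensity β ζ)).toReal • F ζ = _
  rw [ENNReal.toReal_ofReal (fockDensity_nonneg hβ ζ), real_smul]

theorem integrable_exp_neg_mul_norm_sq {b : ℝ} (hb : 0 < b) :
    Integrable fun ζ : ℂ => Real.exp (-b * ‖ζ‖ ^ 2) := by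
  have h := GaussianFourier.integral_rexp_neg_mul_sq_norm (V := ℂ) hb
  -- a function that is not integrable would have integral `0`
  by_contra hn
  rw [integral_undef hn] at h
  have : 0 < (Real.pi / b) ^ (Module.finrank ℝ ℂ / 2 : ℝ) := by positivity
  exact this.ne h

theorem isProbabilityMeasure_fockMeasure (hβ : 0 < β) : IsProbabilityMeasure (fockMeasure β) := by
  refine ⟨?_⟩
  have h := GaussianFourier.integral_rexp_neg_mul_sq_norm (V := ℂ) hβ
  rw [Complex.finrank_real_complex] at h
  rw [← lintegral_one, lintegral_fock]
  simp only [mul_one, fockDensity]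
  rw [← ofReal_integral_eq_lintegral_ofReal ((integrable_exp_neg_mul_norm_sq hβ).const_mul _)
    (Eventually.of_forall fun ζ => by positivity)]
  rw [integral_const_mul, h]
  have : β ≠ 0 := hβ.ne'
  norm_num
  field_simp

theorem isRadial_fockMeasure (hβ : 0 < β) : IsRadial Set.univ (fockMeasure β) where
  rot_mem _ _ _ := trivial
  ae_mem := Eventually.of_forall fun _ => trivial
  map_rot c := (measurePreserving_rotation c).withDensity_self
    (continuous_fockDensity β).measurable.ennreal_ofReal (fun ζ => by
      simp [Circle.norm_coe])
  moment_ne_top n := by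
    rw [lintegral_fock]
    set K : ℝ := β / Real.pi * (n.factorial * (2 / β) ^ n)
    have hle : ∀ ζ : ℂ, ENNReal.ofReal (fockDensity β ζ) * ‖ζ‖ₑ ^ (2 * n) ≤
        ENNReal.ofReal (K * Real.exp (-(β / 2) * ‖ζ‖ ^ 2)) := by
      intro ζ
      rw [← ofReal_norm, ← ENNReal.ofReal_pow (norm_nonneg _),
        ← ENNReal.ofReal_mul (fockDensity_nonneg hβ ζ)]
      refine ENNReal.ofReal_le_ofReal ?_
      have h1 := Real.pow_div_factorial_le_exp (x := β / 2 * ‖ζ‖ ^ 2) (by positivity) n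
      have h2 : ‖ζ‖ ^ (2 * n) ≤
          (n.factorial * (2 / β) ^ n) * Real.exp (β / 2 * ‖ζ‖ ^ 2) := by
        have h3 : ‖ζ‖ ^ (2 * n) = (n.factorial * (2 / β) ^ n) *
            ((β / 2 * ‖ζ‖ ^ 2) ^ n / n.factorial) := by
          have : (n.factorial : ℝ) ≠ 0 := by positivity
          rw [mul_pow, div_pow, div_pow, pow_mul]
          field_simp
        rw [h3]
        gcongr
      have h4 : Real.exp (-(β / 2) * ‖ζ‖ ^ 2) =
          Real.exp (-β * ‖ζ‖ ^ 2) * Real.exp (β / 2 * ‖ζ‖ ^ 2) := by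
        rw [← Real.exp_add]; ring_nf
      rw [h4]
      calc fockDensity β ζ * ‖ζ‖ ^ (2 * n)
          ≤ fockDensity β ζ * ((n.factorial * (2 / β) ^ n) * Real.exp (β / 2 * ‖ζ‖ ^ 2)) := by
            have := fockDensity_nonneg hβ ζ
            gcongr
        _ = _ := by simp only [fockDensity, K]; ring
    refine ((lintegral_mono hle).trans_lt ?_).ne
    have hi : Integrable fun ζ : ℂ => K * Real.exp (-(β / 2) * ‖ζ‖ ^ 2) :=
      (integrable_exp_neg_mul_norm_sq (by positivity)).const_mul K
    exact hi.lintegral_lt_top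

theorem norm_sub_sq_eq (ζ z : ℂ) : ‖ζ - z‖ ^ 2 = ‖ζ‖ ^ 2 + ‖z‖ ^ 2 - 2 * (conj z * ζ).re := by
  rw [← normSq_eq_norm_sq, ← normSq_eq_norm_sq, ← normSq_eq_norm_sq]
  simp only [normSq_apply, sub_re, sub_im, mul_re, conj_re, conj_im]
  ring

/-- The exponential factor of `W_z` is the square root of the ratio of the Gaussian density and its
translate. -/
theorem norm_weyl_sq (z : ℂ) (φ : ℂ → ℂ) (ζ : ℂ) :
    fockDensity β ζ * ‖weyl β z φ ζ‖ ^ 2 = fockDensity β (ζ - z) * ‖φ (ζ - z)‖ ^ 2 := by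
  have h1 : (β * conj z * ζ - ((β * ‖z‖ ^ 2 / 2 : ℝ) : ℂ)).re =
      β * (conj z * ζ).re - β * ‖z‖ ^ 2 / 2 := by
    rw [mul_assoc, sub_re, re_ofReal_mul, ofReal_re]
  simp only [weyl, fockDensity, norm_mul, Complex.norm_exp, mul_pow, ← Real.exp_nat_mul, h1,
    norm_sub_sq_eq ζ z]
  rw [show -β * (‖ζ‖ ^ 2 + ‖z‖ ^ 2 - 2 * (conj z * ζ).re) = -β * ‖ζ‖ ^ 2 +
    ((2 : ℕ) : ℝ) * (β * (conj z * ζ).re - β * ‖z‖ ^ 2 / 2) by push_cast; ring, Real.exp_add]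
  ring

theorem enorm_weyl_sq (hβ : 0 < β) (z : ℂ) (φ : ℂ → ℂ) (ζ : ℂ) :
    ENNReal.ofReal (fockDensity β ζ) * ‖weyl β z φ ζ‖ₑ ^ 2 =
      ENNReal.ofReal (fockDensity β (ζ - z)) * ‖φ (ζ - z)‖ₑ ^ 2 := by
  rw [← ofReal_norm, ← ofReal_norm, ← ENNReal.ofReal_pow (norm_nonneg _),
    ← ENNReal.ofReal_pow (norm_nonneg _), ← ENNReal.ofReal_mul (fockDensity_nonneg hβ _),
    ← ENNReal.ofReal_mul (fockDensity_nonneg hβ _), norm_weyl_sq]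

theorem lintegral_weyl_sq (hβ : 0 < β) (z : ℂ) (φ : ℂ → ℂ) :
    ∫⁻ ζ, ‖weyl β z φ ζ‖ₑ ^ 2 ∂fockMeasure β = ∫⁻ ζ, ‖φ ζ‖ₑ ^ 2 ∂fockMeasure β := by
  rw [lintegral_fock, lintegral_fock]
  simp_rw [enorm_weyl_sq hβ]
  exact lintegral_sub_right_eq_self
    (fun ζ => ENNReal.ofReal (fockDensity β ζ) * ‖φ ζ‖ₑ ^ 2) z

theorem memFock_weyl (hβ : 0 < β) {φ : ℂ → ℂ} (hφ : MemFock β φ) (z : ℂ) :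
    MemFock β (weyl β z φ) := by
  have hd : Differentiable ℂ (weyl β z φ) := by
    have h1 : Differentiable ℂ fun ζ => φ (ζ - z) := hφ.1.comp (by fun_prop)
    exact h1.mul (by fun_prop)
  refine ⟨hd, hd.continuous.aestronglyMeasurable, ?_⟩
  have h := lintegral_sq_ne_top_of_memLp hφ.2
  rw [← lintegral_weyl_sq hβ z, ← eLpNorm_two_sq] at h
  exact lt_top_iff_ne_top.2 fun h' => h (by simp [h'])

theorem MemFock.rotate (hβ : 0 < β) {φ : ℂ → ℂ} (hφ : MemFock β φ) (c : Circle) :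
    MemFock β (rotate c φ) :=
  ⟨hφ.1.comp (by fun_prop), memLp_rotate (isRadial_fockMeasure hβ) hφ.2 c⟩

/-- The adjoint of `W_z` is `W_{-z}`. -/
theorem fockInner_weyl (hβ : 0 < β) (z : ℂ) (g φ : ℂ → ℂ) :
    fockInner β g (weyl β z φ) = fockInner β (weyl β (-z) g) φ := by
  rw [fockInner, fockInner, integral_fock hβ, integral_fock hβ,
    ← integral_sub_right_eq_self
      (fun ζ => (fockDensity β ζ : ℂ) * (weyl β (-z) g ζ * conj (φ ζ))) z]
  refine integral_congr_ae (Eventually.of_forall fun w => ?_)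
  simp only [weyl, fockDensity, map_mul, ← Complex.exp_conj, map_neg, sub_neg_eq_add,
    sub_add_cancel, norm_neg, map_sub, conj_conj, conj_ofReal]
  have h1 : ((‖w - z‖ ^ 2 : ℝ) : ℂ) = (w - z) * (conj w - conj z) := by
    rw [← map_sub, mul_conj, normSq_eq_norm_sq]
  have h2 : ((‖w‖ ^ 2 : ℝ) : ℂ) = w * conj w := by rw [mul_conj, normSq_eq_norm_sq]
  have h3 : ((‖z‖ ^ 2 : ℝ) : ℂ) = z * conj z := by rw [mul_conj, normSq_eq_norm_sq]
  have key : cexp ((-β * ‖w‖ ^ 2 : ℝ) : ℂ) *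
      cexp (β * z * conj w - ((β * ‖z‖ ^ 2 / 2 : ℝ) : ℂ)) =
      cexp ((-β * ‖w - z‖ ^ 2 : ℝ) : ℂ) *
      cexp (β * -conj z * (w - z) - ((β * ‖z‖ ^ 2 / 2 : ℝ) : ℂ)) := by
    rw [← Complex.exp_add, ← Complex.exp_add]
    congr 1
    push_cast at h1 h2 h3 ⊢
    rw [h1, h2, h3]
    ring
  push_cast at key ⊢
  linear_combination (β / Real.pi * g w * conj (φ (w - z))) * key

/-- The reproducing kernel bound: the isometry `W_{-z}` moves the evaluation at `z` to the one
at `0`. -/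
theorem norm_le_of_memFock (hβ : 0 < β) {φ : ℂ → ℂ} (hφ : MemFock β φ) (z : ℂ) :
    ‖φ z‖ ≤ Real.exp (β * ‖z‖ ^ 2 / 2) * (eLpNorm φ 2 (fockMeasure β)).toReal := by
  have := isProbabilityMeasure_fockMeasure hβ
  have hW := memFock_weyl hβ hφ (-z)
  have h := enorm_sq_apply_zero_le (isRadial_fockMeasure hβ) hW.1.continuous.measurable
    (hasCoeffs_univ hW.1) trivial
  rw [lintegral_weyl_sq hβ, measure_univ, mul_one, ← eLpNorm_two_sq,
    ENNReal.pow_le_pow_left_iff two_ne_zero] at h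
  have h2 := ENNReal.toReal_mono hφ.2.2.ne h
  rw [toReal_enorm] at h2
  have h3 : ‖weyl β (-z) φ 0‖ = ‖φ z‖ * Real.exp (-(β * ‖z‖ ^ 2 / 2)) := by
    simp only [weyl, norm_mul, zero_sub, neg_neg, mul_zero, norm_neg, Complex.norm_exp,
      neg_re, ofReal_re]
  rw [h3, Real.exp_neg, ← div_eq_mul_inv, div_le_iff₀ (Real.exp_pos _)] at h2
  rwa [mul_comm]

theorem completeSpace_fockSpace (hβ : 0 < β) : CompleteSpace (FockSpace β) := by
  have h := isClosed_setOf_holomorphic (μ := fockMeasure β) isOpen_univ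
    (Eventually.of_forall fun _ => trivial) (k := fun z => Real.exp (β * ‖z‖ ^ 2 / 2))
    (by fun_prop) (fun φ hφ hφ2 z _ =>
      norm_le_of_memFock hβ ⟨differentiableOn_univ.1 hφ, hφ2⟩ z)
  simp only [differentiableOn_univ] at h
  exact IsClosed.completeSpace_coe (s := (FockSpace β : Set (Lp ℂ 2 (fockMeasure β)))) (hs := h)

theorem measurable_weyl {g : ℂ → ℂ} (hg : Measurable g) :
    Measurable (Function.uncurry fun z => weyl β (-z) g) := by
  unfold Function.uncurry weyl; fun_prop

/-- For fixed `a`, translation invariance in `z` computes the integral of `|W_{-z} g (a)|²`. -/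
theorem lintegral_weyl_apply (hβ : 0 < β) (g : ℂ → ℂ) (a : ℂ) :
    ∫⁻ z, ‖weyl β (-z) g a‖ₑ ^ 2 = ENNReal.ofReal (fockDensity β a)⁻¹ *
      ∫⁻ ζ, ‖g ζ‖ₑ ^ 2 ∂fockMeasure β := by
  have hpos : 0 < fockDensity β a := by unfold fockDensity; positivity
  rw [lintegral_fock, ← lintegral_add_left_eq_self
    (fun ζ => ENNReal.ofReal (fockDensity β ζ) * ‖g ζ‖ₑ ^ 2) a, ← lintegral_const_mul' _ _ (by simp)]
  refine lintegral_congr fun z => ?_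
  have := enorm_weyl_sq hβ (-z) g a
  rw [sub_neg_eq_add] at this
  rw [← this, ← mul_assoc, ← ENNReal.ofReal_mul (by positivity), inv_mul_cancel₀ hpos.ne',
    ENNReal.ofReal_one, one_mul]

/-- Schur orthogonality for the Weyl operators on the Fock space. -/
theorem lintegral_fockInner_sq (hβ : 0 < β) {g φ : ℂ → ℂ} (hg : MemFock β g) (hφ : MemFock β φ) :
    ∫⁻ z, ∫⁻ c : Circle, ‖fockInner β g (weyl β z (rotate c φ))‖ₑ ^ 2 ∂circleMeasure =
      ENNReal.ofReal (Real.pi / β) * (∫⁻ ζ, ‖g ζ‖ₑ ^ 2 ∂fockMeasure β) *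
        ∫⁻ ζ, ‖φ ζ‖ₑ ^ 2 ∂fockMeasure β := by
  have hprob := isProbabilityMeasure_fockMeasure hβ
  have hR := isRadial_fockMeasure hβ
  have h1 : MemFock β (fun _ => 1) := ⟨differentiable_const _, memLp_const _⟩
  have hcirc : ∀ f : ℂ → ℂ, Measurable f → ∀ x : ℝ,
      ∫⁻ z, ∫⁻ c : Circle, ‖weyl β (-z) f (c * x)‖ₑ ^ 2 ∂circleMeasure =
        ENNReal.ofReal (fockDensity β x)⁻¹ * ∫⁻ ζ, ‖f ζ‖ₑ ^ 2 ∂fockMeasure β := by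
    intro f hf x
    have hm : Measurable (Function.uncurry fun (z : ℂ) (c : Circle) =>
        ‖weyl β (-z) f (c * x)‖ₑ ^ 2) := by
      refine Measurable.pow_const (Measurable.enorm ?_) 2
      exact (measurable_weyl hf).comp (f := fun p : ℂ × Circle => (p.1, (p.2 : ℂ) * x))
        (by fun_prop)
    rw [lintegral_lintegral_swap hm.aemeasurable]
    simp_rw [lintegral_weyl_apply hβ]
    have : ∀ c : Circle, fockDensity β (c * x) = fockDensity β x := fun c => by
      simp [fockDensity, Circle.norm_coe]
    simp_rw [this]
    simp
  have hgm := hg.1.continuous.measurable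
  have h := lintegral_inner_rotate_eq (ν := volume) hR one_pos (fun _ _ _ => trivial)
    (G := fun z => weyl β (-z) g) (E := fun z => weyl β (-z) fun _ => 1)
    (measurable_weyl hgm) (measurable_weyl measurable_const)
    (Eventually.of_forall fun z => hasCoeffs_univ (memFock_weyl hβ hg (-z)).1)
    (Eventually.of_forall fun z => hasCoeffs_univ (memFock_weyl hβ h1 (-z)).1)
    (Eventually.of_forall fun z => (memFock_weyl hβ hg (-z)).2)
    (Eventually.of_forall fun z => (memFock_weyl hβ h1 (-z)).2)
    hφ.1.continuous.measurable (hasCoeffs_univ hφ.1) hφ.2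
    (N := ∫⁻ ζ, ‖g ζ‖ₑ ^ 2 ∂fockMeasure β) (C := ENNReal.ofReal (Real.pi / β))
    (lintegral_sq_ne_top_of_memLp hg.2)
    (fun x _ => by
      rw [hcirc _ hgm, hcirc _ measurable_const]
      simp [mul_comm])
    (fun x _ => by
      rw [hcirc _ measurable_const]
      simp)
    (fun n => by
      have hn : MemFock β (fun ζ => ζ ^ n) := ⟨by fun_prop, hR.memLp_pow n⟩
      -- the function `1` reproduces the value at `0`
      have hval : ∀ z, ‖∫ ζ, weyl β (-z) (fun _ => 1) ζ * conj (ζ ^ n) ∂fockMeasure β‖ₑ =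
          ‖weyl β z (fun ζ => ζ ^ n) 0‖ₑ := by
        intro z
        have h2 := fockInner_weyl hβ z (fun _ => 1) (fun ζ => ζ ^ n)
        have hW := memFock_weyl hβ hn z
        have h3 := integral_mul_conj_pow hR hW.1.continuous.measurable (hasCoeffs_univ hW.1) hW.2 0
        rw [(hasCoeffs_univ hW.1).apply_zero trivial] at h3
        simp only [pow_zero, map_one, mul_one, moment, mul_zero, lintegral_one, measure_univ,
          ENNReal.toReal_one, ofReal_one] at h3
        rw [show ∫ ζ, weyl β (-z) (fun _ => 1) ζ * conj (ζ ^ n) ∂fockMeasure β =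
          conj (weyl β z (fun ζ => ζ ^ n) 0) by
            rw [← h3, ← integral_conj]
            refine Eq.trans h2.symm ?_
            simp [fockInner], RCLike.enorm_conj]
      simp_rw [hval]
      rw [moment, lintegral_fock, ← lintegral_const_mul' _ _ (by simp)]
      refine lintegral_congr fun z => ?_
      have h4 := enorm_weyl_sq hβ z (fun ζ => ζ ^ n) 0
      have h5 : fockDensity β 0 = β / Real.pi := by simp [fockDensity]
      have h6 : ENNReal.ofReal (Real.pi / β) * ENNReal.ofReal (β / Real.pi) = 1 := by
        rw [← ENNReal.ofReal_mul (by positivity)]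
        have := Real.pi_ne_zero
        have := hβ.ne'
        field_simp
        simp
      have h7 : fockDensity β (0 - z) = fockDensity β z := by simp [fockDensity]
      rw [h5, h7] at h4
      rw [← one_mul (‖weyl β z (fun ζ => ζ ^ n) 0‖ₑ ^ 2), ← h6, mul_assoc, h4]
      simp [enorm_pow, ← pow_mul, mul_comm n 2])
  simp only [fockInner_weyl hβ]
  rw [show ENNReal.ofReal (Real.pi / β) * (∫⁻ ζ, ‖g ζ‖ₑ ^ 2 ∂fockMeasure β) *
        ∫⁻ ζ, ‖φ ζ‖ₑ ^ 2 ∂fockMeasure β = _ from by rw [mul_comm (ENNReal.ofReal _)], ← h]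
  rfl

end Fock

/-! ### Möbius maps of the disc -/

/-- The derivative of the Möbius map `moebius z` at `ζ`. -/
noncomputable def moebiusDeriv (z ζ : ℂ) : ℂ := ((1 - ‖z‖ ^ 2 : ℝ) : ℂ) / (1 - conj z * ζ) ^ 2

theorem mem_disc {z : ℂ} : z ∈ disc ↔ ‖z‖ < 1 := by simp [disc]

theorem measurableSet_disc : MeasurableSet disc := Metric.isOpen_ball.measurableSet

theorem neg_mem_disc {z : ℂ} (hz : z ∈ disc) : -z ∈ disc := by simpa [mem_disc] using hz

theorem one_sub_norm_sq_pos {z : ℂ} (hz : z ∈ disc) : 0 < 1 - ‖z‖ ^ 2 := by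
  rw [mem_disc] at hz
  nlinarith [norm_nonneg z]

theorem re_one_sub_pos {z ζ : ℂ} (hz : z ∈ disc) (hζ : ζ ∈ disc) : 0 < (1 - conj z * ζ).re := by
  have h1 : ‖conj z * ζ‖ < 1 := by
    rw [norm_mul, RCLike.norm_conj]
    rw [mem_disc] at hz hζ
    nlinarith [norm_nonneg z, norm_nonneg ζ]
  have h2 := re_le_norm (conj z * ζ)
  simp only [sub_re, one_re]
  linarith

theorem one_sub_ne_zero {z ζ : ℂ} (hz : z ∈ disc) (hζ : ζ ∈ disc) : 1 - conj z * ζ ≠ 0 := by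
  intro h
  have := re_one_sub_pos hz hζ
  simp [h] at this

/-- The principal branch in `bergmanU` is holomorphic on the disc. -/
theorem moebiusDeriv_mem_slitPlane {z ζ : ℂ} (hz : z ∈ disc) (hζ : ζ ∈ disc) :
    moebiusDeriv z ζ ∈ slitPlane := by
  have hre := re_one_sub_pos hz hζ
  have hne := one_sub_ne_zero hz hζ
  have ht := one_sub_norm_sq_pos hz
  set w := 1 - conj z * ζ
  -- the derivative is the square of a number `u` with positive real part
  obtain ⟨u, hu⟩ : ∃ u : ℂ, u = (√(1 - ‖z‖ ^ 2) : ℝ) * w⁻¹ := ⟨_, rfl⟩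
  have hure : 0 < u.re := by
    rw [hu, re_ofReal_mul, inv_re]
    have := normSq_pos.2 hne
    have := Real.sqrt_pos.2 ht
    positivity
  have hJ : moebiusDeriv z ζ = u ^ 2 := by
    rw [hu, mul_pow, ← ofReal_pow, Real.sq_sqrt ht.le, moebiusDeriv, inv_pow, div_eq_mul_inv]
  rw [hJ, mem_slitPlane_iff, sq, mul_re, mul_im]
  by_cases him : u.im = 0
  · left; rw [him]; nlinarith
  · right
    intro h
    have : u.re * u.im = 0 := by linarith
    rcases mul_eq_zero.1 this with h | h
    · exact hure.ne' h
    · exact him h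

theorem moebiusDeriv_ne_zero {z ζ : ℂ} (hz : z ∈ disc) (hζ : ζ ∈ disc) : moebiusDeriv z ζ ≠ 0 :=
  slitPlane_ne_zero (moebiusDeriv_mem_slitPlane hz hζ)

theorem one_sub_norm_moebius_sq {z ζ : ℂ} (hz : z ∈ disc) (hζ : ζ ∈ disc) :
    1 - ‖moebius z ζ‖ ^ 2 = (1 - ‖ζ‖ ^ 2) * ‖moebiusDeriv z ζ‖ := by
  have hne := one_sub_ne_zero hz hζ
  have hn : 0 < ‖1 - conj z * ζ‖ ^ 2 := by positivity
  rw [moebius, moebiusDeriv, norm_div, norm_div, norm_pow, norm_real,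
    Real.norm_of_nonneg (one_sub_norm_sq_pos hz).le, div_pow]
  rw [← mul_div_assoc, one_sub_div hn.ne']
  congr 1
  simp only [← normSq_eq_norm_sq, normSq_apply, sub_re, sub_im, mul_re, mul_im, conj_re, conj_im,
    one_re, one_im]
  ring

theorem moebius_mem_disc {z ζ : ℂ} (hz : z ∈ disc) (hζ : ζ ∈ disc) : moebius z ζ ∈ disc := by
  have h := one_sub_norm_moebius_sq hz hζ
  have h1 : 0 < (1 - ‖ζ‖ ^ 2) * ‖moebiusDeriv z ζ‖ :=
    mul_pos (one_sub_norm_sq_pos hζ) (norm_pos_iff.2 (moebiusDeriv_ne_zero hz hζ))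
  rw [mem_disc]
  nlinarith [norm_nonneg (moebius z ζ)]

theorem one_add_mul_moebius {z ζ : ℂ} (hz : z ∈ disc) (hζ : ζ ∈ disc) :
    1 - conj (-z) * moebius z ζ = ((1 - ‖z‖ ^ 2 : ℝ) : ℂ) / (1 - conj z * ζ) := by
  have hne := one_sub_ne_zero hz hζ
  have : ((1 - ‖z‖ ^ 2 : ℝ) : ℂ) = 1 - z * conj z := by
    rw [mul_conj, normSq_eq_norm_sq]; push_cast; ring
  rw [this, moebius, map_neg]
  field_simp
  ring

theorem moebius_neg_moebius {z ζ : ℂ} (hz : z ∈ disc) (hζ : ζ ∈ disc) :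
    moebius (-z) (moebius z ζ) = ζ := by
  have hne := one_sub_ne_zero hz hζ
  have ht : ((1 - ‖z‖ ^ 2 : ℝ) : ℂ) ≠ 0 := by exact_mod_cast (one_sub_norm_sq_pos hz).ne'
  have e : ((1 - ‖z‖ ^ 2 : ℝ) : ℂ) = 1 - z * conj z := by
    rw [mul_conj, normSq_eq_norm_sq]; push_cast; ring
  rw [show moebius (-z) (moebius z ζ) = (moebius z ζ - -z) / (1 - conj (-z) * moebius z ζ) from rfl,
    one_add_mul_moebius hz hζ, moebius, div_eq_iff (div_ne_zero ht hne), e,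
    sub_neg_eq_add, div_add' _ _ _ hne, ← mul_div_assoc]
  congr 1
  ring

theorem moebiusDeriv_neg_moebius {z ζ : ℂ} (hz : z ∈ disc) (hζ : ζ ∈ disc) :
    moebiusDeriv (-z) (moebius z ζ) = (moebiusDeriv z ζ)⁻¹ := by
  have hne := one_sub_ne_zero hz hζ
  have ht : ((1 - ‖z‖ ^ 2 : ℝ) : ℂ) ≠ 0 := by exact_mod_cast (one_sub_norm_sq_pos hz).ne'
  rw [moebiusDeriv, moebiusDeriv, one_add_mul_moebius hz hζ, norm_neg]
  field_simp

theorem hasDerivAt_moebius {z ζ : ℂ} (hz : z ∈ disc) (hζ : ζ ∈ disc) :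
    HasDerivAt (moebius z) (moebiusDeriv z ζ) ζ := by
  have hne := one_sub_ne_zero hz hζ
  have h1 : HasDerivAt (fun ζ => ζ - z) 1 ζ := (hasDerivAt_id ζ).sub_const z
  have h2 : HasDerivAt (fun ζ => 1 - conj z * ζ) (-conj z) ζ := by
    simpa using ((hasDerivAt_id ζ).const_mul (conj z)).const_sub 1
  have e : ((1 - ‖z‖ ^ 2 : ℝ) : ℂ) = 1 - z * conj z := by
    rw [mul_conj, normSq_eq_norm_sq]; push_cast; ring
  have h3 : moebiusDeriv z ζ =
      (1 * (1 - conj z * ζ) - (ζ - z) * -conj z) / (1 - conj z * ζ) ^ 2 := by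
    rw [moebiusDeriv, e]
    ring
  rw [h3]
  exact h1.div h2 hne

theorem measurable_moebius : Measurable (Function.uncurry moebius) := by
  unfold Function.uncurry moebius; fun_prop

theorem moebius_image_disc {z : ℂ} (hz : z ∈ disc) : moebius z '' disc = disc := by
  refine Set.Subset.antisymm (Set.image_subset_iff.2 fun ζ hζ => moebius_mem_disc hz hζ) ?_
  intro ζ hζ
  refine ⟨moebius (-z) ζ, moebius_mem_disc (neg_mem_disc hz) hζ, ?_⟩
  simpa using moebius_neg_moebius (neg_mem_disc hz) hζ

theorem moebius_injOn {z : ℂ} (hz : z ∈ disc) : Set.InjOn (moebius z) disc := by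
  intro a ha b hb hab
  rw [← moebius_neg_moebius hz ha, hab, moebius_neg_moebius hz hb]

theorem ae_mem_disc_moebiusMeasure : ∀ᵐ z ∂moebiusMeasure, z ∈ disc :=
  (withDensity_absolutelyContinuous _ _).ae_le (ae_restrict_mem measurableSet_disc)

theorem measurable_moebiusDensity :
    Measurable fun z : ℂ => ENNReal.ofReal (1 / (Real.pi * (1 - ‖z‖ ^ 2) ^ 2)) := by fun_prop

instance : SFinite moebiusMeasure := by unfold moebiusMeasure; infer_instance

theorem lintegral_moebiusMeasure (F : ℂ → ℝ≥0∞) :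
    ∫⁻ z, F z ∂moebiusMeasure =
      ∫⁻ z in disc, ENNReal.ofReal (1 / (Real.pi * (1 - ‖z‖ ^ 2) ^ 2)) * F z := by
  rw [moebiusMeasure, lintegral_withDensity_eq_lintegral_mul_non_measurable _
    measurable_moebiusDensity (by simp)]
  rfl

/-- The measure `moebiusMeasure` is invariant under the Möbius maps of the disc. -/
theorem measurePreserving_moebius {z : ℂ} (hz : z ∈ disc) :
    MeasurePreserving (moebius z) moebiusMeasure moebiusMeasure := by
  have hm : Measurable (moebius z) := measurable_moebius.comp measurable_prodMk_left
  refine ⟨hm, ?_⟩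
  ext s hs
  rw [Measure.map_apply hm hs, ← lintegral_indicator_one hs, ← lintegral_indicator_one (hm hs),
    lintegral_moebiusMeasure, lintegral_moebiusMeasure]
  have hd : ∀ ζ ∈ disc, HasFDerivWithinAt (moebius z)
      ((ContinuousLinearMap.toSpanSingleton ℂ (moebiusDeriv z ζ)).restrictScalars ℝ) disc ζ :=
    fun ζ hζ => ((hasDerivAt_moebius hz hζ).hasFDerivAt.restrictScalars ℝ).hasFDerivWithinAt
  conv_rhs => rw [← moebius_image_disc hz]
  rw [lintegral_image_eq_lintegral_abs_det_fderiv_mul volume measurableSet_disc hd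
    (moebius_injOn hz)]
  refine setLIntegral_congr_fun measurableSet_disc fun ζ hζ => ?_
  have hdet : ((ContinuousLinearMap.toSpanSingleton ℂ (moebiusDeriv z ζ)).restrictScalars ℝ).det =
      ‖moebiusDeriv z ζ‖ ^ 2 := by
    simp [ContinuousLinearMap.det, LinearMap.det_restrictScalars,
      Algebra.norm_complex_eq, Complex.normSq_eq_norm_sq]
  simp only [hdet]
  rw [← mul_assoc, ← ENNReal.ofReal_mul (abs_nonneg _), abs_of_nonneg (by positivity),
    one_sub_norm_moebius_sq hz hζ]
  have h1 := (norm_pos_iff.2 (moebiusDeriv_ne_zero hz hζ)).ne'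
  have h2 := (one_sub_norm_sq_pos hζ).ne'
  refine congr_arg₂ (· * ·) (congrArg _ ?_) rfl
  field_simp

theorem measurePreserving_rotation_moebiusMeasure (c : Circle) :
    MeasurePreserving (fun ζ : ℂ => (c : ℂ) * ζ) moebiusMeasure moebiusMeasure := by
  refine MeasurePreserving.withDensity_self ?_ measurable_moebiusDensity (fun ζ => by
    simp [Circle.norm_coe])
  have h := (measurePreserving_rotation c).restrict_preimage measurableSet_disc
  have : (fun ζ : ℂ => (c : ℂ) * ζ) ⁻¹' disc = disc := by
    ext ζ; simp [mem_disc, Circle.norm_coe]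
  rwa [this] at h

/-! ### The weighted Bergman spaces -/

section Bergman

variable {α : ℝ}

/-- The density of `bergmanMeasure α` with respect to `moebiusMeasure`. -/
noncomputable def bergmanDensity (α : ℝ) (ζ : ℂ) : ℝ := (α + 1) * (1 - ‖ζ‖ ^ 2) ^ (α + 2)

theorem measurable_bergmanDensity (α : ℝ) : Measurable (bergmanDensity α) := by
  unfold bergmanDensity; fun_prop

theorem bergmanDensity_pos (hα : 0 ≤ α) {ζ : ℂ} (hζ : ζ ∈ disc) : 0 < bergmanDensity α ζ := by
  have := one_sub_norm_sq_pos hζ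
  unfold bergmanDensity; positivity

theorem bergmanMeasure_eq (hα : 0 ≤ α) : bergmanMeasure α =
    moebiusMeasure.withDensity fun ζ => ENNReal.ofReal (bergmanDensity α ζ) := by
  rw [moebiusMeasure, ← withDensity_mul _ measurable_moebiusDensity
    (measurable_bergmanDensity α).ennreal_ofReal, bergmanMeasure]
  refine withDensity_congr_ae ?_
  filter_upwards [ae_restrict_mem measurableSet_disc] with ζ hζ
  have h := one_sub_norm_sq_pos hζ
  rw [Pi.mul_apply, ← ENNReal.ofReal_mul (by positivity), bergmanDensity, Real.rpow_add h]
  congr 1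
  rw [Real.rpow_two]
  field_simp

theorem lintegral_bergman (hα : 0 ≤ α) (F : ℂ → ℝ≥0∞) : ∫⁻ ζ, F ζ ∂bergmanMeasure α =
    ∫⁻ ζ, ENNReal.ofReal (bergmanDensity α ζ) * F ζ ∂moebiusMeasure := by
  rw [bergmanMeasure_eq hα, lintegral_withDensity_eq_lintegral_mul_non_measurable _
    (measurable_bergmanDensity α).ennreal_ofReal (by simp)]
  rfl

theorem integral_bergman (hα : 0 ≤ α) (F : ℂ → ℂ) : ∫ ζ, F ζ ∂bergmanMeasure α =
    ∫ ζ, (bergmanDensity α ζ : ℂ) * F ζ ∂moebiusMeasure := by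
  rw [bergmanMeasure_eq hα, integral_withDensity_eq_integral_toReal_smul
    (measurable_bergmanDensity α).ennreal_ofReal (by simp)]
  refine integral_congr_ae ?_
  filter_upwards [ae_mem_disc_moebiusMeasure] with ζ hζ
  rw [ENNReal.toReal_ofReal (bergmanDensity_pos hα hζ).le, real_smul]

theorem ae_mem_disc_bergmanMeasure (α : ℝ) : ∀ᵐ z ∂bergmanMeasure α, z ∈ disc :=
  (withDensity_absolutelyContinuous _ _).ae_le (ae_restrict_mem measurableSet_disc)

/-- In polar coordinates the integrand has the primitive `-(1 - y²)^{α+1} / (2π)`. -/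
theorem isProbabilityMeasure_bergmanMeasure (hα : 0 ≤ α) :
    IsProbabilityMeasure (bergmanMeasure α) := by
  have hfin := isFiniteMeasure_bergmanMeasure hα
  set F : ℝ → ℝ := fun y => if y < 1 then (α + 1) / Real.pi * (1 - y ^ 2) ^ α else 0
  have h1 := integral_fun_norm_addHaar (volume : Measure ℂ) F
  have hπ : (volume : Measure ℂ).real (Metric.ball 0 1) = Real.pi := by
    simp [Measure.real]
  have hF : ∀ y, y ^ 1 • F y = if y < 1 then y * ((α + 1) / Real.pi * (1 - y ^ 2) ^ α) else 0 := by
    intro y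
    simp only [F, smul_eq_mul]
    split_ifs <;> simp
  have h2 : ∫ y in Set.Ioi (0 : ℝ), y ^ 1 • F y = 1 / (2 * Real.pi) := by
    have hind : ∀ y, y ^ 1 • F y = (Set.Iio (1 : ℝ)).indicator
        (fun y => y * ((α + 1) / Real.pi * (1 - y ^ 2) ^ α)) y := by
      intro y
      rw [hF]
      simp [Set.indicator]
    simp_rw [hind]
    rw [setIntegral_indicator measurableSet_Iio, Set.Ioi_inter_Iio, ← integral_Ioc_eq_integral_Ioo,
      ← intervalIntegral.integral_of_le zero_le_one]
    have hder : ∀ y ∈ Set.uIcc (0 : ℝ) 1, HasDerivAt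
        (fun y : ℝ => -(1 / (2 * Real.pi)) * (1 - y ^ 2) ^ (α + 1))
        (y * ((α + 1) / Real.pi * (1 - y ^ 2) ^ α)) y := by
      intro y _
      have h3 : HasDerivAt (fun y : ℝ => 1 - y ^ 2) (-(2 * y)) y := by
        simpa using (hasDerivAt_pow 2 y).const_sub 1
      have h4 := (h3.rpow_const (p := α + 1) (Or.inr (by linarith))).const_mul
        (-(1 / (2 * Real.pi)))
      have h5 : y * ((α + 1) / Real.pi * (1 - y ^ 2) ^ α) =
          -(1 / (2 * Real.pi)) * (-(2 * y) * (α + 1) * (1 - y ^ 2) ^ (α + 1 - 1)) := by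
        rw [add_sub_cancel_right]
        field_simp
      rw [h5]
      exact h4
    rw [intervalIntegral.integral_eq_sub_of_hasDerivAt hder]
    · rw [one_pow, sub_self, Real.zero_rpow (by linarith)]
      simp
    · refine ContinuousOn.intervalIntegrable fun y _ => ContinuousAt.continuousWithinAt ?_
      have : ContinuousAt (fun y : ℝ => (1 - y ^ 2) ^ α) y :=
        ContinuousAt.rpow_const (by fun_prop) (Or.inr hα)
      fun_prop
  rw [Complex.finrank_real_complex, hπ, h2] at h1
  have h5 : ∫ ζ : ℂ, F ‖ζ‖ = 1 := by
    rw [h1]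
    have := Real.pi_ne_zero
    simp
  refine ⟨?_⟩
  have hFnn : ∀ ζ : ℂ, 0 ≤ F ‖ζ‖ := by
    intro ζ
    simp only [F]
    split_ifs with h
    · have := one_sub_norm_sq_pos (mem_disc.2 h)
      positivity
    · exact le_rfl
  have hFi : Integrable fun ζ : ℂ => F ‖ζ‖ := by
    -- a function that is not integrable would have integral `0`
    by_contra hn
    rw [integral_undef hn] at h5
    exact zero_ne_one h5
  have h6 : ∫⁻ ζ : ℂ, ENNReal.ofReal (F ‖ζ‖) = 1 := by
    rw [← ofReal_integral_eq_lintegral_ofReal hFi (Eventually.of_forall hFnn), h5,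
      ENNReal.ofReal_one]
  rw [bergmanMeasure, withDensity_apply _ MeasurableSet.univ, Measure.restrict_univ,
    ← lintegral_indicator measurableSet_disc, ← h6]
  refine lintegral_congr fun ζ => ?_
  by_cases h : ζ ∈ disc
  · rw [Set.indicator_of_mem h]
    simp [F, mem_disc.1 h]
  · rw [Set.indicator_of_notMem h]
    simp [F, mt mem_disc.2 h]

theorem isRadial_bergmanMeasure (hα : 0 ≤ α) : IsRadial disc (bergmanMeasure α) where
  rot_mem c ζ h := by simpa [mem_disc, Circle.norm_coe] using h
  ae_mem := ae_mem_disc_bergmanMeasure α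
  map_rot c := by
    rw [bergmanMeasure_eq hα]
    exact (measurePreserving_rotation_moebiusMeasure c).withDensity_self
      (measurable_bergmanDensity α).ennreal_ofReal (fun ζ => by
        simp [bergmanDensity, Circle.norm_coe])
  moment_ne_top n := by
    have := isFiniteMeasure_bergmanMeasure hα
    refine ((lintegral_mono_ae (g := fun _ => 1) ?_).trans_lt (by simp)).ne
    filter_upwards [ae_mem_disc_bergmanMeasure α] with ζ hζ
    refine pow_le_one₀ bot_le ?_
    rw [← ofReal_norm, ← ENNReal.ofReal_one]
    exact ENNReal.ofReal_le_ofReal (mem_disc.1 hζ).le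

theorem bergmanU_eq (α : ℝ) (z : ℂ) (φ : ℂ → ℂ) (ζ : ℂ) :
    bergmanU α z φ ζ = φ (moebius z ζ) * moebiusDeriv z ζ ^ (((2 + α) / 2 : ℝ) : ℂ) := rfl

theorem bergmanDensity_moebius {z ζ : ℂ} (hz : z ∈ disc) (hζ : ζ ∈ disc) :
    bergmanDensity α (moebius z ζ) = bergmanDensity α ζ * ‖moebiusDeriv z ζ‖ ^ (α + 2) := by
  rw [bergmanDensity, bergmanDensity, one_sub_norm_moebius_sq hz hζ,
    Real.mul_rpow (one_sub_norm_sq_pos hζ).le (norm_nonneg _), mul_assoc]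

/-- The modulus of the Jacobian factor of `U_z` is the square root of the ratio of the densities at
`moebius z ζ` and `ζ`. -/
theorem norm_bergmanU_sq {z ζ : ℂ} (hz : z ∈ disc) (hζ : ζ ∈ disc) (φ : ℂ → ℂ) :
    bergmanDensity α ζ * ‖bergmanU α z φ ζ‖ ^ 2 =
      bergmanDensity α (moebius z ζ) * ‖φ (moebius z ζ)‖ ^ 2 := by
  rw [bergmanU_eq, bergmanDensity_moebius hz hζ, norm_mul, norm_cpow_real, mul_pow,
    ← Real.rpow_natCast (‖moebiusDeriv z ζ‖ ^ _), ← Real.rpow_mul (norm_nonneg _)]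
  rw [show (2 + α) / 2 * ((2 : ℕ) : ℝ) = α + 2 by push_cast; ring]
  ring

theorem enorm_bergmanU_sq (hα : 0 ≤ α) {z ζ : ℂ} (hz : z ∈ disc) (hζ : ζ ∈ disc) (φ : ℂ → ℂ) :
    ENNReal.ofReal (bergmanDensity α ζ) * ‖bergmanU α z φ ζ‖ₑ ^ 2 =
      ENNReal.ofReal (bergmanDensity α (moebius z ζ)) * ‖φ (moebius z ζ)‖ₑ ^ 2 := by
  rw [← ofReal_norm, ← ofReal_norm, ← ENNReal.ofReal_pow (norm_nonneg _),
    ← ENNReal.ofReal_pow (norm_nonneg _), ← ENNReal.ofReal_mul (bergmanDensity_pos hα hζ).le,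
    ← ENNReal.ofReal_mul (bergmanDensity_pos hα (moebius_mem_disc hz hζ)).le,
    norm_bergmanU_sq hz hζ]

theorem lintegral_bergmanU_sq (hα : 0 ≤ α) {z : ℂ} (hz : z ∈ disc) {φ : ℂ → ℂ}
    (hφ : Measurable φ) :
    ∫⁻ ζ, ‖bergmanU α z φ ζ‖ₑ ^ 2 ∂bergmanMeasure α = ∫⁻ ζ, ‖φ ζ‖ₑ ^ 2 ∂bergmanMeasure α := by
  rw [lintegral_bergman hα, lintegral_bergman hα]
  have h := (measurePreserving_moebius hz).lintegral_comp
    (f := fun ζ => ENNReal.ofReal (bergmanDensity α ζ) * ‖φ ζ‖ₑ ^ 2)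
    ((measurable_bergmanDensity α).ennreal_ofReal.mul (hφ.enorm.pow_const 2))
  rw [← h]
  refine lintegral_congr_ae ?_
  filter_upwards [ae_mem_disc_moebiusMeasure] with ζ hζ
  exact enorm_bergmanU_sq hα hz hζ φ

theorem aestronglyMeasurable_of_differentiableOn_disc {G : ℂ → ℂ}
    (hG : DifferentiableOn ℂ G disc) (α : ℝ) : AEStronglyMeasurable G (bergmanMeasure α) :=
  (hG.continuousOn.aestronglyMeasurable measurableSet_disc).mono_ac
    (withDensity_absolutelyContinuous _ _)

theorem memBergman_bergmanU (hα : 0 ≤ α) {φ : ℂ → ℂ} (hφ : MemBergman α φ) (hφm : Measurable φ)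
    {z : ℂ} (hz : z ∈ disc) : MemBergman α (bergmanU α z φ) := by
  have hd : DifferentiableOn ℂ (bergmanU α z φ) disc := by
    have h1 : DifferentiableOn ℂ (moebius z) disc := fun ζ hζ =>
      (hasDerivAt_moebius hz hζ).differentiableAt.differentiableWithinAt
    have h2 : DifferentiableOn ℂ (fun ζ => φ (moebius z ζ)) disc :=
      hφ.1.comp h1 fun ζ hζ => moebius_mem_disc hz hζ
    have h3 : DifferentiableOn ℂ (moebiusDeriv z) disc := by
      unfold moebiusDeriv
      refine DifferentiableOn.div (by fun_prop) (by fun_prop) fun ζ hζ => ?_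
      exact pow_ne_zero _ (one_sub_ne_zero hz hζ)
    exact h2.mul (h3.cpow_const fun ζ hζ => moebiusDeriv_mem_slitPlane hz hζ)
  refine ⟨hd, aestronglyMeasurable_of_differentiableOn_disc hd α, ?_⟩
  have h := lintegral_sq_ne_top_of_memLp hφ.2
  rw [← lintegral_bergmanU_sq hα hz hφm, ← eLpNorm_two_sq] at h
  exact lt_top_iff_ne_top.2 fun h' => h (by simp [h'])

theorem MemBergman.rotate (hα : 0 ≤ α) {φ : ℂ → ℂ} (hφ : MemBergman α φ) (c : Circle) :
    MemBergman α (rotate c φ) :=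
  ⟨hφ.1.comp (by fun_prop) fun _ hζ => (isRadial_bergmanMeasure hα).rot_mem c hζ,
    memLp_rotate (isRadial_bergmanMeasure hα) hφ.2 c⟩

theorem measurable_bergmanU {g : ℂ → ℂ} (hg : Measurable g) :
    Measurable (Function.uncurry fun z => bergmanU α z g) := by
  have : Measurable fun p : ℂ × ℂ => g (moebius p.1 p.2) := hg.comp measurable_moebius
  exact this.mul (by fun_prop)

theorem measurable_bergmanU_apply {g : ℂ → ℂ} (hg : Measurable g) (z : ℂ) :
    Measurable (bergmanU α z g) := (measurable_bergmanU hg).comp measurable_prodMk_left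

/-- The adjoint of `U_z` is `U_{-z}`. -/
theorem bergmanInner_bergmanU (hα : 0 ≤ α) {z : ℂ} (hz : z ∈ disc) {g φ : ℂ → ℂ}
    (hg : Measurable g) (hφ : Measurable φ) :
    bergmanInner α g (bergmanU α z φ) = bergmanInner α (bergmanU α (-z) g) φ := by
  rw [bergmanInner, bergmanInner, integral_bergman hα, integral_bergman hα]
  have hU : Measurable (bergmanU α (-z) g) := measurable_bergmanU_apply hg (-z)
  have hm : Measurable fun ζ => (bergmanDensity α ζ : ℂ) *
      (bergmanU α (-z) g ζ * conj (φ ζ)) :=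
    (measurable_ofReal.comp (measurable_bergmanDensity α)).mul
      (hU.mul (continuous_conj.measurable.comp hφ))
  have hmp := measurePreserving_moebius hz
  conv_rhs => rw [← hmp.map_eq]
  rw [integral_map_of_stronglyMeasurable hmp.measurable hm.stronglyMeasurable]
  refine integral_congr_ae ?_
  filter_upwards [ae_mem_disc_moebiusMeasure] with ζ hζ
  rw [bergmanU_eq, bergmanU_eq, moebius_neg_moebius hz hζ, moebiusDeriv_neg_moebius hz hζ,
    inv_cpow _ _ (slitPlane_arg_ne_pi (moebiusDeriv_mem_slitPlane hz hζ)),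
    bergmanDensity_moebius hz hζ, map_mul]
  set s : ℂ := moebiusDeriv z ζ ^ (((2 + α) / 2 : ℝ) : ℂ) with hs
  have hs0 : s ≠ 0 := by
    rw [hs, Ne, cpow_eq_zero_iff]
    exact fun h => moebiusDeriv_ne_zero hz hζ h.1
  have hss : ((‖moebiusDeriv z ζ‖ ^ (α + 2) : ℝ) : ℂ) = s * conj s := by
    rw [mul_conj, normSq_eq_norm_sq, hs, norm_cpow_real, ← Real.rpow_natCast,
      ← Real.rpow_mul (norm_nonneg _)]
    congr 2
    push_cast; ring
  rw [ofReal_mul, hss]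
  field_simp

/-- The reproducing kernel bound: the isometry `U_{-z}` moves the evaluation at `z` to the one
at `0`. -/
theorem norm_le_of_memBergman (hα : 0 ≤ α) {φ : ℂ → ℂ} (hφ : MemBergman α φ) {z : ℂ}
    (hz : z ∈ disc) :
    ‖φ z‖ ≤ √((1 - ‖z‖ ^ 2) ^ (α + 2))⁻¹ * (eLpNorm φ 2 (bergmanMeasure α)).toReal := by
  have := isProbabilityMeasure_bergmanMeasure hα
  -- pass to a Borel function with the same values on the disc
  wlog hφm : Measurable φ generalizing φ
  · have heq : ∀ ζ ∈ disc, disc.indicator φ ζ = φ ζ := fun ζ hζ => Set.indicator_of_mem hζ φ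
    have hae : disc.indicator φ =ᵐ[bergmanMeasure α] φ :=
      (ae_mem_disc_bergmanMeasure α).mono heq
    have hm : Measurable (disc.indicator φ) := by
      classical
      rw [← Set.piecewise_eq_indicator]
      exact hφ.1.continuousOn.measurable_piecewise continuousOn_const measurableSet_disc
    have h := this (φ := disc.indicator φ)
      ⟨hφ.1.congr heq, (memLp_congr_ae hae).2 hφ.2⟩ hm
    rwa [heq z hz, eLpNorm_congr_ae hae] at h
  have hU := memBergman_bergmanU hα hφ hφm (neg_mem_disc hz)
  have h0 : (0 : ℂ) ∈ disc := by simp [mem_disc]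
  have h := enorm_sq_apply_zero_le (isRadial_bergmanMeasure hα)
    (measurable_bergmanU_apply hφm (-z))
    (hasCoeffs_disc hU.1) h0
  rw [lintegral_bergmanU_sq hα (neg_mem_disc hz) hφm, measure_univ, mul_one, ← eLpNorm_two_sq,
    ENNReal.pow_le_pow_left_iff two_ne_zero] at h
  have h2 := ENNReal.toReal_mono hφ.2.2.ne h
  rw [toReal_enorm] at h2
  have h3 := norm_bergmanU_sq (α := α) (neg_mem_disc hz) h0 φ
  have h4 : moebius (-z) 0 = z := by simp [moebius]
  have h5 : bergmanDensity α 0 = α + 1 := by simp [bergmanDensity]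
  have hpos : 0 < (1 - ‖z‖ ^ 2) ^ (α + 2) := Real.rpow_pos_of_pos (one_sub_norm_sq_pos hz) _
  rw [h4, h5, bergmanDensity, mul_assoc] at h3
  have h6 := mul_left_cancel₀ (by positivity : α + 1 ≠ 0) h3
  have h7 : ‖φ z‖ = √((1 - ‖z‖ ^ 2) ^ (α + 2))⁻¹ * ‖bergmanU α (-z) φ 0‖ := by
    rw [← Real.sqrt_sq (norm_nonneg (bergmanU α (-z) φ 0)), ← Real.sqrt_mul (by positivity), h6,
      inv_mul_cancel_left₀ hpos.ne', Real.sqrt_sq (norm_nonneg _)]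
  rw [h7]
  gcongr

theorem completeSpace_bergmanSpace (hα : 0 ≤ α) : CompleteSpace (BergmanSpace α) := by
  have h := isClosed_setOf_holomorphic (Ω := disc) (μ := bergmanMeasure α) Metric.isOpen_ball
    (ae_mem_disc_bergmanMeasure α) (k := fun z => √((1 - ‖z‖ ^ 2) ^ (α + 2))⁻¹)
    (by
      refine fun z hz => ContinuousAt.continuousWithinAt ?_
      have h1 := one_sub_norm_sq_pos hz
      refine ContinuousAt.sqrt (ContinuousAt.inv₀ ?_ (Real.rpow_pos_of_pos h1 _).ne')
      exact ContinuousAt.rpow_const (by fun_prop) (Or.inl h1.ne'))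
    (fun φ hφ hφ2 z hz => norm_le_of_memBergman hα ⟨hφ, hφ2⟩ hz)
  exact IsClosed.completeSpace_coe
    (s := (BergmanSpace α : Set (Lp ℂ 2 (bergmanMeasure α)))) (hs := h)

theorem lintegral_circle_mul_eq_of_norm_eq {H : ℂ → ℝ≥0∞} (hH : Measurable H) {a b : ℂ}
    (hab : ‖a‖ = ‖b‖) :
    ∫⁻ c : Circle, H (c * a) ∂circleMeasure = ∫⁻ c : Circle, H (c * b) ∂circleMeasure := by
  by_cases hb : b = 0
  · have : a = 0 := by rwa [hb, norm_zero, norm_eq_zero] at hab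
    rw [this, hb]
  · have hb' : ‖b‖ ≠ 0 := norm_ne_zero_iff.2 hb
    set u : Circle := ⟨a / b, by
      rw [Submonoid.unitSphere, Submonoid.mem_mk]
      simp [hab, hb']⟩
    have h := (measurePreserving_mul_circleMeasure u).lintegral_comp
      (f := fun c : Circle => H (c * b)) (by fun_prop)
    rw [← h]
    refine lintegral_congr fun c => ?_
    rw [Circle.coe_mul, show ((u : Circle) : ℂ) = a / b from rfl]
    congr 1
    field_simp

/-- The mean over circles of `|U_{-z} f|²`, integrated over `z`. After averaging over the circle,
`moebius (-z) x` may be replaced by `moebius (-x) z`, which has the same modulus and preserves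
`moebiusMeasure` as a function of `z`. -/
theorem lintegral_lintegral_bergmanU (hα : 0 ≤ α) {f : ℂ → ℂ} (hf : Measurable f) {x : ℝ}
    (hx : (x : ℂ) ∈ disc) :
    ∫⁻ z, ∫⁻ c : Circle, ‖bergmanU α (-z) f (c * x)‖ₑ ^ 2 ∂circleMeasure ∂moebiusMeasure =
      ENNReal.ofReal (bergmanDensity α x)⁻¹ * ∫⁻ ζ, ‖f ζ‖ₑ ^ 2 ∂bergmanMeasure α := by
  set H : ℂ → ℝ≥0∞ := fun ζ => ENNReal.ofReal (bergmanDensity α ζ) * ‖f ζ‖ₑ ^ 2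
  have hH : Measurable H :=
    (measurable_bergmanDensity α).ennreal_ofReal.mul (hf.enorm.pow_const 2)
  have hrot : ∀ c : Circle, (c : ℂ) * x ∈ disc := fun c =>
    (isRadial_bergmanMeasure hα).rot_mem c hx
  have hD : ∀ c : Circle, bergmanDensity α (c * x) = bergmanDensity α x := fun c => by
    simp [bergmanDensity, Circle.norm_coe]
  have hpos := bergmanDensity_pos hα hx
  have hmm : Measurable fun p : ℂ × ℂ => moebius (-p.1) p.2 :=
    measurable_moebius.comp (f := fun p : ℂ × ℂ => (-p.1, p.2)) (by fun_prop)
  have e1 : ∫⁻ z, ∫⁻ c : Circle, ‖bergmanU α (-z) f (c * x)‖ₑ ^ 2 ∂circleMeasure ∂moebiusMeasure =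
      ∫⁻ z, ENNReal.ofReal (bergmanDensity α x)⁻¹ *
        ∫⁻ c : Circle, H (moebius (-z) (c * x)) ∂circleMeasure ∂moebiusMeasure := by
    refine lintegral_congr_ae ?_
    filter_upwards [ae_mem_disc_moebiusMeasure] with z hz
    rw [← lintegral_const_mul' _ _ (by simp)]
    refine lintegral_congr fun c => ?_
    have h := enorm_bergmanU_sq hα (neg_mem_disc hz) (hrot c) f
    rw [hD] at h
    simp only [H]
    rw [← h, ← mul_assoc, ← ENNReal.ofReal_mul (by positivity), inv_mul_cancel₀ hpos.ne',
      ENNReal.ofReal_one, one_mul]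
  rw [e1, lintegral_const_mul' _ _ (by simp), lintegral_bergman hα]
  congr 1
  calc ∫⁻ z, ∫⁻ c : Circle, H (moebius (-z) (c * x)) ∂circleMeasure ∂moebiusMeasure
      = ∫⁻ c : Circle, ∫⁻ z, H (moebius (-z) (c * x)) ∂moebiusMeasure ∂circleMeasure := by
        refine lintegral_lintegral_swap (Measurable.aemeasurable ?_)
        exact hH.comp (hmm.comp (f := fun p : ℂ × Circle => (p.1, (p.2 : ℂ) * x)) (by fun_prop))
    _ = ∫⁻ c : Circle, ∫⁻ z, H (c * moebius (-z) x) ∂moebiusMeasure ∂circleMeasure := by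
        refine lintegral_congr fun c => ?_
        have hk : Measurable fun z => H (moebius (-z) (c * x)) :=
          hH.comp (hmm.comp measurable_prodMk_right)
        rw [← (measurePreserving_rotation_moebiusMeasure c).lintegral_comp hk]
        refine lintegral_congr fun z => ?_
        have hc : conj (c : ℂ) * c = 1 := by
          rw [mul_comm, mul_conj, Circle.normSq_coe, ofReal_one]
        simp only [moebius]
        congr 1
        rw [← mul_div_assoc]
        congr 1
        · ring
        · rw [map_neg, map_neg, map_mul]
          linear_combination (conj z * x) * hc
    _ = ∫⁻ z, ∫⁻ c : Circle, H (c * moebius (-z) x) ∂circleMeasure ∂moebiusMeasure := by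
        refine (lintegral_lintegral_swap (Measurable.aemeasurable ?_)).symm
        refine hH.comp (Measurable.mul (by fun_prop) ?_)
        exact hmm.comp (f := fun p : ℂ × Circle => (p.1, (x : ℂ))) (by fun_prop)
    _ = ∫⁻ z, ∫⁻ c : Circle, H (c * moebius (-x) z) ∂circleMeasure ∂moebiusMeasure := by
        refine lintegral_congr_ae ?_
        filter_upwards [ae_mem_disc_moebiusMeasure] with z hz
        refine lintegral_circle_mul_eq_of_norm_eq hH ?_
        have : 1 - conj (-z) * (x : ℂ) = conj (1 - conj (-(x : ℂ)) * z) := by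
          simp [mul_comm]
        rw [moebius, moebius, norm_div, norm_div, this, RCLike.norm_conj]
        congr 2
        ring
    _ = ∫⁻ z, ∫⁻ c : Circle, H (c * z) ∂circleMeasure ∂moebiusMeasure := by
        refine (measurePreserving_moebius (neg_mem_disc hx)).lintegral_comp
          (f := fun z => ∫⁻ c : Circle, H (c * z) ∂circleMeasure) ?_
        exact Measurable.lintegral_prod_right' (f := fun p : ℂ × Circle => H (p.2 * p.1))
          (by fun_prop)
    _ = ∫⁻ c : Circle, ∫⁻ z, H (c * z) ∂moebiusMeasure ∂circleMeasure :=
        lintegral_lintegral_swap (by fun_prop)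
    _ = ∫⁻ z, H z ∂moebiusMeasure := by
        simp_rw [fun c : Circle => (measurePreserving_rotation_moebiusMeasure c).lintegral_comp hH]
        simp

/-- Schur orthogonality for the operators `U_z` on the Bergman space. -/
theorem lintegral_bergmanInner_sq (hα : 0 ≤ α) {g φ : ℂ → ℂ} (hg : MemBergman α g)
    (hgm : Measurable g) (hφ : MemBergman α φ) (hφm : Measurable φ) :
    ∫⁻ z, ∫⁻ c : Circle, ‖bergmanInner α g (bergmanU α z (rotate c φ))‖ₑ ^ 2
        ∂circleMeasure ∂moebiusMeasure =
      ENNReal.ofReal (1 / (α + 1)) * (∫⁻ ζ, ‖g ζ‖ₑ ^ 2 ∂bergmanMeasure α) *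
        ∫⁻ ζ, ‖φ ζ‖ₑ ^ 2 ∂bergmanMeasure α := by
  have hprob := isProbabilityMeasure_bergmanMeasure hα
  have hR := isRadial_bergmanMeasure hα
  have h1 : MemBergman α (fun _ => 1) := ⟨differentiableOn_const _, memLp_const _⟩
  have hmU : ∀ {f : ℂ → ℂ}, Measurable f →
      Measurable (Function.uncurry fun z => bergmanU α (-z) f) := fun hf =>
    (measurable_bergmanU hf).comp (f := fun p : ℂ × ℂ => (-p.1, p.2)) (by fun_prop)
  have hmem : ∀ {f : ℂ → ℂ}, MemBergman α f → Measurable f →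
      ∀ᵐ z ∂moebiusMeasure, MemBergman α (bergmanU α (-z) f) := fun hf hfm =>
    ae_mem_disc_moebiusMeasure.mono fun z hz => memBergman_bergmanU hα hf hfm (neg_mem_disc hz)
  have h := lintegral_inner_rotate_eq (ν := moebiusMeasure) hR one_half_pos
    (fun x h0 h1 => mem_disc.2 (by
      rw [norm_real, Real.norm_of_nonneg h0.le]; linarith))
    (G := fun z => bergmanU α (-z) g) (E := fun z => bergmanU α (-z) fun _ => 1)
    (hmU hgm) (hmU measurable_const)
    ((hmem hg hgm).mono fun z hz => hasCoeffs_disc hz.1)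
    ((hmem h1 measurable_const).mono fun z hz => hasCoeffs_disc hz.1)
    ((hmem hg hgm).mono fun z hz => hz.2)
    ((hmem h1 measurable_const).mono fun z hz => hz.2)
    hφm (hasCoeffs_disc hφ.1) hφ.2
    (N := ∫⁻ ζ, ‖g ζ‖ₑ ^ 2 ∂bergmanMeasure α) (C := ENNReal.ofReal (1 / (α + 1)))
    (lintegral_sq_ne_top_of_memLp hg.2)
    (fun x hx => by
      rw [lintegral_lintegral_bergmanU hα hgm hx,
        lintegral_lintegral_bergmanU hα measurable_const hx]
      simp [mul_comm])
    (fun x hx => by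
      rw [lintegral_lintegral_bergmanU hα measurable_const hx]
      simp)
    (fun n => by
      have hn : MemBergman α (fun ζ => ζ ^ n) := ⟨by fun_prop, hR.memLp_pow n⟩
      have hnm : Measurable fun ζ : ℂ => ζ ^ n := by fun_prop
      have h0 : (0 : ℂ) ∈ disc := by simp [mem_disc]
      -- the function `1` reproduces the value at `0`
      have hval : ∀ z ∈ disc,
          ‖∫ ζ, bergmanU α (-z) (fun _ => 1) ζ * conj (ζ ^ n) ∂bergmanMeasure α‖ₑ =
          ‖bergmanU α z (fun ζ => ζ ^ n) 0‖ₑ := by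
        intro z hz
        have h2 := bergmanInner_bergmanU hα hz (g := fun _ => 1) measurable_const hnm
        have hU := memBergman_bergmanU hα hn hnm hz
        have h3 := integral_mul_conj_pow hR
          (measurable_bergmanU_apply hnm z)
          (hasCoeffs_disc hU.1) hU.2 0
        rw [(hasCoeffs_disc hU.1).apply_zero h0] at h3
        simp only [pow_zero, map_one, mul_one, moment, mul_zero, lintegral_one, measure_univ,
          ENNReal.toReal_one, ofReal_one] at h3
        rw [show ∫ ζ, bergmanU α (-z) (fun _ => 1) ζ * conj (ζ ^ n) ∂bergmanMeasure α =
          conj (bergmanU α z (fun ζ => ζ ^ n) 0) by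
            rw [← h3, ← integral_conj]
            refine Eq.trans h2.symm ?_
            simp [bergmanInner], RCLike.enorm_conj]
      rw [lintegral_congr_ae (ae_mem_disc_moebiusMeasure.mono fun z hz => by
        show _ = ‖bergmanU α z (fun ζ => ζ ^ n) 0‖ₑ ^ 2
        rw [hval z hz])]
      rw [moment, lintegral_bergman hα, ← lintegral_const_mul' _ _ (by simp)]
      refine lintegral_congr_ae (ae_mem_disc_moebiusMeasure.mono fun z hz => ?_)
      have h4 := enorm_bergmanU_sq hα hz h0 (fun ζ => ζ ^ n)
      have h5 : bergmanDensity α 0 = α + 1 := by simp [bergmanDensity]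
      have h6 : ENNReal.ofReal (1 / (α + 1)) * ENNReal.ofReal (α + 1) = 1 := by
        rw [← ENNReal.ofReal_mul (by positivity), one_div_mul_cancel (by positivity),
          ENNReal.ofReal_one]
      have h7 : moebius z 0 = -z := by simp [moebius]
      have h8 : bergmanDensity α (-z) = bergmanDensity α z := by simp [bergmanDensity]
      rw [h7, h5, h8] at h4
      show ‖bergmanU α z (fun ζ => ζ ^ n) 0‖ₑ ^ 2 = _
      rw [← one_mul (‖bergmanU α z (fun ζ => ζ ^ n) 0‖ₑ ^ 2), ← h6, mul_assoc, h4]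
      simp [enorm_pow, ← pow_mul, mul_comm n 2])
  rw [show ENNReal.ofReal (1 / (α + 1)) * (∫⁻ ζ, ‖g ζ‖ₑ ^ 2 ∂bergmanMeasure α) *
        ∫⁻ ζ, ‖φ ζ‖ₑ ^ 2 ∂bergmanMeasure α = _ from by rw [mul_comm (ENNReal.ofReal _)], ← h]
  refine lintegral_congr_ae (ae_mem_disc_moebiusMeasure.mono fun z hz => ?_)
  refine lintegral_congr fun c => ?_
  rw [bergmanInner_bergmanU hα hz hgm (measurable_rotate hφm c)]
  rfl

end Bergman

/-! ### Existence of the localization operators -/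

theorem fockInner_congr_left {β : ℝ} {u u' : ℂ → ℂ} (h : u =ᵐ[fockMeasure β] u') (v : ℂ → ℂ) :
    fockInner β u v = fockInner β u' v :=
  integral_congr_ae (h.mono fun ζ hζ => by simp only [hζ])

theorem fockInner_conj (β : ℝ) (u v : ℂ → ℂ) : conj (fockInner β u v) = fockInner β v u := by
  rw [fockInner, ← integral_conj]
  exact integral_congr_ae (Eventually.of_forall fun ζ => by simp [mul_comm])

theorem bergmanInner_congr_left {α : ℝ} {u u' : ℂ → ℂ} (h : u =ᵐ[bergmanMeasure α] u')
    (v : ℂ → ℂ) : bergmanInner α u v = bergmanInner α u' v :=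
  integral_congr_ae (h.mono fun ζ hζ => by simp only [hζ])

theorem bergmanInner_conj (α : ℝ) (u v : ℂ → ℂ) :
    conj (bergmanInner α u v) = bergmanInner α v u := by
  rw [bergmanInner, ← integral_conj]
  exact integral_congr_ae (Eventually.of_forall fun ζ => by simp [mul_comm])

theorem MemFock.inner_toSpace {β : ℝ} {φ : ℂ → ℂ} (h : MemFock β φ) (u : FockSpace β) :
    inner ℂ h.toSpace u = fockInner β u.1 φ := by
  rw [Submodule.coe_inner, L2.inner_def]
  refine integral_congr_ae ?_
  filter_upwards [h.2.coeFn_toLp] with ζ hζ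
  rw [RCLike.inner_apply, MemFock.toSpace, hζ]

theorem MemBergman.inner_toSpace {α : ℝ} {φ : ℂ → ℂ} (h : MemBergman α φ) (u : BergmanSpace α) :
    inner ℂ h.toSpace u = bergmanInner α u.1 φ := by
  rw [Submodule.coe_inner, L2.inner_def]
  refine integral_congr_ae ?_
  filter_upwards [h.2.coeFn_toLp] with ζ hζ
  rw [RCLike.inner_apply, MemBergman.toSpace, hζ]

theorem exists_memFock_ae_eq {β : ℝ} (u : FockSpace β) :
    ∃ g : ℂ → ℂ, MemFock β g ∧ u.1 =ᵐ[fockMeasure β] g := by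
  obtain ⟨g, hg, hu⟩ := u.2
  exact ⟨g, ⟨hg, (memLp_congr_ae hu).1 (Lp.memLp u.1)⟩, hu⟩

/-- The representative is cut off outside the disc, which makes it Borel. -/
theorem exists_memBergman_ae_eq {α : ℝ} (u : BergmanSpace α) :
    ∃ g : ℂ → ℂ, MemBergman α g ∧ Measurable g ∧ u.1 =ᵐ[bergmanMeasure α] g := by
  obtain ⟨φ, hφ, hu⟩ := u.2
  have heq : ∀ ζ ∈ disc, disc.indicator φ ζ = φ ζ := fun ζ hζ => Set.indicator_of_mem hζ φ
  have hae : u.1 =ᵐ[bergmanMeasure α] disc.indicator φ :=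
    hu.trans ((ae_mem_disc_bergmanMeasure α).mono fun ζ hζ => (heq ζ hζ).symm)
  refine ⟨disc.indicator φ, ⟨hφ.congr heq, (memLp_congr_ae hae).1 (Lp.memLp u.1)⟩, ?_, hae⟩
  classical
  rw [← Set.piecewise_eq_indicator]
  exact hφ.continuousOn.measurable_piecewise continuousOn_const measurableSet_disc

theorem measurable_fockInner_weyl {β : ℝ} (hβ : 0 < β) {g φ : ℂ → ℂ} (hg : Measurable g)
    (hφ : Measurable φ) :
    Measurable fun p : Circle × ℂ => fockInner β g (weyl β p.2 (rotate p.1 φ)) := by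
  have := isProbabilityMeasure_fockMeasure hβ
  refine (StronglyMeasurable.integral_prod_right (f := fun (p : Circle × ℂ) (ζ : ℂ) =>
    g ζ * conj (weyl β p.2 (rotate p.1 φ) ζ)) (Measurable.stronglyMeasurable ?_)).measurable
  unfold Function.uncurry weyl rotate
  refine Measurable.mul (by fun_prop) (continuous_conj.measurable.comp ?_)
  fun_prop

theorem measurable_bergmanInner_bergmanU {α : ℝ} (hα : 0 ≤ α) {g φ : ℂ → ℂ} (hg : Measurable g)
    (hφ : Measurable φ) :
    Measurable fun p : Circle × ℂ => bergmanInner α g (bergmanU α p.2 (rotate p.1 φ)) := by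
  have := isProbabilityMeasure_bergmanMeasure hα
  refine (StronglyMeasurable.integral_prod_right (f := fun (p : Circle × ℂ) (ζ : ℂ) =>
    g ζ * conj (bergmanU α p.2 (rotate p.1 φ) ζ)) (Measurable.stronglyMeasurable ?_)).measurable
  have h1 : Measurable fun q : (Circle × ℂ) × ℂ => moebius q.1.2 q.2 :=
    measurable_moebius.comp (f := fun q : (Circle × ℂ) × ℂ => (q.1.2, q.2)) (by fun_prop)
  have h2 : Measurable fun q : (Circle × ℂ) × ℂ => φ (q.1.1 * moebius q.1.2 q.2) := by fun_prop
  refine Measurable.mul (by fun_prop) (continuous_conj.measurable.comp (h2.mul ?_))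
  fun_prop

theorem lintegral_prod_fockInner_sq {β : ℝ} (hβ : 0 < β) {g φ : ℂ → ℂ} (hg : MemFock β g)
    (hφ : MemFock β φ) :
    ∫⁻ p : Circle × ℂ, ‖fockInner β g (weyl β p.2 (rotate p.1 φ))‖ₑ ^ 2
        ∂(circleMeasure.prod volume) =
      ENNReal.ofReal (Real.pi / β) * (∫⁻ ζ, ‖g ζ‖ₑ ^ 2 ∂fockMeasure β) *
        ∫⁻ ζ, ‖φ ζ‖ₑ ^ 2 ∂fockMeasure β := by
  rw [← lintegral_fockInner_sq hβ hg hφ, lintegral_prod_symm]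
  exact ((measurable_fockInner_weyl hβ hg.1.continuous.measurable
    hφ.1.continuous.measurable).enorm.pow_const 2).aemeasurable

theorem lintegral_prod_bergmanInner_sq {α : ℝ} (hα : 0 ≤ α) {g φ : ℂ → ℂ} (hg : MemBergman α g)
    (hgm : Measurable g) (hφ : MemBergman α φ) (hφm : Measurable φ) :
    ∫⁻ p : Circle × ℂ, ‖bergmanInner α g (bergmanU α p.2 (rotate p.1 φ))‖ₑ ^ 2
        ∂(circleMeasure.prod moebiusMeasure) =
      ENNReal.ofReal (1 / (α + 1)) * (∫⁻ ζ, ‖g ζ‖ₑ ^ 2 ∂bergmanMeasure α) *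
        ∫⁻ ζ, ‖φ ζ‖ₑ ^ 2 ∂bergmanMeasure α := by
  rw [← lintegral_bergmanInner_sq hα hg hgm hφ hφm, lintegral_prod_symm]
  exact ((measurable_bergmanInner_bergmanU hα hgm hφm).enorm.pow_const 2).aemeasurable

theorem exists_isFockLocalization {β : ℝ} (hβ : 0 < β) {φ ψ : ℂ → ℂ} (hφ : MemFock β φ)
    (hψ : MemFock β ψ) {f : Circle × ℂ → ℂ}
    (hf : MemLp f ∞ (circleMeasure.prod (volume : Measure ℂ))) :
    ∃ T, IsFockLocalization β φ ψ f T := by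
  have := completeSpace_fockSpace hβ
  let w : ∀ {φ : ℂ → ℂ}, MemFock β φ → Circle × ℂ → FockSpace β := fun hφ p =>
    (memFock_weyl hβ (hφ.rotate hβ p.1) p.2).toSpace
  have hw : ∀ {φ : ℂ → ℂ} (hφ : MemFock β φ) (u : FockSpace β) (p : Circle × ℂ),
      inner ℂ (w hφ p) u = fockInner β u.1 (weyl β p.2 (rotate p.1 φ)) := fun hφ u p =>
    MemFock.inner_toSpace _ u
  have hmeas : ∀ {φ : ℂ → ℂ} (hφ : MemFock β φ) (u : FockSpace β),
      AEStronglyMeasurable (fun p => inner ℂ (w hφ p) u) (circleMeasure.prod volume) := by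
    intro φ hφ u
    obtain ⟨g, hg, hu⟩ := exists_memFock_ae_eq u
    simp_rw [hw, fockInner_congr_left hu]
    exact (measurable_fockInner_weyl hβ hg.1.continuous.measurable
      hφ.1.continuous.measurable).aestronglyMeasurable
  have hbound : ∀ {φ : ℂ → ℂ} (hφ : MemFock β φ) (u : FockSpace β),
      ∫⁻ p, ‖(inner ℂ (w hφ p) u : ℂ)‖ₑ ^ 2 ∂(circleMeasure.prod volume) ≤
        (ENNReal.ofReal (Real.pi / β) * ∫⁻ ζ, ‖φ ζ‖ₑ ^ 2 ∂fockMeasure β) * ‖u‖ₑ ^ 2 := by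
    intro φ hφ u
    obtain ⟨g, hg, hu⟩ := exists_memFock_ae_eq u
    simp_rw [hw, fockInner_congr_left hu]
    have hn : ∫⁻ ζ, ‖u.1 ζ‖ₑ ^ 2 ∂fockMeasure β = ∫⁻ ζ, ‖g ζ‖ₑ ^ 2 ∂fockMeasure β :=
      lintegral_congr_ae (hu.mono fun ζ hζ => by simp only [hζ])
    rw [lintegral_prod_fockInner_sq hβ hg hφ, show ‖u‖ₑ = ‖u.1‖ₑ from rfl, enorm_Lp_two_sq, hn,
      mul_right_comm]
  have hfin : ∀ {φ : ℂ → ℂ}, MemFock β φ →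
      ENNReal.ofReal (Real.pi / β) * ∫⁻ ζ, ‖φ ζ‖ₑ ^ 2 ∂fockMeasure β ≠ ∞ := fun hφ =>
    ENNReal.mul_ne_top (by simp) (lintegral_sq_ne_top_of_memLp hφ.2)
  obtain ⟨T, hT⟩ := exists_clm_inner_eq_integral hf (hmeas hφ) (hmeas hψ) (hfin hφ) (hfin hψ)
    (hbound hφ) (hbound hψ)
  have hint : ∀ (g h : FockSpace β) (p : Circle × ℂ),
      f p * inner ℂ (w hφ p) g * inner ℂ h (w hψ p) = fockIntegrand β φ ψ f g.1 h.1 p := by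
    intro g h p
    rw [← inner_conj_symm (𝕜 := ℂ) h, hw hφ, hw hψ, fockInner_conj]
    rfl
  refine ⟨(β / Real.pi : ℂ) • T, fun g h => ?_⟩
  obtain ⟨h1, h2⟩ := hT g h
  simp_rw [hint] at h1 h2
  refine ⟨h1, ?_⟩
  rw [_root_.smul_apply, inner_smul_right, h2, integral_prod _ h1]

theorem exists_isBergmanLocalization {α : ℝ} (hα : 0 ≤ α) {φ ψ : ℂ → ℂ} (hφ : MemBergman α φ)
    (hφm : Measurable φ) (hψ : MemBergman α ψ) (hψm : Measurable ψ) {f : Circle × ℂ → ℂ}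
    (hf : MemLp f ∞ (circleMeasure.prod moebiusMeasure)) :
    ∃ T, IsBergmanLocalization α φ ψ f T := by
  classical
  have := completeSpace_bergmanSpace hα
  have hae : ∀ᵐ p : Circle × ℂ ∂(circleMeasure.prod moebiusMeasure), p.2 ∈ disc :=
    Measure.quasiMeasurePreserving_snd.ae ae_mem_disc_moebiusMeasure
  let w : ∀ {φ : ℂ → ℂ}, MemBergman α φ → Measurable φ → Circle × ℂ → BergmanSpace α :=
    fun hφ hφm p => if hp : p.2 ∈ disc then
      (memBergman_bergmanU hα (hφ.rotate hα p.1) (measurable_rotate hφm p.1) hp).toSpace else 0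
  have hw : ∀ {φ : ℂ → ℂ} (hφ : MemBergman α φ) (hφm : Measurable φ) (u : BergmanSpace α)
      (p : Circle × ℂ), p.2 ∈ disc →
      inner ℂ (w hφ hφm p) u = bergmanInner α u.1 (bergmanU α p.2 (rotate p.1 φ)) := by
    intro φ hφ hφm u p hp
    simp only [w]
    rw [dif_pos hp]
    exact MemBergman.inner_toSpace _ u
  have hmeas : ∀ {φ : ℂ → ℂ} (hφ : MemBergman α φ) (hφm : Measurable φ) (u : BergmanSpace α),
      AEStronglyMeasurable (fun p => inner ℂ (w hφ hφm p) u)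
        (circleMeasure.prod moebiusMeasure) := by
    intro φ hφ hφm u
    obtain ⟨g, hg, hgm, hu⟩ := exists_memBergman_ae_eq u
    refine (measurable_bergmanInner_bergmanU hα hgm hφm).aestronglyMeasurable.congr ?_
    filter_upwards [hae] with p hp
    rw [hw hφ hφm u p hp, bergmanInner_congr_left hu]
  have hbound : ∀ {φ : ℂ → ℂ} (hφ : MemBergman α φ) (hφm : Measurable φ) (u : BergmanSpace α),
      ∫⁻ p, ‖(inner ℂ (w hφ hφm p) u : ℂ)‖ₑ ^ 2 ∂(circleMeasure.prod moebiusMeasure) ≤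
        (ENNReal.ofReal (1 / (α + 1)) * ∫⁻ ζ, ‖φ ζ‖ₑ ^ 2 ∂bergmanMeasure α) * ‖u‖ₑ ^ 2 := by
    intro φ hφ hφm u
    obtain ⟨g, hg, hgm, hu⟩ := exists_memBergman_ae_eq u
    rw [lintegral_congr_ae (hae.mono fun p hp => by
      rw [hw hφ hφm u p hp, bergmanInner_congr_left hu])]
    have hn : ∫⁻ ζ, ‖u.1 ζ‖ₑ ^ 2 ∂bergmanMeasure α = ∫⁻ ζ, ‖g ζ‖ₑ ^ 2 ∂bergmanMeasure α :=
      lintegral_congr_ae (hu.mono fun ζ hζ => by simp only [hζ])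
    rw [lintegral_prod_bergmanInner_sq hα hg hgm hφ hφm, show ‖u‖ₑ = ‖u.1‖ₑ from rfl,
      enorm_Lp_two_sq, hn, mul_right_comm]
  have hfin : ∀ {φ : ℂ → ℂ}, MemBergman α φ →
      ENNReal.ofReal (1 / (α + 1)) * ∫⁻ ζ, ‖φ ζ‖ₑ ^ 2 ∂bergmanMeasure α ≠ ∞ := fun hφ =>
    ENNReal.mul_ne_top (by simp) (lintegral_sq_ne_top_of_memLp hφ.2)
  obtain ⟨T, hT⟩ := exists_clm_inner_eq_integral hf (hmeas hφ hφm) (hmeas hψ hψm) (hfin hφ)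
    (hfin hψ) (hbound hφ hφm) (hbound hψ hψm)
  have hint : ∀ (g h : BergmanSpace α), (fun p : Circle × ℂ =>
      f p * inner ℂ (w hφ hφm p) g * inner ℂ h (w hψ hψm p))
        =ᵐ[circleMeasure.prod moebiusMeasure] bergmanIntegrand α φ ψ f g.1 h.1 := by
    intro g h
    filter_upwards [hae] with p hp
    rw [← inner_conj_symm (𝕜 := ℂ) h, hw hφ hφm g p hp, hw hψ hψm h p hp, bergmanInner_conj]
    rfl
  refine ⟨(α + 1 : ℂ) • T, fun g h => ?_⟩
  obtain ⟨h1, h2⟩ := hT g h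
  rw [integrable_congr (hint g h)] at h1
  rw [integral_congr_ae (hint g h)] at h2
  refine ⟨h1, ?_⟩
  rw [_root_.smul_apply, inner_smul_right, h2, integral_prod _ h1]

theorem isFockLocalization_fockLocalization {β : ℝ} (hβ : 0 < β) {φ ψ : ℂ → ℂ}
    (hφ : MemFock β φ) (hψ : MemFock β ψ) {f : Circle × ℂ → ℂ}
    (hf : MemLp f ∞ (circleMeasure.prod (volume : Measure ℂ))) :
    IsFockLocalization β φ ψ f (fockLocalization β φ ψ f) := by
  have h := exists_isFockLocalization hβ hφ hψ hf
  rw [fockLocalization, dif_pos h]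
  exact h.choose_spec

theorem isBergmanLocalization_bergmanLocalization {α : ℝ} (hα : 0 ≤ α) {φ ψ : ℂ → ℂ}
    (hφ : MemBergman α φ) (hφm : Measurable φ) (hψ : MemBergman α ψ) (hψm : Measurable ψ)
    {f : Circle × ℂ → ℂ} (hf : MemLp f ∞ (circleMeasure.prod moebiusMeasure)) :
    IsBergmanLocalization α φ ψ f (bergmanLocalization α φ ψ f) := by
  have h := exists_isBergmanLocalization hα hφ hφm hψ hψm hf
  rw [bergmanLocalization, dif_pos h]
  exact h.choose_spec

theorem quasiMeasurePreserving_dilate {r : ℝ} (hr : 0 < r) :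
    Measure.QuasiMeasurePreserving (fun p : Circle × ℂ => (p.1, (r : ℂ) * p.2))
      (circleMeasure.prod moebiusMeasure) (circleMeasure.prod volume) := by
  have h1 : Measure.QuasiMeasurePreserving (fun z : ℂ => (r : ℂ) * z) moebiusMeasure volume := by
    have hac : moebiusMeasure ≪ (volume : Measure ℂ) :=
      (withDensity_absolutelyContinuous _ _).trans Measure.restrict_le_self.absolutelyContinuous
    refine ⟨by fun_prop, hac.map (by fun_prop) |>.trans ?_⟩
    have := Measure.map_addHaar_smul (volume : Measure ℂ) hr.ne'
    have e : (fun z : ℂ => (r : ℂ) * z) = (r • ·) := by funext z; simp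
    rw [e, this]
    exact Measure.smul_absolutelyContinuous
  exact QuasiMeasurePreserving.prodMap (Measure.QuasiMeasurePreserving.id circleMeasure) h1

theorem memLp_dilateSymbol {f : Circle × ℂ → ℂ}
    (hf : MemLp f ∞ (circleMeasure.prod (volume : Measure ℂ))) {r σ : ℝ} (hr : 0 < r)
    (hσ : 0 ≤ σ) : MemLp (dilateSymbol r σ f) ∞ (circleMeasure.prod moebiusMeasure) := by
  have hq := quasiMeasurePreserving_dilate hr
  have hae : ∀ᵐ p : Circle × ℂ ∂(circleMeasure.prod moebiusMeasure), p.2 ∈ disc :=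
    Measure.quasiMeasurePreserving_snd.ae ae_mem_disc_moebiusMeasure
  have h1 : MemLp (fun p : Circle × ℂ => f (p.1, (r : ℂ) * p.2)) ∞
      (circleMeasure.prod moebiusMeasure) := by
    refine memLp_top_of_bound (hf.1.comp_quasiMeasurePreserving hq)
      (eLpNormEssSup f (circleMeasure.prod volume)).toReal ?_
    have hfin : eLpNormEssSup f (circleMeasure.prod volume) ≠ ∞ := by
      have := hf.2.ne; rwa [eLpNorm_exponent_top] at this
    have h2 := hq.ae (enorm_ae_le_eLpNormEssSup f (circleMeasure.prod volume))
    filter_upwards [h2] with p hp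
    rw [← toReal_enorm]
    exact ENNReal.toReal_mono hfin hp
  have h2 : MemLp (fun p : Circle × ℂ => (((1 - ‖p.2‖ ^ 2) ^ σ : ℝ) : ℂ)) ∞
      (circleMeasure.prod moebiusMeasure) := by
    refine memLp_top_of_bound (Measurable.aestronglyMeasurable (by fun_prop)) 1 ?_
    filter_upwards [hae] with p hp
    have h3 := one_sub_norm_sq_pos hp
    rw [norm_real, Real.norm_of_nonneg (by positivity)]
    exact Real.rpow_le_one h3.le (by nlinarith [norm_nonneg p.2]) hσ
  exact h1.mul h2

/-! ### Rescaling the disc to a large disc -/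

/-- The density of the image of `moebiusMeasure` under `z ↦ r z`. -/
noncomputable def moebiusScaled (r : ℝ) (w : ℂ) : ℝ :=
  if ‖w‖ < r then 1 / (Real.pi * r ^ 2 * (1 - ‖w‖ ^ 2 / r ^ 2) ^ 2) else 0

/-- The density of the image of `bergmanMeasure (β * r ^ 2)` under `z ↦ r z`. -/
noncomputable def bergmanScaled (β r : ℝ) (w : ℂ) : ℝ :=
  if ‖w‖ < r then
    (β * r ^ 2 + 1) / (Real.pi * r ^ 2) * (1 - ‖w‖ ^ 2 / r ^ 2) ^ (β * r ^ 2) else 0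

theorem measurable_moebiusScaled (r : ℝ) : Measurable (moebiusScaled r) := by
  unfold moebiusScaled
  exact Measurable.ite (measurableSet_lt (by fun_prop) (by fun_prop)) (by fun_prop) (by fun_prop)

theorem measurable_bergmanScaled (β r : ℝ) : Measurable (bergmanScaled β r) := by
  unfold bergmanScaled
  exact Measurable.ite (measurableSet_lt (by fun_prop) (by fun_prop)) (by fun_prop) (by fun_prop)

theorem moebiusScaled_nonneg (r : ℝ) (w : ℂ) : 0 ≤ moebiusScaled r w := by
  unfold moebiusScaled
  split_ifs <;> positivity

theorem div_mem_disc {r : ℝ} {w : ℂ} (h : ‖w‖ < r) : w / r ∈ disc := by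
  have hr : 0 < r := (norm_nonneg w).trans_lt h
  rw [mem_disc, norm_div, norm_real, Real.norm_of_nonneg hr.le]
  exact (div_lt_one hr).2 h

theorem norm_div_ofReal_sq (r : ℝ) (w : ℂ) : ‖w / (r : ℂ)‖ ^ 2 = ‖w‖ ^ 2 / r ^ 2 := by
  rw [norm_div, norm_real, div_pow, Real.norm_eq_abs, sq_abs]

theorem one_sub_norm_sq_div_pos {r : ℝ} {w : ℂ} (h : ‖w‖ < r) : 0 < 1 - ‖w‖ ^ 2 / r ^ 2 := by
  rw [← norm_div_ofReal_sq]
  exact one_sub_norm_sq_pos (div_mem_disc h)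

theorem bergmanScaled_nonneg {β : ℝ} (hβ : 0 < β) (r : ℝ) (w : ℂ) : 0 ≤ bergmanScaled β r w := by
  unfold bergmanScaled
  split_ifs with h
  · have := one_sub_norm_sq_div_pos h
    positivity
  · exact le_rfl

theorem moebiusScaled_mul_bergmanDensity {β r : ℝ} (w : ℂ) :
    moebiusScaled r w * bergmanDensity (β * r ^ 2) (w / r) = bergmanScaled β r w := by
  unfold moebiusScaled bergmanScaled
  split_ifs with h
  · have h1 := one_sub_norm_sq_div_pos h
    rw [bergmanDensity, norm_div_ofReal_sq, Real.rpow_add h1, Real.rpow_two]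
    field_simp
  · rw [zero_mul]

theorem moebiusScaled_mul {r : ℝ} (hr : 0 < r) (z : ℂ) : moebiusScaled r (r * z) * r ^ 2 =
    disc.indicator (fun z => 1 / (Real.pi * (1 - ‖z‖ ^ 2) ^ 2)) z := by
  have hn : ‖(r : ℂ) * z‖ = r * ‖z‖ := by
    rw [norm_mul, norm_real, Real.norm_of_nonneg hr.le]
  unfold moebiusScaled
  rw [hn]
  by_cases h : z ∈ disc
  · have h1 := one_sub_norm_sq_pos h
    rw [Set.indicator_of_mem h, if_pos (by nlinarith [mem_disc.1 h]), mul_pow,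
      mul_div_cancel_left₀ _ (by positivity)]
    field_simp
  · rw [Set.indicator_of_notMem h, if_neg, zero_mul]
    rw [mem_disc, not_lt] at h
    nlinarith

/-- The change of variables `z = w / r`. -/
theorem lintegral_moebiusMeasure_scaled {r : ℝ} (hr : 0 < r) {F : ℂ → ℝ≥0∞} (hF : Measurable F) :
    ∫⁻ z, F z ∂moebiusMeasure = ∫⁻ w, ENNReal.ofReal (moebiusScaled r w) * F (w / r) := by
  set G : ℂ → ℝ≥0∞ := fun w => ENNReal.ofReal (moebiusScaled r w) * F (w / r)
  have hG : Measurable G := (measurable_moebiusScaled r).ennreal_ofReal.mul (by fun_prop)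
  have h1 : ∫⁻ z, G (r • z) = ENNReal.ofReal ((r ^ 2)⁻¹) * ∫⁻ w, G w := by
    rw [← lintegral_map hG (measurable_const_smul r), Measure.map_addHaar_smul _ hr.ne',
      lintegral_smul_measure, Complex.finrank_real_complex, abs_of_nonneg (by positivity)]
    rfl
  have h2 : ENNReal.ofReal (r ^ 2) * ENNReal.ofReal ((r ^ 2)⁻¹) = 1 := by
    rw [← ENNReal.ofReal_mul (by positivity), mul_inv_cancel₀ (by positivity), ENNReal.ofReal_one]
  rw [← one_mul (∫⁻ w, G w), ← h2, mul_assoc, ← h1, ← lintegral_const_mul' _ _ (by simp),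
    lintegral_moebiusMeasure, ← lintegral_indicator measurableSet_disc]
  refine lintegral_congr fun z => ?_
  have hr' : (r : ℂ) ≠ 0 := by exact_mod_cast hr.ne'
  simp only [G]
  rw [real_smul, ← mul_assoc, ← ENNReal.ofReal_mul (by positivity), mul_comm (r ^ 2),
    moebiusScaled_mul hr, mul_div_cancel_left₀ _ hr']
  by_cases h : z ∈ disc
  · rw [Set.indicator_of_mem h, Set.indicator_of_mem h]
  · rw [Set.indicator_of_notMem h, Set.indicator_of_notMem h]
    simp

theorem integral_moebiusMeasure_scaled {r : ℝ} (hr : 0 < r) (F : ℂ → ℂ) :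
    ∫ z, F z ∂moebiusMeasure = ∫ w, (moebiusScaled r w : ℂ) * F (w / r) := by
  set G : ℂ → ℂ := fun w => (moebiusScaled r w : ℂ) * F (w / r)
  have h1 := Measure.integral_comp_smul (volume : Measure ℂ) G r
  rw [Complex.finrank_real_complex, abs_of_nonneg (by positivity)] at h1
  have h3 : ∫ w, G w = r ^ 2 • ∫ z, G (r • z) := by
    rw [h1, smul_smul, mul_inv_cancel₀ (by positivity), one_smul]
  rw [h3, ← integral_smul, moebiusMeasure, integral_withDensity_eq_integral_toReal_smul
    measurable_moebiusDensity (by simp), ← integral_indicator measurableSet_disc]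
  refine integral_congr_ae (Eventually.of_forall fun z => ?_)
  have hr' : (r : ℂ) ≠ 0 := by exact_mod_cast hr.ne'
  have h4 := moebiusScaled_mul hr z
  simp only [G]
  rw [real_smul, real_smul, mul_div_cancel_left₀ _ hr', ← mul_assoc, ← ofReal_mul,
    mul_comm (r ^ 2), h4]
  by_cases h : z ∈ disc
  · rw [Set.indicator_of_mem h, Set.indicator_of_mem h, ENNReal.toReal_ofReal (by positivity),
      real_smul]
  · rw [Set.indicator_of_notMem h, Set.indicator_of_notMem h]
    simp

section Limits

variable {β : ℝ}

theorem lintegral_bergman_scaled (hβ : 0 < β) {r : ℝ} (hr : 0 < r) {F : ℂ → ℝ≥0∞}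
    (hF : Measurable F) : ∫⁻ z, F z ∂bergmanMeasure (β * r ^ 2) =
      ∫⁻ w, ENNReal.ofReal (bergmanScaled β r w) * F (w / r) := by
  rw [lintegral_bergman (by positivity), lintegral_moebiusMeasure_scaled hr
    (F := fun ζ => ENNReal.ofReal (bergmanDensity (β * r ^ 2) ζ) * F ζ)
    ((measurable_bergmanDensity _).ennreal_ofReal.mul hF)]
  refine lintegral_congr fun w => ?_
  rw [← mul_assoc, ← ENNReal.ofReal_mul (moebiusScaled_nonneg r w),
    moebiusScaled_mul_bergmanDensity]

theorem integral_bergman_scaled (hβ : 0 < β) {r : ℝ} (hr : 0 < r) (F : ℂ → ℂ) :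
    ∫ z, F z ∂bergmanMeasure (β * r ^ 2) = ∫ w, (bergmanScaled β r w : ℂ) * F (w / r) := by
  rw [integral_bergman (by positivity), integral_moebiusMeasure_scaled hr]
  refine integral_congr_ae (Eventually.of_forall fun w => ?_)
  simp only
  rw [← mul_assoc, ← ofReal_mul, moebiusScaled_mul_bergmanDensity]

/-! ### Pointwise limits -/

theorem tendsto_inv_sq_atTop : Tendsto (fun r : ℝ => (r ^ 2)⁻¹) atTop (𝓝 0) :=
  (tendsto_pow_atTop two_ne_zero).inv_tendsto_atTop

theorem tendsto_moebiusScaled (β : ℝ) (w : ℂ) :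
    Tendsto (fun r : ℝ => (β * r ^ 2 + 1) * moebiusScaled r w) atTop (𝓝 (β / Real.pi)) := by
  have h1 : Tendsto (fun s : ℝ => (β + s) / (Real.pi * (1 - ‖w‖ ^ 2 * s) ^ 2)) (𝓝 0)
      (𝓝 (β / Real.pi)) := by
    have : ContinuousAt (fun s : ℝ => (β + s) / (Real.pi * (1 - ‖w‖ ^ 2 * s) ^ 2)) 0 := by
      refine ContinuousAt.div (by fun_prop) (by fun_prop) ?_
      simp [Real.pi_ne_zero]
    simpa [ContinuousAt] using this
  refine (h1.comp tendsto_inv_sq_atTop).congr' ?_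
  filter_upwards [eventually_gt_atTop ‖w‖] with r hr
  have hr0 : 0 < r := (norm_nonneg w).trans_lt hr
  rw [Function.comp, moebiusScaled, if_pos hr, ← div_eq_mul_inv]
  field_simp

theorem tendsto_bergmanScaled (hβ : 0 < β) (w : ℂ) :
    Tendsto (fun r : ℝ => bergmanScaled β r w) atTop (𝓝 (fockDensity β w)) := by
  have hx : Tendsto (fun r : ℝ => β * r ^ 2) atTop atTop :=
    (tendsto_pow_atTop two_ne_zero).const_mul_atTop hβ
  have h1 := (Real.tendsto_one_add_div_rpow_exp (-β * ‖w‖ ^ 2)).comp hx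
  have h2 : Tendsto (fun r : ℝ => (β + (r ^ 2)⁻¹) / Real.pi) atTop (𝓝 (β / Real.pi)) := by
    simpa using (tendsto_inv_sq_atTop.const_add β).div_const Real.pi
  refine (h2.mul h1).congr' ?_
  filter_upwards [eventually_gt_atTop ‖w‖] with r hr
  have hr0 : 0 < r := (norm_nonneg w).trans_lt hr
  rw [bergmanScaled, if_pos hr, Function.comp]
  have e1 : -β * ‖w‖ ^ 2 / (β * r ^ 2) = -(‖w‖ ^ 2 / r ^ 2) := by field_simp
  rw [e1, ← sub_eq_add_neg]
  congr 1
  field_simp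

/-- From `1 - t ≤ exp (-t)`; it makes the norms `‖g_r‖` converge by dominated convergence. -/
theorem bergmanScaled_le (hβ : 0 < β) {r : ℝ} (hr : 1 ≤ r) (w : ℂ) :
    bergmanScaled β r w ≤ (β + 1) / β * fockDensity β w := by
  have hr0 : 0 < r := by linarith
  unfold bergmanScaled
  split_ifs with h
  · have h1 := one_sub_norm_sq_div_pos h
    have h2 : (1 - ‖w‖ ^ 2 / r ^ 2) ^ (β * r ^ 2) ≤ Real.exp (-β * ‖w‖ ^ 2) := by
      calc (1 - ‖w‖ ^ 2 / r ^ 2) ^ (β * r ^ 2)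
          ≤ Real.exp (-(‖w‖ ^ 2 / r ^ 2)) ^ (β * r ^ 2) := by
            refine Real.rpow_le_rpow h1.le ?_ (by positivity)
            linarith [Real.add_one_le_exp (-(‖w‖ ^ 2 / r ^ 2))]
        _ = Real.exp (-β * ‖w‖ ^ 2) := by
            rw [← Real.exp_mul]
            congr 1
            field_simp
    have h3 : (β * r ^ 2 + 1) / (Real.pi * r ^ 2) ≤ (β + 1) / Real.pi := by
      rw [div_le_div_iff₀ (by positivity) Real.pi_pos]
      have : 1 ≤ r ^ 2 := one_le_pow₀ hr
      nlinarith [Real.pi_pos]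
    calc _ ≤ (β + 1) / Real.pi * Real.exp (-β * ‖w‖ ^ 2) := by gcongr
      _ = _ := by unfold fockDensity; field_simp
  · have := fockDensity_nonneg hβ w
    positivity

/-- The Jacobian factor of `U_{z/r}` converges to the exponential factor of `W_z`. -/
theorem tendsto_moebiusDeriv_cpow (z w : ℂ) :
    Tendsto (fun r : ℝ => moebiusDeriv (z / r) (w / r) ^ (((2 + β * r ^ 2) / 2 : ℝ) : ℂ)) atTop
      (𝓝 (cexp (β * conj z * w - ((β * ‖z‖ ^ 2 / 2 : ℝ) : ℂ)))) := by
  -- with `s = r⁻²` the base is a smooth function of `s` equal to `1` at `s = 0`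
  set a : ℂ := ((‖z‖ ^ 2 : ℝ) : ℂ)
  set b : ℂ := conj z * w
  set J : ℂ → ℂ := fun s => (1 - a * s) / (1 - b * s) ^ 2
  have hJ0 : J 0 = 1 := by simp [J]
  have hJ : HasDerivAt J (2 * b - a) 0 := by
    have h1 : HasDerivAt (fun s : ℂ => 1 - a * s) (-a) 0 := by
      simpa using ((hasDerivAt_id (0 : ℂ)).const_mul a).const_sub 1
    have h2 : HasDerivAt (fun s : ℂ => 1 - b * s) (-b) 0 := by
      simpa using ((hasDerivAt_id (0 : ℂ)).const_mul b).const_sub 1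
    have h3 := h1.div (h2.pow 2) (by simp)
    have h4 : 2 * b - a = (-a * ((fun s : ℂ => 1 - b * s) ^ 2) 0 -
        (1 - a * 0) * (((2 : ℕ) : ℂ) * (1 - b * 0) ^ (2 - 1) * -b)) /
          (((fun s : ℂ => 1 - b * s) ^ 2) 0) ^ 2 := by
      simp; ring
    rw [h4]
    exact h3
  have hlog : HasDerivAt (fun s => log (J s)) (2 * b - a) 0 := by
    have := hJ.clog (by rw [hJ0]; exact one_mem_slitPlane)
    rwa [hJ0, div_one] at this
  -- `log (J s) / s` tends to the derivative of `log ∘ J` at `0`, and `s⁻¹ = r²`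
  have hslope := hasDerivAt_iff_tendsto_slope_zero.1 hlog
  simp only [zero_add, hJ0, log_one, sub_zero, smul_eq_mul] at hslope
  have hs0 : Tendsto (fun r : ℝ => (((r ^ 2)⁻¹ : ℝ) : ℂ)) atTop (𝓝 0) := by
    have := (continuous_ofReal.tendsto 0).comp tendsto_inv_sq_atTop
    simpa [Function.comp_def] using this
  have hs : Tendsto (fun r : ℝ => (((r ^ 2)⁻¹ : ℝ) : ℂ)) atTop (𝓝[≠] 0) := by
    refine tendsto_nhdsWithin_iff.2 ⟨hs0, ?_⟩
    filter_upwards [eventually_gt_atTop 0] with r hr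
    have : (r ^ 2)⁻¹ ≠ 0 := by positivity
    exact ofReal_ne_zero.2 this
  have h1 := hslope.comp hs
  have h2 : Tendsto (fun r : ℝ => (((r ^ 2)⁻¹ : ℝ) : ℂ) + β / 2) atTop (𝓝 (β / 2)) := by
    simpa using hs0.add_const ((β : ℂ) / 2)
  have h3 := (continuous_exp.tendsto _).comp (h1.mul h2)
  have hlim : (2 * b - a) * (β / 2 : ℂ) = β * conj z * w - ((β * ‖z‖ ^ 2 / 2 : ℝ) : ℂ) := by
    simp only [a, b]; push_cast; ring
  rw [hlim] at h3
  refine h3.congr' ?_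
  filter_upwards [eventually_gt_atTop ‖z‖, eventually_gt_atTop ‖w‖] with r hz hw
  have hr0 : 0 < r := (norm_nonneg z).trans_lt hz
  have hr' : (r : ℂ) ≠ 0 := by exact_mod_cast hr0.ne'
  have hne := moebiusDeriv_ne_zero (div_mem_disc hz) (div_mem_disc hw)
  have hJr : J (((r ^ 2)⁻¹ : ℝ) : ℂ) = moebiusDeriv (z / r) (w / r) := by
    simp only [J, moebiusDeriv, a, b]
    rw [norm_div_ofReal_sq, map_div₀, conj_ofReal]
    push_cast
    congr 1
    congr 1
    field_simp
  rw [cpow_def_of_ne_zero hne]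
  simp only [Function.comp]
  rw [hJr]
  congr 1
  push_cast
  field_simp

theorem tendsto_bergmanU (β : ℝ) {φ : ℂ → ℂ} (hφ : Continuous φ) (z w : ℂ) :
    Tendsto (fun r : ℝ => bergmanU (β * r ^ 2) (z / r) (dilate r φ) (w / r)) atTop
      (𝓝 (weyl β z φ w)) := by
  refine Tendsto.mul ?_ (tendsto_moebiusDeriv_cpow z w)
  refine (hφ.tendsto _).comp ?_
  have hs0 : Tendsto (fun r : ℝ => (((r ^ 2)⁻¹ : ℝ) : ℂ)) atTop (𝓝 0) := by
    have := (continuous_ofReal.tendsto 0).comp tendsto_inv_sq_atTop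
    simpa [Function.comp_def] using this
  have h1 : Tendsto (fun r : ℝ => (w - z) / (1 - conj z * w * (((r ^ 2)⁻¹ : ℝ) : ℂ))) atTop
      (𝓝 (w - z)) := by
    have h2 := (hs0.const_mul (conj z * w)).const_sub 1
    have h3 : Tendsto (fun r : ℝ => (w - z) / (1 - conj z * w * (((r ^ 2)⁻¹ : ℝ) : ℂ))) atTop
        (𝓝 ((w - z) / (1 - conj z * w * 0))) := tendsto_const_nhds.div h2 (by simp)
    simpa using h3
  refine h1.congr' ?_
  filter_upwards [eventually_gt_atTop 0] with r hr
  have hr' : (r : ℂ) ≠ 0 := by exact_mod_cast hr.ne'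
  rw [moebius, map_div₀, conj_ofReal, ← mul_div_assoc]
  push_cast
  congr 1
  · field_simp
  · field_simp

/-! ### Limits of norms and inner products -/

theorem dilate_div {r : ℝ} (hr : 0 < r) (g : ℂ → ℂ) (w : ℂ) : dilate r g (w / r) = g w := by
  have hr' : (r : ℂ) ≠ 0 := by exact_mod_cast hr.ne'
  rw [dilate, mul_div_cancel₀ _ hr']

theorem measurable_dilate (r : ℝ) {g : ℂ → ℂ} (hg : Measurable g) : Measurable (dilate r g) := by
  unfold dilate; fun_prop

/-- The norms of `g_r` in `A²_{βr²}` converge to the norm of `g` in `F²_β`. -/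
theorem tendsto_lintegral_dilate_sq (hβ : 0 < β) {g : ℂ → ℂ} (hg : MemFock β g) :
    Tendsto (fun r : ℝ => ∫⁻ ζ, ‖dilate r g ζ‖ₑ ^ 2 ∂bergmanMeasure (β * r ^ 2)) atTop
      (𝓝 (∫⁻ ζ, ‖g ζ‖ₑ ^ 2 ∂fockMeasure β)) := by
  have hgm := hg.1.continuous.measurable
  have hlim : Tendsto (fun r : ℝ => ∫⁻ w, ENNReal.ofReal (bergmanScaled β r w) * ‖g w‖ₑ ^ 2) atTop
      (𝓝 (∫⁻ w, ENNReal.ofReal (fockDensity β w) * ‖g w‖ₑ ^ 2)) := by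
    refine tendsto_lintegral_filter_of_dominated_convergence
      (fun w => ENNReal.ofReal ((β + 1) / β) * (ENNReal.ofReal (fockDensity β w) * ‖g w‖ₑ ^ 2))
      ?_ ?_ ?_ ?_
    · exact Eventually.of_forall fun r =>
        (measurable_bergmanScaled β r).ennreal_ofReal.mul (hgm.enorm.pow_const 2)
    · filter_upwards [eventually_ge_atTop 1] with r hr
      refine Eventually.of_forall fun w => ?_
      rw [← mul_assoc, ← ENNReal.ofReal_mul (by positivity)]
      gcongr
      exact bergmanScaled_le hβ hr w
    · rw [lintegral_const_mul' _ _ (by simp), ← lintegral_fock]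
      exact ENNReal.mul_ne_top (by simp) (lintegral_sq_ne_top_of_memLp hg.2)
    · refine Eventually.of_forall fun w => ?_
      exact ENNReal.Tendsto.mul_const (ENNReal.tendsto_ofReal (tendsto_bergmanScaled hβ w))
        (Or.inr (by simp))
  rw [lintegral_fock]
  refine hlim.congr' ?_
  filter_upwards [eventually_gt_atTop 0] with r hr
  rw [lintegral_bergman_scaled hβ hr ((measurable_dilate r hgm).enorm.pow_const 2)]
  simp_rw [dilate_div hr]

/-- The inner products `⟨g_r, U_{z/r} φ_r⟩` converge to `⟨g, W_z φ⟩`. The majorants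
`|g|² + |U_{z/r} φ_r|²` have integrals `‖g_r‖² + ‖φ_r‖²`, as `U_{z/r}` is isometric. -/
theorem tendsto_bergmanInner (hβ : 0 < β) {g φ : ℂ → ℂ} (hg : MemFock β g) (hφ : MemFock β φ)
    (z : ℂ) :
    Tendsto (fun r : ℝ => bergmanInner (β * r ^ 2) (dilate r g)
        (bergmanU (β * r ^ 2) (z / r) (dilate r φ))) atTop
      (𝓝 (fockInner β g (weyl β z φ))) := by
  have hgm := hg.1.continuous.measurable
  have hφm := hφ.1.continuous.measurable
  set U : ℝ → ℂ → ℂ := fun r => bergmanU (β * r ^ 2) (z / r) (dilate r φ)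
  have hUm : ∀ r, Measurable (U r) := fun r =>
    measurable_bergmanU_apply (measurable_dilate r hφm) _
  have hUm' : ∀ r : ℝ, Measurable fun w : ℂ => U r (w / r) := fun r =>
    (hUm r).comp (by fun_prop)
  have hWm : Measurable (weyl β z φ) := (memFock_weyl hβ hφ z).1.continuous.measurable
  have hUlim : ∀ w, Tendsto (fun r : ℝ => U r (w / r)) atTop (𝓝 (weyl β z φ w)) := fun w =>
    tendsto_bergmanU β hφ.1.continuous z w
  set G : ℝ → ℂ → ℝ≥0∞ := fun r w =>
    ENNReal.ofReal (bergmanScaled β r w) * (‖g w‖ₑ ^ 2 + ‖U r (w / r)‖ₑ ^ 2)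
  set G₀ : ℂ → ℝ≥0∞ := fun w =>
    ENNReal.ofReal (fockDensity β w) * (‖g w‖ₑ ^ 2 + ‖weyl β z φ w‖ₑ ^ 2)
  have hG₀ : ∫⁻ w, G₀ w = ∫⁻ ζ, ‖g ζ‖ₑ ^ 2 ∂fockMeasure β + ∫⁻ ζ, ‖φ ζ‖ₑ ^ 2 ∂fockMeasure β := by
    rw [← lintegral_weyl_sq hβ z φ, ← lintegral_add_left (hgm.enorm.pow_const 2), lintegral_fock]
  have hG : ∀ᶠ r : ℝ in atTop, ∫⁻ ζ, ‖dilate r g ζ‖ₑ ^ 2 ∂bergmanMeasure (β * r ^ 2) +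
      ∫⁻ ζ, ‖dilate r φ ζ‖ₑ ^ 2 ∂bergmanMeasure (β * r ^ 2) = ∫⁻ w, G r w := by
    filter_upwards [eventually_gt_atTop ‖z‖] with r hr
    have hr0 : 0 < r := (norm_nonneg z).trans_lt hr
    rw [← lintegral_bergmanU_sq (by positivity) (div_mem_disc hr) (measurable_dilate r hφm),
      ← lintegral_add_left ((measurable_dilate r hgm).enorm.pow_const 2),
      lintegral_bergman_scaled hβ hr0 (F := fun ζ => ‖dilate r g ζ‖ₑ ^ 2 +
        ‖bergmanU (β * r ^ 2) (z / r) (dilate r φ) ζ‖ₑ ^ 2) (((measurable_dilate r hgm).enorm.pow_const 2).add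
        ((hUm r).enorm.pow_const 2))]
    simp_rw [dilate_div hr0]
    rfl
  have hlim := tendsto_integral_of_tendsto_lintegral_bound (μ := (volume : Measure ℂ))
    (l := (atTop : Filter ℝ))
    (k := fun r w => (bergmanScaled β r w : ℂ) * (g w * conj (U r (w / r))))
    (k₀ := fun w => (fockDensity β w : ℂ) * (g w * conj (weyl β z φ w))) (G := G) (G₀ := G₀)
    ?_ ?_ ?_ ?_ ?_ ?_ ?_
  · rw [fockInner, integral_fock hβ]
    refine hlim.congr' ?_
    filter_upwards [eventually_gt_atTop 0] with r hr
    rw [bergmanInner, integral_bergman_scaled hβ hr]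
    simp_rw [dilate_div hr]
    rfl
  · refine Eventually.of_forall fun r => Measurable.aestronglyMeasurable ?_
    exact (measurable_ofReal.comp (measurable_bergmanScaled β r)).mul
      (hgm.mul (continuous_conj.measurable.comp (hUm' r)))
  · refine Eventually.of_forall fun r => Measurable.aemeasurable ?_
    exact (measurable_bergmanScaled β r).ennreal_ofReal.mul
      ((hgm.enorm.pow_const 2).add ((hUm' r).enorm.pow_const 2))
  · refine Eventually.of_forall fun r => Eventually.of_forall fun w => ?_
    rw [enorm_mul, enorm_mul, RCLike.enorm_conj, ← ofReal_norm (bergmanScaled β r w : ℂ),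
      norm_real, Real.norm_of_nonneg (bergmanScaled_nonneg hβ r w)]
    exact mul_le_mul_right (enorm_mul_le_sq_add_sq _ _) _
  · refine Eventually.of_forall fun w => ?_
    exact ((continuous_ofReal.tendsto _).comp (tendsto_bergmanScaled hβ w)).mul
      (((continuous_conj.tendsto _).comp (hUlim w)).const_mul (g w))
  · refine Eventually.of_forall fun w => ?_
    refine ENNReal.Tendsto.mul (ENNReal.tendsto_ofReal (tendsto_bergmanScaled hβ w))
      (Or.inr (by simp [ENNReal.add_eq_top])) ?_ (Or.inr (by simp))
    exact tendsto_const_nhds.add (((ENNReal.continuous_pow 2).tendsto _).comp (hUlim w).enorm)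
  · rw [hG₀]
    exact ((tendsto_lintegral_dilate_sq hβ hg).add (tendsto_lintegral_dilate_sq hβ hφ)).congr' hG
  · rw [hG₀]
    exact ENNReal.add_ne_top.2 ⟨lintegral_sq_ne_top_of_memLp hg.2,
      lintegral_sq_ne_top_of_memLp hφ.2⟩

end Limits

/-! ### Convergence of the localization operators -/

section Convergence

variable {β : ℝ}

theorem rotate_dilate (c : Circle) (r : ℝ) (φ : ℂ → ℂ) :
    rotate c (dilate r φ) = dilate r (rotate c φ) := by
  funext ζ
  simp only [rotate, dilate]
  rw [mul_left_comm]

/-- The matrix coefficient `⟨g_r, U_z φ_{r,θ}⟩` at the point `z = w / r`, as a function of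
`(e^{iθ}, w)`. -/
noncomputable def scaledCoeff (β r : ℝ) (g φ : ℂ → ℂ) (p : Circle × ℂ) : ℂ :=
  bergmanInner (β * r ^ 2) (dilate r g)
    (bergmanU (β * r ^ 2) (p.2 / r) (rotate p.1 (dilate r φ)))

theorem measurable_scaledCoeff (hβ : 0 < β) (r : ℝ) {g φ : ℂ → ℂ} (hg : Measurable g)
    (hφ : Measurable φ) : Measurable (scaledCoeff β r g φ) :=
  (measurable_bergmanInner_bergmanU (by positivity) (measurable_dilate r hg)
    (measurable_dilate r hφ)).comp (f := fun p : Circle × ℂ => (p.1, p.2 / (r : ℂ))) (by fun_prop)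

theorem tendsto_scaledCoeff (hβ : 0 < β) {g φ : ℂ → ℂ} (hg : MemFock β g) (hφ : MemFock β φ)
    (p : Circle × ℂ) : Tendsto (fun r => scaledCoeff β r g φ p) atTop
      (𝓝 (fockInner β g (weyl β p.2 (rotate p.1 φ)))) := by
  unfold scaledCoeff
  simp_rw [rotate_dilate]
  exact tendsto_bergmanInner hβ hg (hφ.rotate hβ p.1) p.2

/-- Schur orthogonality in the Bergman space, transported to the disc of radius `r`. -/
theorem lintegral_scaledCoeff_sq (hβ : 0 < β) {r : ℝ} (hr : 0 < r) {g φ : ℂ → ℂ}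
    (hg : MemFock β g) (hφ : MemFock β φ) :
    ∫⁻ p, ENNReal.ofReal ((β * r ^ 2 + 1) * moebiusScaled r p.2) * ‖scaledCoeff β r g φ p‖ₑ ^ 2
        ∂(circleMeasure.prod volume) =
      (∫⁻ ζ, ‖dilate r g ζ‖ₑ ^ 2 ∂bergmanMeasure (β * r ^ 2)) *
        ∫⁻ ζ, ‖dilate r φ ζ‖ₑ ^ 2 ∂bergmanMeasure (β * r ^ 2) := by
  have hα : 0 ≤ β * r ^ 2 := by positivity
  have hgm := hg.1.continuous.measurable
  have hφm := hφ.1.continuous.measurable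
  have hA := measurable_scaledCoeff hβ r hgm hφm
  have hF : Measurable fun z : ℂ => ∫⁻ c : Circle, ‖bergmanInner (β * r ^ 2) (dilate r g)
      (bergmanU (β * r ^ 2) z (rotate c (dilate r φ)))‖ₑ ^ 2 ∂circleMeasure :=
    ((measurable_bergmanInner_bergmanU hα (measurable_dilate r hgm)
      (measurable_dilate r hφm)).enorm.pow_const 2).lintegral_prod_left'
  have h1 := lintegral_bergmanInner_sq hα (hg.dilate hβ r) (measurable_dilate r hgm)
    (hφ.dilate hβ r) (measurable_dilate r hφm)
  rw [lintegral_moebiusMeasure_scaled hr hF] at h1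
  have h2 : ENNReal.ofReal (β * r ^ 2 + 1) * ENNReal.ofReal (1 / (β * r ^ 2 + 1)) = 1 := by
    rw [← ENNReal.ofReal_mul (by positivity), mul_one_div_cancel (by positivity),
      ENNReal.ofReal_one]
  rw [← one_mul (lintegral _ _ * _), ← h2, mul_assoc, ← mul_assoc (ENNReal.ofReal (1 / _)), ← h1,
    ← lintegral_const_mul' _ _ (by simp), lintegral_prod_symm]
  · refine lintegral_congr fun w => ?_
    rw [← mul_assoc, ← ENNReal.ofReal_mul (by positivity),
      ← lintegral_const_mul' _ _ ENNReal.ofReal_ne_top]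
    rfl
  · exact ((((measurable_moebiusScaled r).comp measurable_snd).const_mul _).ennreal_ofReal.mul
      (hA.enorm.pow_const 2)).aemeasurable

/-- The integrand of the rescaled localization operator, with respect to `dθ/2π × dA`. -/
noncomputable def scaledIntegrand (β σ r : ℝ) (φ ψ : ℂ → ℂ) (f : Circle × ℂ → ℂ) (g h : ℂ → ℂ)
    (p : Circle × ℂ) : ℂ :=
  (((β * r ^ 2 + 1) * moebiusScaled r p.2 : ℝ) : ℂ) * ((((1 - ‖p.2‖ ^ 2 / r ^ 2) ^ σ : ℝ) : ℂ) *
    (f p * scaledCoeff β r g φ p * conj (scaledCoeff β r h ψ p)))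

/-- The majorant of `scaledIntegrand`; `M` bounds the symbol. -/
noncomputable def scaledMajorant (β r : ℝ) (M : ℝ≥0∞) (φ ψ g h : ℂ → ℂ) (p : Circle × ℂ) : ℝ≥0∞ :=
  M * (ENNReal.ofReal ((β * r ^ 2 + 1) * moebiusScaled r p.2) * ‖scaledCoeff β r g φ p‖ₑ ^ 2 +
    ENNReal.ofReal ((β * r ^ 2 + 1) * moebiusScaled r p.2) * ‖scaledCoeff β r h ψ p‖ₑ ^ 2)

theorem enorm_scaledIntegrand_le (hβ : 0 < β) {σ r : ℝ} (hσ : 0 ≤ σ) (φ ψ : ℂ → ℂ)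
    {f : Circle × ℂ → ℂ} (g h : ℂ → ℂ) {M : ℝ≥0∞} {p : Circle × ℂ} (hM : ‖f p‖ₑ ≤ M) :
    ‖scaledIntegrand β σ r φ ψ f g h p‖ₑ ≤ scaledMajorant β r M φ ψ g h p := by
  -- outside the disc of radius `r` both sides vanish, whatever the junk value of the power
  by_cases hp : ‖p.2‖ < r
  · have h1 := one_sub_norm_sq_div_pos hp
    have h2 : ‖(((1 - ‖p.2‖ ^ 2 / r ^ 2) ^ σ : ℝ) : ℂ)‖ₑ ≤ 1 := by
      rw [← ofReal_norm, norm_real, Real.norm_of_nonneg (by positivity), ENNReal.ofReal_le_one]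
      exact Real.rpow_le_one h1.le (by linarith [show 0 ≤ ‖p.2‖ ^ 2 / r ^ 2 by positivity]) hσ
    have h3 : 0 ≤ (β * r ^ 2 + 1) * moebiusScaled r p.2 :=
      mul_nonneg (by positivity) (moebiusScaled_nonneg r _)
    rw [scaledIntegrand, scaledMajorant, ← mul_add, enorm_mul, enorm_mul, enorm_mul, enorm_mul,
      RCLike.enorm_conj, ← ofReal_norm ((((β * r ^ 2 + 1) * moebiusScaled r p.2 : ℝ)) : ℂ),
      norm_real, Real.norm_of_nonneg h3, mul_left_comm M]
    refine mul_le_mul_right ?_ _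
    refine (mul_le_mul_left h2 _).trans ?_
    rw [one_mul, mul_assoc]
    exact mul_le_mul' hM (enorm_mul_le_sq_add_sq _ _)
  · rw [scaledIntegrand, moebiusScaled, if_neg hp]
    simp

theorem aestronglyMeasurable_scaledIntegrand (hβ : 0 < β) (σ r : ℝ) {φ ψ g h : ℂ → ℂ}
    (hφ : Measurable φ) (hψ : Measurable ψ) (hg : Measurable g) (hh : Measurable h)
    {f : Circle × ℂ → ℂ} (hf : AEStronglyMeasurable f (circleMeasure.prod volume)) :
    AEStronglyMeasurable (scaledIntegrand β σ r φ ψ f g h) (circleMeasure.prod volume) := by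
  have h1 : Measurable fun p : Circle × ℂ => (((β * r ^ 2 + 1) * moebiusScaled r p.2 : ℝ) : ℂ) :=
    measurable_ofReal.comp (((measurable_moebiusScaled r).comp measurable_snd).const_mul _)
  have h2 : Measurable fun p : Circle × ℂ => (((1 - ‖p.2‖ ^ 2 / r ^ 2) ^ σ : ℝ) : ℂ) := by
    fun_prop
  have hA := measurable_scaledCoeff hβ r hg hφ
  have hB := continuous_conj.measurable.comp (measurable_scaledCoeff hβ r hh hψ)
  exact h1.aestronglyMeasurable.mul (h2.aestronglyMeasurable.mul
    ((hf.mul hA.aestronglyMeasurable).mul hB.aestronglyMeasurable))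

theorem measurable_scaledMajorant (hβ : 0 < β) (r : ℝ) (M : ℝ≥0∞) {φ ψ g h : ℂ → ℂ}
    (hφ : Measurable φ) (hψ : Measurable ψ) (hg : Measurable g) (hh : Measurable h) :
    Measurable (scaledMajorant β r M φ ψ g h) := by
  have h1 : Measurable fun p : Circle × ℂ =>
      ENNReal.ofReal ((β * r ^ 2 + 1) * moebiusScaled r p.2) :=
    (((measurable_moebiusScaled r).comp measurable_snd).const_mul _).ennreal_ofReal
  exact ((h1.mul ((measurable_scaledCoeff hβ r hg hφ).enorm.pow_const 2)).add
    (h1.mul ((measurable_scaledCoeff hβ r hh hψ).enorm.pow_const 2))).const_mul M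

theorem lintegral_scaledMajorant (hβ : 0 < β) {r : ℝ} (hr : 0 < r) {M : ℝ≥0∞} (hM : M ≠ ∞)
    {φ ψ g h : ℂ → ℂ} (hφ : MemFock β φ) (hψ : MemFock β ψ) (hg : MemFock β g)
    (hh : MemFock β h) :
    ∫⁻ p, scaledMajorant β r M φ ψ g h p ∂(circleMeasure.prod volume) =
      M * ((∫⁻ ζ, ‖dilate r g ζ‖ₑ ^ 2 ∂bergmanMeasure (β * r ^ 2)) *
          (∫⁻ ζ, ‖dilate r φ ζ‖ₑ ^ 2 ∂bergmanMeasure (β * r ^ 2)) +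
        (∫⁻ ζ, ‖dilate r h ζ‖ₑ ^ 2 ∂bergmanMeasure (β * r ^ 2)) *
          ∫⁻ ζ, ‖dilate r ψ ζ‖ₑ ^ 2 ∂bergmanMeasure (β * r ^ 2)) := by
  have h1 : Measurable fun p : Circle × ℂ =>
      ENNReal.ofReal ((β * r ^ 2 + 1) * moebiusScaled r p.2) * ‖scaledCoeff β r g φ p‖ₑ ^ 2 :=
    (((measurable_moebiusScaled r).comp measurable_snd).const_mul _).ennreal_ofReal.mul
      ((measurable_scaledCoeff hβ r hg.1.continuous.measurable
        hφ.1.continuous.measurable).enorm.pow_const 2)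
  unfold scaledMajorant
  rw [lintegral_const_mul' _ _ hM, lintegral_add_left h1,
    lintegral_scaledCoeff_sq hβ hr hg hφ, lintegral_scaledCoeff_sq hβ hr hh hψ]

/-- The change of variables `z = w / r` in the integral defining the localization operator. -/
theorem integral_scaledIntegrand {σ r : ℝ} (hr : 0 < r) {φ ψ g h : ℂ → ℂ}
    {f : Circle × ℂ → ℂ}
    (hint : Integrable (scaledIntegrand β σ r φ ψ f g h) (circleMeasure.prod volume)) :
    (((β * r ^ 2 : ℝ) : ℂ) + 1) * ∫ c, ∫ z, bergmanIntegrand (β * r ^ 2) (dilate r φ) (dilate r ψ)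
        (dilateSymbol r σ f) (dilate r g) (dilate r h) (c, z) ∂moebiusMeasure ∂circleMeasure =
      ∫ p, scaledIntegrand β σ r φ ψ f g h p ∂(circleMeasure.prod volume) := by
  have hr' : (r : ℂ) ≠ 0 := by exact_mod_cast hr.ne'
  rw [integral_prod _ hint, ← integral_const_mul]
  refine integral_congr_ae (Eventually.of_forall fun c => ?_)
  simp only
  rw [integral_moebiusMeasure_scaled hr, ← integral_const_mul]
  refine integral_congr_ae (Eventually.of_forall fun w => ?_)
  simp only [scaledIntegrand, bergmanIntegrand, dilateSymbol, scaledCoeff]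
  rw [mul_div_cancel₀ _ hr', norm_div_ofReal_sq, bergmanInner_conj]
  push_cast
  ring

theorem tendsto_scaledIntegrand (hβ : 0 < β) (σ : ℝ) {φ ψ g h : ℂ → ℂ} (hφ : MemFock β φ)
    (hψ : MemFock β ψ) (hg : MemFock β g) (hh : MemFock β h) (f : Circle × ℂ → ℂ)
    (p : Circle × ℂ) : Tendsto (fun r => scaledIntegrand β σ r φ ψ f g h p) atTop
      (𝓝 ((β / Real.pi : ℂ) * fockIntegrand β φ ψ f g h p)) := by
  have h1 : Tendsto (fun r : ℝ => (((β * r ^ 2 + 1) * moebiusScaled r p.2 : ℝ) : ℂ)) atTop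
      (𝓝 (β / Real.pi : ℂ)) := by
    have := (continuous_ofReal.tendsto _).comp (tendsto_moebiusScaled β p.2)
    rwa [ofReal_div] at this
  have h2 : Tendsto (fun r : ℝ => (((1 - ‖p.2‖ ^ 2 / r ^ 2) ^ σ : ℝ) : ℂ)) atTop (𝓝 1) := by
    have h3 : Tendsto (fun r : ℝ => 1 - ‖p.2‖ ^ 2 / r ^ 2) atTop (𝓝 1) := by
      simpa [div_eq_mul_inv] using (tendsto_inv_sq_atTop.const_mul (‖p.2‖ ^ 2)).const_sub 1
    have h4 := (continuous_ofReal.tendsto _).comp (h3.rpow_const (p := σ) (Or.inl one_ne_zero))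
    simpa [Function.comp_def] using h4
  have h5 := ((tendsto_scaledCoeff hβ hg hφ p).const_mul (f p)).mul
    ((continuous_conj.tendsto _).comp (tendsto_scaledCoeff hβ hh hψ p))
  have h6 := h1.mul (h2.mul h5)
  rw [one_mul, fockInner_conj] at h6
  exact h6

theorem tendsto_integral_bergmanIntegrand (hβ : 0 < β) {σ : ℝ} (hσ : 0 ≤ σ) {φ ψ g h : ℂ → ℂ}
    (hφ : MemFock β φ) (hψ : MemFock β ψ) (hg : MemFock β g) (hh : MemFock β h)
    {f : Circle × ℂ → ℂ} (hf : MemLp f ∞ (circleMeasure.prod (volume : Measure ℂ)))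
    (hint : Integrable (fockIntegrand β φ ψ f g h) (circleMeasure.prod volume)) :
    Tendsto (fun r : ℝ => (((β * r ^ 2 : ℝ) : ℂ) + 1) * ∫ c, ∫ z,
        bergmanIntegrand (β * r ^ 2) (dilate r φ) (dilate r ψ) (dilateSymbol r σ f) (dilate r g)
          (dilate r h) (c, z) ∂moebiusMeasure ∂circleMeasure) atTop
      (𝓝 ((β / Real.pi : ℂ) *
        ∫ c, ∫ z, fockIntegrand β φ ψ f g h (c, z) ∂volume ∂circleMeasure)) := by
  have hφm := hφ.1.continuous.measurable
  have hψm := hψ.1.continuous.measurable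
  have hgm := hg.1.continuous.measurable
  have hhm := hh.1.continuous.measurable
  set M : ℝ≥0∞ := eLpNormEssSup f (circleMeasure.prod volume)
  have hM : M ≠ ∞ := by
    have := hf.2.ne
    rwa [eLpNorm_exponent_top] at this
  have hfM : ∀ᵐ p ∂(circleMeasure.prod volume), ‖f p‖ₑ ≤ M := enorm_ae_le_eLpNormEssSup f _
  set N : (ℂ → ℂ) → ℝ≥0∞ := fun u => ∫⁻ ζ, ‖u ζ‖ₑ ^ 2 ∂fockMeasure β
  have hN : ∀ {u : ℂ → ℂ}, MemFock β u → N u ≠ ∞ := fun hu => lintegral_sq_ne_top_of_memLp hu.2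
  have hmeas := fun r : ℝ => aestronglyMeasurable_scaledIntegrand hβ σ r hφm hψm hgm hhm hf.1
  have hbound : ∀ r : ℝ, ∀ᵐ p ∂(circleMeasure.prod volume),
      ‖scaledIntegrand β σ r φ ψ f g h p‖ₑ ≤ scaledMajorant β r M φ ψ g h p := fun r =>
    hfM.mono fun p hp => enorm_scaledIntegrand_le hβ hσ φ ψ g h hp
  set A : Circle × ℂ → ℂ := fun p => fockInner β g (weyl β p.2 (rotate p.1 φ))
  set B : Circle × ℂ → ℂ := fun p => fockInner β h (weyl β p.2 (rotate p.1 ψ))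
  set b : ℝ≥0∞ := ENNReal.ofReal (β / Real.pi)
  set G₀ : Circle × ℂ → ℝ≥0∞ := fun p => M * (b * ‖A p‖ₑ ^ 2 + b * ‖B p‖ₑ ^ 2)
  have hb : b * ENNReal.ofReal (Real.pi / β) = 1 := by
    have := Real.pi_pos
    rw [← ENNReal.ofReal_mul (by positivity), div_mul_div_cancel₀ (by positivity),
      div_self (by positivity), ENNReal.ofReal_one]
  have hG₀ : ∫⁻ p, G₀ p ∂(circleMeasure.prod volume) = M * (N g * N φ + N h * N ψ) := by
    rw [lintegral_const_mul' _ _ hM, lintegral_add_left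
        (((measurable_fockInner_weyl hβ hgm hφm).enorm.pow_const 2).const_mul b),
      lintegral_const_mul' _ _ (by simp [b]), lintegral_const_mul' _ _ (by simp [b]),
      lintegral_prod_fockInner_sq hβ hg hφ, lintegral_prod_fockInner_sq hβ hh hψ,
      ← mul_assoc, ← mul_assoc, ← mul_assoc, ← mul_assoc, hb, one_mul, one_mul]
  have hGtend : Tendsto (fun r : ℝ => ∫⁻ p, scaledMajorant β r M φ ψ g h p
      ∂(circleMeasure.prod volume)) atTop (𝓝 (∫⁻ p, G₀ p ∂(circleMeasure.prod volume))) := by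
    rw [hG₀]
    have h1 := ENNReal.Tendsto.mul (tendsto_lintegral_dilate_sq hβ hg) (Or.inr (hN hφ))
      (tendsto_lintegral_dilate_sq hβ hφ) (Or.inr (hN hg))
    have h2 := ENNReal.Tendsto.mul (tendsto_lintegral_dilate_sq hβ hh) (Or.inr (hN hψ))
      (tendsto_lintegral_dilate_sq hβ hψ) (Or.inr (hN hh))
    refine (ENNReal.Tendsto.const_mul (h1.add h2) (Or.inr hM)).congr' ?_
    filter_upwards [eventually_gt_atTop 0] with r hr
    rw [lintegral_scaledMajorant hβ hr hM hφ hψ hg hh]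
  have hfin : ∫⁻ p, G₀ p ∂(circleMeasure.prod volume) ≠ ∞ := by
    rw [hG₀]
    exact ENNReal.mul_ne_top hM (ENNReal.add_ne_top.2
      ⟨ENNReal.mul_ne_top (hN hg) (hN hφ), ENNReal.mul_ne_top (hN hh) (hN hψ)⟩)
  have hlim := tendsto_integral_of_tendsto_lintegral_bound (G₀ := G₀)
    (Eventually.of_forall hmeas) (Eventually.of_forall fun r =>
      (measurable_scaledMajorant hβ r M hφm hψm hgm hhm).aemeasurable)
    (Eventually.of_forall hbound)
    (Eventually.of_forall (tendsto_scaledIntegrand hβ σ hφ hψ hg hh f))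
    (Eventually.of_forall fun p => ?_) hGtend hfin
  · rw [integral_const_mul, integral_prod _ hint] at hlim
    refine hlim.congr' ?_
    filter_upwards [eventually_gt_atTop 0, hGtend.eventually_lt_const hfin.lt_top] with r hr hr2
    exact (integral_scaledIntegrand hr
      ⟨hmeas r, (lintegral_mono_ae (hbound r)).trans_lt hr2⟩).symm
  · have h1 := ENNReal.tendsto_ofReal (tendsto_moebiusScaled β p.2)
    have h2 : ∀ {u v : ℂ → ℂ}, MemFock β u → MemFock β v → Tendsto (fun r : ℝ =>
        ENNReal.ofReal ((β * r ^ 2 + 1) * moebiusScaled r p.2) * ‖scaledCoeff β r u v p‖ₑ ^ 2)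
        atTop (𝓝 (b * ‖fockInner β u (weyl β p.2 (rotate p.1 v))‖ₑ ^ 2)) := fun hu hv =>
      ENNReal.Tendsto.mul h1 (Or.inr (by simp))
        (((ENNReal.continuous_pow 2).tendsto _).comp (tendsto_scaledCoeff hβ hu hv p).enorm)
        (Or.inr (by simp [b]))
    exact ENNReal.Tendsto.const_mul ((h2 hg hφ).add (h2 hh hψ)) (Or.inr hM)

end Convergence

theorem fockIntegrand_toSpace {β : ℝ} (φ ψ : ℂ → ℂ) (f : Circle × ℂ → ℂ) {g h : ℂ → ℂ}
    (hg : MemFock β g) (hh : MemFock β h) :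
    fockIntegrand β φ ψ f hg.toSpace.1 hh.toSpace.1 = fockIntegrand β φ ψ f g h := by
  funext p
  have hg' : hg.toSpace.1 =ᵐ[fockMeasure β] g := hg.2.coeFn_toLp
  have hh' : hh.toSpace.1 =ᵐ[fockMeasure β] h := hh.2.coeFn_toLp
  rw [fockIntegrand, fockIntegrand, fockInner_congr_left hg',
    ← fockInner_conj β hh.toSpace.1, fockInner_congr_left hh', fockInner_conj]

theorem bergmanIntegrand_toSpace {α : ℝ} (φ ψ : ℂ → ℂ) (f : Circle × ℂ → ℂ) {g h : ℂ → ℂ}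
    (hg : MemBergman α g) (hh : MemBergman α h) :
    bergmanIntegrand α φ ψ f hg.toSpace.1 hh.toSpace.1 = bergmanIntegrand α φ ψ f g h := by
  funext p
  have hg' : hg.toSpace.1 =ᵐ[bergmanMeasure α] g := hg.2.coeFn_toLp
  have hh' : hh.toSpace.1 =ᵐ[bergmanMeasure α] h := hh.2.coeFn_toLp
  rw [bergmanIntegrand, bergmanIntegrand, bergmanInner_congr_left hg',
    ← bergmanInner_conj α hh.toSpace.1, bergmanInner_congr_left hh',
    bergmanInner_conj]

theorem theorem4p3 (β : ℝ) (hβ : 0 < β) (φ ψ : ℂ → ℂ) (hφ : MemFock β φ) (hψ : MemFock β ψ)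
    (f : Circle × ℂ → ℂ) (hf : MemLp f ∞ (circleMeasure.prod (volume : Measure ℂ)))
    (σ : ℝ) (hσ : 0 ≤ σ) :
    IsFockLocalization β φ ψ f (fockLocalization β φ ψ f) ∧
    (∀ r : ℝ, 0 < r →
      IsBergmanLocalization (β * r ^ 2) (dilate r φ) (dilate r ψ) (dilateSymbol r σ f)
        (bergmanLocalization (β * r ^ 2) (dilate r φ) (dilate r ψ) (dilateSymbol r σ f))) ∧
    ∀ (g h : ℂ → ℂ) (hg : MemFock β g) (hh : MemFock β h),
      Tendsto
        (fun r : ℝ =>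
          inner ℂ (hh.dilate hβ r).toSpace
            (bergmanLocalization (β * r ^ 2) (dilate r φ) (dilate r ψ) (dilateSymbol r σ f)
              (hg.dilate hβ r).toSpace))
        atTop
        (𝓝 (inner ℂ hh.toSpace (fockLocalization β φ ψ f hg.toSpace))) := by
  have hF := isFockLocalization_fockLocalization hβ hφ hψ hf
  have hB : ∀ r : ℝ, 0 < r →
      IsBergmanLocalization (β * r ^ 2) (dilate r φ) (dilate r ψ) (dilateSymbol r σ f)
        (bergmanLocalization (β * r ^ 2) (dilate r φ) (dilate r ψ) (dilateSymbol r σ f)) :=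
    fun r hr => isBergmanLocalization_bergmanLocalization (by positivity) (hφ.dilate hβ r)
      (measurable_dilate r hφ.1.continuous.measurable) (hψ.dilate hβ r)
      (measurable_dilate r hψ.1.continuous.measurable) (memLp_dilateSymbol hf hr hσ)
  refine ⟨hF, hB, fun g h hg hh => ?_⟩
  obtain ⟨h1, h2⟩ := hF hg.toSpace hh.toSpace
  rw [fockIntegrand_toSpace] at h1 h2
  rw [h2]
  refine (tendsto_integral_bergmanIntegrand hβ hσ hφ hψ hg hh hf h1).congr' ?_
  filter_upwards [eventually_gt_atTop 0] with r hr
  rw [(hB r hr _ _).2, bergmanIntegrand_toSpace]
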